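/- Let $n\ge 3$ and let $(M^n,g)$ be a smooth, connected, complete Riemannian manifold with one asymptotically Euclidean end: there are an open set $E\subset M$ with $M\setminus E$ compact, a radius $R>0$ and a smooth diffeomorphism $\Phi:E\to\mathbb R^n\setminus\overline{B_R(0)}$ such that the components $g_{ab}$ of $g$ in the coordinates $\Phi$ satisfy $g_{ab}-\delta_{ab}\in W^{k,p}_{-\tau}(\mathbb R^n\setminus\overline{B_R(0)})$, that is, $$\sigma^{\tau+j-n/p}\,|\nabla^j(g_{ab}-\delta_{ab})|\in L^p(\mathbb R^n\setminus \overline{B_R(0)})\quad\text{for } 0\le j\le k,\qquad \sigma=\sqrt{1+|x|^2}\ \ (n/p=0 \text{ if } p=\infty),$$ where $\tau>\max\{0,\tfrac{n-4}{2}\}$ and either $k\ge 5$ and $n<p\le\infty$, or $k\ge4$ and $p=\infty$ (the latter with $k=4$ being $g_{ab}-\delta_{ab}=O_4(|x|^{-\tau})$). Let $$Q_g=-\tfrac{1}{2(n-1)}\Delta_gR_g-\tfrac{2}{(n-2)^2}|\mathrm{Ric}_g|_g^2+\tfrac{n^3-4n^2+16n-16}{8(n-1)^2(n-2)^2}R_g^2$$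 be the $Q$-curvature, and assume $Q_g\in L^1(M,dV_g)$. Let $S_g=\frac1{n-2}\big(\mathrm{Ric}_g-\frac{1}{2(n-1)}R_g\,g\big)$ be the Schouten tensor, $\overset{\circ}{S}_g$ its traceless part, $(S_g\times S_g)_{ij}=S_i^kS_{kj}$, $W$ the Weyl tensor, $B_{ij}=\nabla^k(\nabla_kS_{ij}-\nabla_iS_{kj})+W_{kilj}S^{kl}$ the Bach tensor, $$T_g=(n-2)\big(\nabla^2\mathrm{tr}_gS_g-\tfrac1n g\,\Delta_g\mathrm{tr}_gS_g\big)+4(n-1)\big(S_g\times S_g-\tfrac1n|S_g|_g^2g\big)-n^2(\mathrm{tr}_gS_g)\overset{\circ}{S}_g,$$ $$J_g=\tfrac1nQ_g\,g-\tfrac1{n-2}B_g-\tfrac{n-4}{4(n-1)(n-2)}T_g,\qquad G_{J_g}=J_g-\tfrac14Q_g\,g .$$ Let $S_r$ be the coordinate sphere of radius $r$ in the coordinates $\Phi$, with Euclidean outward unit normal $\nu$ and Euclidean surface measure $d\omega$. Then the limits $$\mathcal E(g)=\lim_{r\to\infty}\int_{S_r}\big(\partial_j\partial_i\partial_ig_{aa}-\partial_j\partial_a\partial_ig_{ai}\big)\nu^j\,d\omega\qquad\text{and}\qquad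 \lim_{r\to\infty}\int_{S_r}G_{J_g}(r\partial_r,\nu)\,d\omega$$ exist and are finite, and $$\frac{n-4}{8(n-1)}\,\mathcal E(g)=-\lim_{r\to\infty}\int_{S_r}G_{J_g}(r\partial_r,\nu)\,d\omega .$$ In particular, if moreover $J_g=0$ on $M$, then $\mathcal E(g)=0$. -/

import Mathlib

open Set Filter Topology MeasureTheory Bundle Manifold
open scoped ENNReal ContDiff

noncomputable section

namespace AEGeom

/-- Euclidean space `ℝⁿ`, with coordinates `x¹, …, xⁿ`. -/
abbrev Eu (n : ℕ) : Type := EuclideanSpace ℝ (Fin n)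

/-! ### Local tensor calculus

Tensor fields on an open set of `ℝⁿ` are given by their components.  `g` is the matrix-valued
function of components `g_{ij}` of a metric. -/

section Coordinates

variable {n : ℕ}

/-- The partial derivative `∂_i f`. -/
def pd (i : Fin n) (f : Eu n → ℝ) (x : Eu n) : ℝ :=
  fderiv ℝ f x (EuclideanSpace.single i 1)

/-- The components `g^{ij}` of the inverse metric. -/
def ginv (g : Eu n → Matrix (Fin n) (Fin n) ℝ) (i j : Fin n) (x : Eu n) : ℝ :=
  (g x)⁻¹ i j

/-- The Christoffel symbols
`Γ^k_{ij} = (1/2) g^{kl} (∂_i g_{jl} + ∂_j g_{il} - ∂_l g_{ij})`. -/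
def christoffel (g : Eu n → Matrix (Fin n) (Fin n) ℝ) (k i j : Fin n) (x : Eu n) : ℝ :=
  (1 / 2) * ∑ l, ginv g k l x *
    (pd i (fun y => g y j l) x + pd j (fun y => g y i l) x - pd l (fun y => g y i j) x)

/-- The curvature tensor `R^i_{jkl} = dx^i (R(∂_k, ∂_l) ∂_j)`, where
`R(X,Y)Z = ∇_X ∇_Y Z - ∇_Y ∇_X Z - ∇_{[X,Y]} Z`. -/
def riem (g : Eu n → Matrix (Fin n) (Fin n) ℝ) (i j k l : Fin n) (x : Eu n) : ℝ :=
  pd k (christoffel g i l j) x - pd l (christoffel g i k j) x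
    + ∑ m, (christoffel g i k m x * christoffel g m l j x
      - christoffel g i l m x * christoffel g m k j x)

/-- The curvature tensor with its first index lowered, `R_{ijkl} = g_{im} R^m_{jkl}`. -/
def riemLow (g : Eu n → Matrix (Fin n) (Fin n) ℝ) (i j k l : Fin n) (x : Eu n) : ℝ :=
  ∑ m, g x i m * riem g m j k l x

/-- The Ricci tensor `Ric_{ij} = R^k_{ikj}` (positive on round spheres). -/
def ric (g : Eu n → Matrix (Fin n) (Fin n) ℝ) (i j : Fin n) (x : Eu n) : ℝ :=
  ∑ k, riem g k i k j x

/-- The trace `g^{ij} T_{ij}` of a `(0,2)`-tensor. -/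
def trace2 (g : Eu n → Matrix (Fin n) (Fin n) ℝ) (T : Fin n → Fin n → Eu n → ℝ)
    (x : Eu n) : ℝ :=
  ∑ i, ∑ j, ginv g i j x * T i j x

/-- The product `(T × T)_{ij} = g^{kl} T_{ik} T_{lj}` of a symmetric `(0,2)`-tensor with
itself. -/
def sq2 (g : Eu n → Matrix (Fin n) (Fin n) ℝ) (T : Fin n → Fin n → Eu n → ℝ)
    (i j : Fin n) (x : Eu n) : ℝ :=
  ∑ k, ∑ l, ginv g k l x * T i k x * T l j x

/-- The squared norm `|T|²_g = g^{ik} g^{jl} T_{ij} T_{kl}` of a `(0,2)`-tensor. -/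
def normSq2 (g : Eu n → Matrix (Fin n) (Fin n) ℝ) (T : Fin n → Fin n → Eu n → ℝ)
    (x : Eu n) : ℝ :=
  ∑ i, ∑ j, ∑ k, ∑ l, ginv g i k x * ginv g j l x * T i j x * T k l x

/-- The scalar curvature `R_g`. -/
def scal (g : Eu n → Matrix (Fin n) (Fin n) ℝ) : Eu n → ℝ :=
  trace2 g (ric g)

/-- The Hessian `∇_i ∇_j f = ∂_i ∂_j f - Γ^k_{ij} ∂_k f`. -/
def hess (g : Eu n → Matrix (Fin n) (Fin n) ℝ) (f : Eu n → ℝ) (i j : Fin n) (x : Eu n) : ℝ :=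
  pd i (pd j f) x - ∑ k, christoffel g k i j x * pd k f x

/-- The Laplace–Beltrami operator on functions, `Δ_g f = g^{ij} ∇_i ∇_j f`. -/
def lap (g : Eu n → Matrix (Fin n) (Fin n) ℝ) (f : Eu n → ℝ) : Eu n → ℝ :=
  trace2 g (hess g f)

/-- The covariant derivative `∇_k T_{ij}` of a `(0,2)`-tensor. -/
def cov2 (g : Eu n → Matrix (Fin n) (Fin n) ℝ) (T : Fin n → Fin n → Eu n → ℝ)
    (k i j : Fin n) (x : Eu n) : ℝ :=
  pd k (T i j) x - ∑ m, (christoffel g m k i x * T m j x + christoffel g m k j x * T i m x)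

/-- The covariant derivative `∇_l T_{kij}` of a `(0,3)`-tensor. -/
def cov3 (g : Eu n → Matrix (Fin n) (Fin n) ℝ) (T : Fin n → Fin n → Fin n → Eu n → ℝ)
    (l k i j : Fin n) (x : Eu n) : ℝ :=
  pd l (T k i j) x - ∑ m, (christoffel g m l k x * T m i j x
    + christoffel g m l i x * T k m j x + christoffel g m l j x * T k i m x)

/-- The Schouten tensor `S = (1/(n-2)) (Ric - R g / (2(n-1)))`. -/
def schouten (g : Eu n → Matrix (Fin n) (Fin n) ℝ) (i j : Fin n) (x : Eu n) : ℝ :=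
  1 / ((n : ℝ) - 2) * (ric g i j x - 1 / (2 * ((n : ℝ) - 1)) * scal g x * g x i j)

/-- The Weyl tensor
`W_{ijkl} = R_{ijkl} - (g_{ik} S_{jl} + g_{jl} S_{ik} - g_{il} S_{jk} - g_{jk} S_{il})`. -/
def weyl (g : Eu n → Matrix (Fin n) (Fin n) ℝ) (i j k l : Fin n) (x : Eu n) : ℝ :=
  riemLow g i j k l x - (g x i k * schouten g j l x + g x j l * schouten g i k x
    - g x i l * schouten g j k x - g x j k * schouten g i l x)

/-- The Cotton tensor `C_{kij} = ∇_k S_{ij} - ∇_i S_{kj}`. -/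
def cotton (g : Eu n → Matrix (Fin n) (Fin n) ℝ) (k i j : Fin n) (x : Eu n) : ℝ :=
  cov2 g (schouten g) k i j x - cov2 g (schouten g) i k j x

/-- The Bach tensor `B_{ij} = ∇^k C_{kij} + W_{kilj} S^{kl}`.  It is equal to
`∇^k ∇^l W_{kilj} / (n-3) + W_{kilj} S^{kl}` in dimension `n ≥ 4`. -/
def bach (g : Eu n → Matrix (Fin n) (Fin n) ℝ) (i j : Fin n) (x : Eu n) : ℝ :=
  (∑ k, ∑ l, ginv g k l x * cov3 g (cotton g) l k i j x)
    + ∑ k, ∑ l, ∑ a, ∑ b,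
        weyl g k i l j x * ginv g k a x * ginv g l b x * schouten g a b x

/-- The `Q`-curvature
`Q = - Δ R / (2(n-1)) - 2 |Ric|² / (n-2)² + (n³-4n²+16n-16) R² / (8 (n-1)² (n-2)²)`. -/
def qcurv (g : Eu n → Matrix (Fin n) (Fin n) ℝ) (x : Eu n) : ℝ :=
  -(1 / (2 * ((n : ℝ) - 1))) * lap g (scal g) x
    - 2 / ((n : ℝ) - 2) ^ 2 * normSq2 g (ric g) x
    + ((n : ℝ) ^ 3 - 4 * (n : ℝ) ^ 2 + 16 * (n : ℝ) - 16)
        / (8 * ((n : ℝ) - 1) ^ 2 * ((n : ℝ) - 2) ^ 2) * scal g x ^ 2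

/-- The tensor
`T = (n-2) (∇² tr S - (1/n) g Δ tr S) + 4(n-1) (S × S - (1/n) |S|² g) - n² (tr S) S°`,
where `S° = S - (1/n) (tr S) g` is the traceless part of `S`. -/
def tTensor (g : Eu n → Matrix (Fin n) (Fin n) ℝ) (i j : Fin n) (x : Eu n) : ℝ :=
  ((n : ℝ) - 2) * (hess g (trace2 g (schouten g)) i j x
      - 1 / (n : ℝ) * g x i j * lap g (trace2 g (schouten g)) x)
    + 4 * ((n : ℝ) - 1) * (sq2 g (schouten g) i j x
      - 1 / (n : ℝ) * normSq2 g (schouten g) x * g x i j)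
    - (n : ℝ) ^ 2 * trace2 g (schouten g) x
      * (schouten g i j x - 1 / (n : ℝ) * trace2 g (schouten g) x * g x i j)

/-- The `J`-tensor `J = (1/n) Q g - (1/(n-2)) B - (n-4)/(4(n-1)(n-2)) T`. -/
def jTensor (g : Eu n → Matrix (Fin n) (Fin n) ℝ) (i j : Fin n) (x : Eu n) : ℝ :=
  1 / (n : ℝ) * qcurv g x * g x i j - 1 / ((n : ℝ) - 2) * bach g i j x
    - ((n : ℝ) - 4) / (4 * ((n : ℝ) - 1) * ((n : ℝ) - 2)) * tTensor g i j x

/-- The `J`-Einstein tensor `G_J = J - (1/4) Q g`. -/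
def jEinstein (g : Eu n → Matrix (Fin n) (Fin n) ℝ) (i j : Fin n) (x : Eu n) : ℝ :=
  jTensor g i j x - 1 / 4 * qcurv g x * g x i j

/-! ### Integrals over large coordinate spheres -/

/-- `∫_{S_r} f dω_δ`: the integral of `f` over the Euclidean sphere of radius `r` centred at the
origin, with respect to the Euclidean surface measure, written over the unit sphere. -/
def sphereIntegral (r : ℝ) (f : Eu n → ℝ) : ℝ :=
  r ^ (n - 1) * ∫ θ : Metric.sphere (0 : Eu n) 1, f (r • (θ : Eu n)) ∂(volume.toSphere)

/-- The integral
`∫_{S_r} (∂_j ∂_i ∂_i g_{aa} - ∂_j ∂_a ∂_i g_{ai}) ν^j dω_δ`, with `ν = x / |x|` the Euclidean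
outward unit normal.  The fourth-order energy is its limit as `r → ∞`. -/
def energyFlux (g : Eu n → Matrix (Fin n) (Fin n) ℝ) (r : ℝ) : ℝ :=
  sphereIntegral r fun x => ∑ j, (∑ i, ∑ a,
    (pd j (pd i (pd i fun y => g y a a)) x - pd j (pd a (pd i fun y => g y a i)) x))
      * (x j / ‖x‖)

/-- The integral `∫_{S_r} G_J(X, ν) dω_δ`, where `X = r ∂_r = x^i ∂_i` and `ν = x / |x|`. -/
def jEinsteinFlux (g : Eu n → Matrix (Fin n) (Fin n) ℝ) (r : ℝ) : ℝ :=
  sphereIntegral r fun x => ∑ i, ∑ j, jEinstein g i j x * x i * (x j / ‖x‖)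

/-! ### Weighted Sobolev spaces -/

/-- Membership of a smooth function `u` on the open set `Ω` in the weighted Sobolev space
`W^{k,p}_δ(Ω)`: for every `0 ≤ j ≤ k` the weighted norm `‖∇^j u‖_{p,δ-j}` is finite, that is,
`|∇^j u| σ^{-(δ-j)-n/p} ∈ L^p(Ω)`, where `σ = (1 + |x|²)^{1/2}` (and `n/p = 0` for `p = ∞`). -/
def WeightedSobolev (k : ℕ) (p : ℝ≥0∞) (δ : ℝ) (Ω : Set (Eu n)) (u : Eu n → ℝ) : Prop :=
  ContDiffOn ℝ ∞ u Ω ∧ ∀ j ≤ k,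
    MemLp (fun x => ‖iteratedFDeriv ℝ j u x‖
      * Real.sqrt (1 + ‖x‖ ^ 2) ^ (-(δ - (j : ℝ)) - (n : ℝ) / p.toReal)) p (volume.restrict Ω)

end Coordinates

/-! ### Riemannian manifolds -/

section Manifolds

variable {n : ℕ} {M : Type*} [TopologicalSpace M] [ChartedSpace (Eu n) M]
  [RiemannianBundle (fun x : M => TangentSpace (𝓡 n) x)]

/-- The components in the chart `e` of the Riemannian metric `g`: the matrix
`((e⁻¹)^* g)_{ab}(y) = g (d(e⁻¹)_y ∂_a, d(e⁻¹)_y ∂_b)` for `y ∈ e.target`. -/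
def metricInChart (e : OpenPartialHomeomorph M (Eu n)) (y : Eu n) :
    Matrix (Fin n) (Fin n) ℝ :=
  Matrix.of fun a b =>
    inner ℝ (mfderiv (𝓡 n) (𝓡 n) e.symm y (EuclideanSpace.single a (1 : ℝ) : Eu n))
      (mfderiv (𝓡 n) (𝓡 n) e.symm y (EuclideanSpace.single b (1 : ℝ) : Eu n))

variable (n M) in
/-- The `Q`-curvature as a function on the Riemannian manifold `M`, computed at `x` in the
preferred chart at `x` (the value does not depend on the chart). -/
def qCurvature (x : M) : ℝ :=
  qcurv (metricInChart (chartAt (Eu n) x)) (chartAt (Eu n) x x)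

variable (n M) in
/-- `J_g = 0`: all components of the `J`-tensor vanish in every smooth chart. -/
def JFlat : Prop :=
  ∀ e ∈ IsManifold.maximalAtlas (𝓡 n) ∞ M, ∀ y ∈ e.target, ∀ i j,
    jTensor (metricInChart e) i j y = 0

/-- The Riemannian volume in the domain of the chart `e`: the image under `e⁻¹` of the measure
`√(det g_{ij}) dy` on `e.target`. -/
def chartVolume [MeasurableSpace M] (e : OpenPartialHomeomorph M (Eu n)) : Measure M :=
  Measure.map e.symm ((volume.restrict e.target).withDensity
    fun y => ENNReal.ofReal (Real.sqrt (metricInChart e y).det))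

variable (n M) in
/-- The Riemannian volume measure `dV_g`.  The local measures `√(det g_{ij}) dy` of the smooth
charts agree on overlaps, and `dV_g`, the measure whose restriction to the domain of every smooth
chart is the local one, is their supremum in the lattice of measures. -/
def riemannianVolume [MeasurableSpace M] : Measure M :=
  ⨆ e ∈ IsManifold.maximalAtlas (𝓡 n) ∞ M, chartVolume e

/-- `Φ` is a structure of infinity (with one end) for which the Riemannian manifold `M` is
asymptotically Euclidean of class `W^{k,p}_{-τ}`: `Φ` is a smooth diffeomorphism from an open
subset of `M` with compact complement onto the exterior of a closed ball in `ℝⁿ`, and in the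
coordinates `Φ` one has `g_{ab} - δ_{ab} ∈ W^{k,p}_{-τ}`, where `τ > 0`. -/
structure IsAEChart (Φ : OpenPartialHomeomorph M (Eu n)) (k : ℕ) (p : ℝ≥0∞) (τ : ℝ) :
    Prop where
  mem_maximalAtlas : Φ ∈ IsManifold.maximalAtlas (𝓡 n) ∞ M
  isCompact_core : IsCompact (Φ.sourceᶜ)
  target_eq : ∃ R : ℝ, 0 < R ∧ Φ.target = (Metric.closedBall 0 R)ᶜ
  order_pos : 0 < τ
  decay : ∀ a b : Fin n, WeightedSobolev k p (-τ) Φ.target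
    fun y => metricInChart Φ y a b - (1 : Matrix (Fin n) (Fin n) ℝ) a b

end Manifolds

end AEGeom

end

/-!
# The fourth-order energy and the `J`-Einstein tensor

Write `g = δ + h` in the chart at infinity. The weighted Sobolev condition and Morrey's
inequality, scaled to balls of radius comparable to `|x|`, give `∂^j h = O(|x|^{-τ-j})` for
`j ≤ 4` (`WeightedSobolev.symbolDecay`). Every curvature quantity of differential order `m` then
equals its linearization at `δ` up to `O(|x|^{-2τ-m})`; this calculus of linear parts and
quadratic remainders is carried by `SymbolDecay` and `LinApprox`. The area of `S_r` is of order
`r^{n-1}` and the position field `X = r∂_r` has length `r`, so the remainder of `G_J` contributes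
`O(r^{n-2τ-4})` to the flux, which tends to zero because `2τ + 4 > n`.

At the linear level the identity is exact. The linearized contracted Bianchi identity implies that
`DG_J(h)` is divergence free (`linG_div`) and that its trace is `(n-4)/(8(n-1)) Δ DR(h)`
(`linG_trace`). As `∂_j X_i = δ_{ij}`, the vector field `DG_J(h)(X, ·)` has as divergence this
trace, whereas the energy is the flux of `-∇ DR(h)`, with divergence `-Δ DR(h)`. Hence
`DG_J(h)(X, ·) - (n-4)/(8(n-1)) ∇ DR(h)` is divergence free. Since `h` may be cut off and extended
to a smooth tensor on all of `ℝⁿ`, and the identities hold for every smooth `h`, the flux of this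
field through *every* sphere vanishes (`flux_linJField`); no interior boundary term remains.

The limits exist because `Q = -Δ DR(h) / (2(n-1)) + O(|x|^{-2τ-4})`, where the remainder is
integrable at infinity: if `Q` is integrable, then so is the divergence of `-∇ DR(h)`, and its
fluxes converge (`exists_tendsto_flux`). If `J = 0`, then `Q` is of quadratic order, because
`tr J = Q` at the linear level; so `G_J = -Q g / 4` has no flux in the limit, and the energy
vanishes if `n ≠ 4`. For `n = 4` the identity says nothing about the energy, but
`∂³g = O(r^{-τ-3})` and `τ > 0` give the vanishing directly.

The hypothesis on `Q` concerns the manifold, where `Q` is computed in the preferred charts and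
integrated against the Riemannian volume. To transport it to the chart at infinity, the
transformation laws of the Christoffel symbols, of the curvature and of the Hessian are derived,
which show that `Q` is a scalar (`IsPullback.qcurv`); and the volume density is bounded below near
infinity (`integrableOn_chart`).
-/

noncomputable section

namespace AEGeom

/-! ### Partial derivatives -/

section PartialDerivatives

variable {n : ℕ}

lemma pd_congr {U : Set (Eu n)} (hU : IsOpen U) {f g : Eu n → ℝ} (h : EqOn f g U) (i : Fin n) :
    EqOn (pd i f) (pd i g) U := by
  intro x hx
  have : f =ᶠ[𝓝 x] g := h.eventuallyEq_of_mem (hU.mem_nhds hx)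
  simp only [pd, this.fderiv_eq]

lemma pd_congr_nhds {f g : Eu n → ℝ} {x : Eu n} (h : f =ᶠ[𝓝 x] g) (i : Fin n) :
    pd i f x = pd i g x := by
  simp only [pd, h.fderiv_eq]

lemma contDiffOn_pd {U : Set (Eu n)} (hU : IsOpen U) {f : Eu n → ℝ} (h : ContDiffOn ℝ ∞ f U)
    (i : Fin n) : ContDiffOn ℝ ∞ (pd i f) U :=
  (h.fderiv_of_isOpen hU (by simp)).clm_apply contDiffOn_const

lemma contDiff_pd {f : Eu n → ℝ} (h : ContDiff ℝ ∞ f) (i : Fin n) : ContDiff ℝ ∞ (pd i f) :=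
  (h.fderiv_right (by simp)).clm_apply contDiff_const

lemma differentiableAt_of_contDiffOn {E F : Type*} [NormedAddCommGroup E] [NormedSpace ℝ E]
    [NormedAddCommGroup F] [NormedSpace ℝ F] {U : Set E} (hU : IsOpen U) {f : E → F}
    (h : ContDiffOn ℝ ∞ f U) {x : E} (hx : x ∈ U) : DifferentiableAt ℝ f x :=
  (h.contDiffAt (hU.mem_nhds hx)).differentiableAt (by simp)

lemma pd_add {f g : Eu n → ℝ} {x : Eu n} (hf : DifferentiableAt ℝ f x)
    (hg : DifferentiableAt ℝ g x) (i : Fin n) :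
    pd i (fun y => f y + g y) x = pd i f x + pd i g x := by
  simp only [pd]
  rw [fderiv_fun_add hf hg]; rfl

lemma pd_sub {f g : Eu n → ℝ} {x : Eu n} (hf : DifferentiableAt ℝ f x)
    (hg : DifferentiableAt ℝ g x) (i : Fin n) :
    pd i (fun y => f y - g y) x = pd i f x - pd i g x := by
  simp only [pd]
  rw [fderiv_fun_sub hf hg]; rfl

lemma pd_mul {f g : Eu n → ℝ} {x : Eu n} (hf : DifferentiableAt ℝ f x)
    (hg : DifferentiableAt ℝ g x) (i : Fin n) :
    pd i (fun y => f y * g y) x = pd i f x * g x + f x * pd i g x := by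
  simp only [pd]
  rw [fderiv_fun_mul hf hg]
  simp
  ring

lemma pd_const_mul (c : ℝ) {f : Eu n → ℝ} {x : Eu n} (hf : DifferentiableAt ℝ f x) (i : Fin n) :
    pd i (fun y => c * f y) x = c * pd i f x := by
  simp only [pd]
  rw [fderiv_const_mul hf]
  simp

lemma pd_const (c : ℝ) (i : Fin n) (x : Eu n) : pd i (fun _ => c) x = 0 := by
  simp [pd]

lemma pd_sum {ι : Type*} (s : Finset ι) {f : ι → Eu n → ℝ} {x : Eu n}
    (hf : ∀ a ∈ s, DifferentiableAt ℝ (f a) x) (i : Fin n) :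
    pd i (fun y => ∑ a ∈ s, f a y) x = ∑ a ∈ s, pd i (f a) x := by
  simp only [pd]
  rw [fderiv_fun_sum hf]
  simp

lemma pd_comm {U : Set (Eu n)} (hU : IsOpen U) {f : Eu n → ℝ} (h : ContDiffOn ℝ ∞ f U)
    {x : Eu n} (hx : x ∈ U) (i j : Fin n) : pd i (pd j f) x = pd j (pd i f) x := by
  have hd : DifferentiableAt ℝ (fderiv ℝ f) x :=
    differentiableAt_of_contDiffOn hU (h.fderiv_of_isOpen hU (by simp)) hx
  have hs : IsSymmSndFDerivAt ℝ f x :=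
    (h.contDiffAt (hU.mem_nhds hx)).isSymmSndFDerivAt 
      (by simpa using WithTop.coe_le_coe.2 (le_top : (2 : ℕ∞) ≤ ⊤))
  have key : ∀ a b : Fin n, pd a (pd b f) x
      = fderiv ℝ (fderiv ℝ f) x (EuclideanSpace.single a 1) (EuclideanSpace.single b 1) := by
    intro a b
    change fderiv ℝ (fun y => fderiv ℝ f y ((fun _ => EuclideanSpace.single b 1) y)) x _ = _
    rw [fderiv_clm_apply hd (differentiableAt_const _)]
    simp
  rw [key, key, hs]

end PartialDerivatives

/-! ### Symbol-type decay at infinity -/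

section Decay

variable {n : ℕ}

/-- The exterior `{|x| > R}` of a closed ball of `ℝⁿ`. -/
def exterior (n : ℕ) (R : ℝ) : Set (Eu n) := {x | R < ‖x‖}

lemma isOpen_exterior (R : ℝ) : IsOpen (exterior n R) :=
  isOpen_lt continuous_const continuous_norm

/-- `f` is smooth on `{|x| > R}` and `∂^α f = O(|x|^{-a-|α|})` there for all `|α| ≤ k`. -/
def SymbolDecay (R : ℝ) : ℕ → ℝ → (Eu n → ℝ) → Prop
  | 0, a, f => ContDiffOn ℝ ∞ f (exterior n R) ∧
      ∃ C, ∀ x ∈ exterior n R, |f x| ≤ C * ‖x‖ ^ (-a)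
  | k + 1, a, f => (ContDiffOn ℝ ∞ f (exterior n R) ∧
      ∃ C, ∀ x ∈ exterior n R, |f x| ≤ C * ‖x‖ ^ (-a)) ∧
      ∀ i, SymbolDecay R k (a + 1) (pd i f)

namespace SymbolDecay

variable {R : ℝ} {k : ℕ} {a b : ℝ} {f g : Eu n → ℝ}

lemma zero_order (h : SymbolDecay R k a f) : SymbolDecay R 0 a f := by
  cases k with
  | zero => exact h
  | succ k => exact h.1

lemma contDiffOn (h : SymbolDecay R k a f) : ContDiffOn ℝ ∞ f (exterior n R) := h.zero_order.1

lemma bound (h : SymbolDecay R k a f) : ∃ C, ∀ x ∈ exterior n R, |f x| ≤ C * ‖x‖ ^ (-a) :=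
  h.zero_order.2

lemma differentiableAt (h : SymbolDecay R k a f) {x : Eu n} (hx : x ∈ exterior n R) :
    DifferentiableAt ℝ f x :=
  differentiableAt_of_contDiffOn (isOpen_exterior R) h.contDiffOn hx

lemma pd (h : SymbolDecay R (k + 1) a f) (i : Fin n) : SymbolDecay R k (a + 1) (pd i f) := h.2 i

lemma congr (h : SymbolDecay R k a f) (hfg : EqOn g f (exterior n R)) : SymbolDecay R k a g := by
  induction k generalizing a f g with
  | zero =>
    refine ⟨h.1.congr hfg, ?_⟩
    obtain ⟨C, hC⟩ := h.2
    exact ⟨C, fun x hx => by rw [hfg hx]; exact hC x hx⟩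
  | succ k ih =>
    refine ⟨⟨h.1.1.congr hfg, ?_⟩, fun i => ih (h.2 i) (pd_congr (isOpen_exterior R) hfg i)⟩
    obtain ⟨C, hC⟩ := h.1.2
    exact ⟨C, fun x hx => by rw [hfg hx]; exact hC x hx⟩

lemma of_succ (h : SymbolDecay R (k + 1) a f) : SymbolDecay R k a f := by
  induction k generalizing a f with
  | zero => exact h.1
  | succ k ih => exact ⟨h.1, fun i => ih (h.2 i)⟩

lemma of_le {k' : ℕ} (h : SymbolDecay R k' a f) (hk : k ≤ k') : SymbolDecay R k a f := by
  induction hk with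
  | refl => exact h
  | step _ ih => exact ih h.of_succ

lemma mono (hR : 1 ≤ R) (h : SymbolDecay R k a f) (hab : b ≤ a) : SymbolDecay R k b f := by
  have key : ∀ {f : Eu n → ℝ} {a b : ℝ}, b ≤ a →
      (∃ C, ∀ x ∈ exterior n R, |f x| ≤ C * ‖x‖ ^ (-a)) →
      ∃ C, ∀ x ∈ exterior n R, |f x| ≤ C * ‖x‖ ^ (-b) := by
    rintro f a b hab ⟨C, hC⟩
    refine ⟨|C|, fun x hx => (hC x hx).trans ?_⟩
    have hx1 : 1 ≤ ‖x‖ := hR.trans (le_of_lt hx)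
    exact mul_le_mul (le_abs_self C) (Real.rpow_le_rpow_of_exponent_le hx1 (by linarith))
      (by positivity) (abs_nonneg C)
  induction k generalizing a b f with
  | zero => exact ⟨h.1, key hab h.2⟩
  | succ k ih => exact ⟨⟨h.1.1, key hab h.1.2⟩, fun i => ih (h.2 i) (by linarith)⟩

lemma zero (R : ℝ) (k : ℕ) (a : ℝ) : SymbolDecay R k a (fun _ : Eu n => 0) := by
  induction k generalizing a with
  | zero => exact ⟨contDiffOn_const, 0, by simp⟩
  | succ k ih =>
    refine ⟨⟨contDiffOn_const, 0, by simp⟩, fun i => (ih (a + 1)).congr fun x _ => pd_const 0 i x⟩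

lemma const (R : ℝ) (k : ℕ) (c : ℝ) : SymbolDecay R k 0 (fun _ : Eu n => c) := by
  cases k with
  | zero => exact ⟨contDiffOn_const, |c|, by simp⟩
  | succ k =>
    exact ⟨⟨contDiffOn_const, |c|, by simp⟩,
      fun i => (zero R k (0 + 1)).congr fun x _ => pd_const c i x⟩

lemma add (hf : SymbolDecay R k a f) (hg : SymbolDecay R k a g) :
    SymbolDecay R k a (fun x => f x + g x) := by
  have key : ∀ {f g : Eu n → ℝ} {a : ℝ}, SymbolDecay R 0 a f → SymbolDecay R 0 a g →
      SymbolDecay R 0 a (fun x => f x + g x) := by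
    rintro f g a ⟨hf, C, hC⟩ ⟨hg, D, hD⟩
    refine ⟨hf.add hg, C + D, fun x hx => (abs_add_le _ _).trans ?_⟩
    rw [add_mul]
    exact add_le_add (hC x hx) (hD x hx)
  induction k generalizing a f g with
  | zero => exact key hf hg
  | succ k ih =>
    exact ⟨key hf.zero_order hg.zero_order, fun i => (ih (hf.2 i) (hg.2 i)).congr fun x hx =>
      pd_add (hf.differentiableAt hx) (hg.differentiableAt hx) i⟩

lemma mul (hf : SymbolDecay R k a f) (hg : SymbolDecay R k b g) :
    SymbolDecay R k (a + b) (fun x => f x * g x) := by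
  have key : ∀ {f g : Eu n → ℝ} {a b : ℝ}, SymbolDecay R 0 a f → SymbolDecay R 0 b g →
      SymbolDecay R 0 (a + b) (fun x => f x * g x) := by
    rintro f g a b ⟨hf, C, hC⟩ ⟨hg, D, hD⟩
    refine ⟨hf.mul hg, |C| * |D|, fun x hx => ?_⟩
    rw [abs_mul]
    by_cases hx0 : ‖x‖ = 0
    · have hC' := hC x hx
      have hD' := hD x hx
      rcases eq_or_ne a 0 with rfl | ha
      · rcases eq_or_ne b 0 with rfl | hb
        · simp only [neg_zero, Real.rpow_zero, mul_one, add_zero] at *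
          exact mul_le_mul (hC'.trans (le_abs_self _)) (hD'.trans (le_abs_self _))
            (abs_nonneg _) (abs_nonneg _)
        · rw [hx0, Real.zero_rpow (neg_ne_zero.mpr hb), mul_zero] at hD'
          have : |g x| = 0 := le_antisymm hD' (abs_nonneg _)
          rw [this, mul_zero]; positivity
      · rw [hx0, Real.zero_rpow (neg_ne_zero.mpr ha), mul_zero] at hC'
        have : |f x| = 0 := le_antisymm hC' (abs_nonneg _)
        rw [this, zero_mul]; positivity
    · have hpos : 0 < ‖x‖ := lt_of_le_of_ne (norm_nonneg x) (Ne.symm hx0)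
      rw [neg_add, Real.rpow_add hpos]
      calc |f x| * |g x| ≤ (|C| * ‖x‖ ^ (-a)) * (|D| * ‖x‖ ^ (-b)) := by
            refine mul_le_mul ((hC x hx).trans ?_) ((hD x hx).trans ?_) (abs_nonneg _)
              (by positivity)
            · exact mul_le_mul_of_nonneg_right (le_abs_self C) (by positivity)
            · exact mul_le_mul_of_nonneg_right (le_abs_self D) (by positivity)
        _ = _ := by ring
  induction k generalizing a b f g with
  | zero => exact key hf hg
  | succ k ih =>
    refine ⟨key hf.zero_order hg.zero_order, fun i => ?_⟩
    have h1 := ih (hf.2 i) hg.of_succ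
    have h2 := ih hf.of_succ (hg.2 i)
    rw [show a + 1 + b = a + b + 1 by ring] at h1
    rw [show a + (b + 1) = a + b + 1 by ring] at h2
    exact (h1.add h2).congr fun x hx => pd_mul (hf.differentiableAt hx) (hg.differentiableAt hx) i

lemma const_mul (c : ℝ) (hf : SymbolDecay R k a f) : SymbolDecay R k a (fun x => c * f x) := by
  simpa using (const (n := n) R k c).mul hf

lemma neg (hf : SymbolDecay R k a f) : SymbolDecay R k a (fun x => -f x) := by
  simpa using hf.const_mul (-1)

lemma sub (hf : SymbolDecay R k a f) (hg : SymbolDecay R k a g) :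
    SymbolDecay R k a (fun x => f x - g x) := by
  simpa [sub_eq_add_neg] using hf.add hg.neg

lemma sum {ι : Type*} (s : Finset ι) {f : ι → Eu n → ℝ} (hf : ∀ i ∈ s, SymbolDecay R k a (f i)) :
    SymbolDecay R k a (fun x => ∑ i ∈ s, f i x) := by
  classical
  induction s using Finset.induction_on with
  | empty => simpa using zero (n := n) R k a
  | insert i s hi ih =>
    simp only [Finset.sum_insert hi]
    exact (hf i (Finset.mem_insert_self i s)).add
      (ih fun j hj => hf j (Finset.mem_insert_of_mem hj))

/-- Enlarging the excluded ball. -/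
lemma mono_radius {R' : ℝ} (h : SymbolDecay R k a f) (hR : R ≤ R') : SymbolDecay R' k a f := by
  have hsub : exterior n R' ⊆ exterior n R := fun x hx => lt_of_le_of_lt hR hx
  induction k generalizing a f with
  | zero => exact ⟨h.1.mono hsub, h.2.imp fun C hC x hx => hC x (hsub hx)⟩
  | succ k ih =>
    exact ⟨⟨h.1.1.mono hsub, h.1.2.imp fun C hC x hx => hC x (hsub hx)⟩, fun i => ih (h.2 i)⟩

end SymbolDecay

/-! ### Linearization at the Euclidean metric -/

/-- `f` agrees with `f₀` up to an error of quadratic order: if `f` is a quantity of differential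
order `m` computed from a metric `g = δ + O(|x|^{-τ})`, and `f₀` its linear part in `g - δ`, then
`f₀ = O(|x|^{-τ-m})` and `f - f₀ = O(|x|^{-2τ-m})`, with `k` derivatives. -/
structure LinApprox (R τ : ℝ) (k : ℕ) (m : ℝ) (f f₀ : Eu n → ℝ) : Prop where
  lin : SymbolDecay R k (τ + m) f₀
  err : SymbolDecay R k (2 * τ + m) (fun x => f x - f₀ x)

namespace LinApprox

variable {R τ : ℝ} {k : ℕ} {m m' : ℝ} {f f₀ g g₀ : Eu n → ℝ}

lemma decay (hR : 1 ≤ R) (hτ : 0 < τ) (h : LinApprox R τ k m f f₀) :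
    SymbolDecay R k (τ + m) f :=
  (h.lin.add (h.err.mono hR (b := τ + m) (by linarith))).congr fun x _ => by ring

lemma of_le {k' : ℕ} (h : LinApprox R τ k' m f f₀) (hk : k ≤ k') : LinApprox R τ k m f f₀ :=
  ⟨h.lin.of_le hk, h.err.of_le hk⟩

lemma congr (h : LinApprox R τ k m f f₀) {f' f₀' : Eu n → ℝ} (hf : EqOn f' f (exterior n R))
    (hf₀ : EqOn f₀' f₀ (exterior n R)) : LinApprox R τ k m f' f₀' :=
  ⟨h.lin.congr hf₀, h.err.congr fun x hx => by simp only [hf hx, hf₀ hx]⟩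

lemma add (hf : LinApprox R τ k m f f₀) (hg : LinApprox R τ k m g g₀) :
    LinApprox R τ k m (fun x => f x + g x) (fun x => f₀ x + g₀ x) :=
  ⟨hf.lin.add hg.lin, (hf.err.add hg.err).congr fun x _ => by ring⟩

lemma sub (hf : LinApprox R τ k m f f₀) (hg : LinApprox R τ k m g g₀) :
    LinApprox R τ k m (fun x => f x - g x) (fun x => f₀ x - g₀ x) :=
  ⟨hf.lin.sub hg.lin, (hf.err.sub hg.err).congr fun x _ => by ring⟩

lemma const_mul (c : ℝ) (hf : LinApprox R τ k m f f₀) :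
    LinApprox R τ k m (fun x => c * f x) (fun x => c * f₀ x) :=
  ⟨hf.lin.const_mul c, (hf.err.const_mul c).congr fun x _ => by ring⟩

lemma sum {ι : Type*} (s : Finset ι) {f f₀ : ι → Eu n → ℝ}
    (hf : ∀ i ∈ s, LinApprox R τ k m (f i) (f₀ i)) :
    LinApprox R τ k m (fun x => ∑ i ∈ s, f i x) (fun x => ∑ i ∈ s, f₀ i x) :=
  ⟨.sum s fun i hi => (hf i hi).lin,
    (SymbolDecay.sum s fun i hi => (hf i hi).err).congr fun x _ => by
      simp only [Finset.sum_sub_distrib]⟩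

lemma pd (hf : LinApprox R τ (k + 1) m f f₀) (i : Fin n) :
    LinApprox R τ k (m + 1) (pd i f) (pd i f₀) := by
  have h1 := hf.lin.pd i
  have h2 := hf.err.pd i
  rw [add_assoc] at h1 h2
  refine ⟨h1, h2.congr fun x hx => ?_⟩
  have hd0 := hf.lin.differentiableAt hx
  have hd : DifferentiableAt ℝ f x := by
    have := (hf.err.differentiableAt hx).add hd0
    refine this.congr_of_eventuallyEq (Eventually.of_forall fun y => ?_)
    simp
  exact (pd_sub hd hd0 i).symm

/-- A product of two quantities without constant term has no linear part. -/
lemma mul (hR : 1 ≤ R) (hτ : 0 < τ) (hf : LinApprox R τ k m f f₀)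
    (hg : LinApprox R τ k m' g g₀) :
    LinApprox R τ k (m + m') (fun x => f x * g x) (fun _ => 0) := by
  refine ⟨.zero R k _, ?_⟩
  have := (hf.decay hR hτ).mul (hg.decay hR hτ)
  rw [show τ + m + (τ + m') = 2 * τ + (m + m') by ring] at this
  exact this.congr fun x _ => by ring

/-- Multiplication by a coefficient `u = c + O(|x|^{-τ})`. -/
lemma coeff_mul (hR : 1 ≤ R) (hτ : 0 < τ) {u : Eu n → ℝ} {c : ℝ}
    (hu : SymbolDecay R k τ (fun x => u x - c)) (hf : LinApprox R τ k m f f₀) :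
    LinApprox R τ k m (fun x => u x * f x) (fun x => c * f₀ x) := by
  refine ⟨hf.lin.const_mul c, ?_⟩
  have h1 := hu.mul (hf.decay hR hτ)
  rw [show τ + (τ + m) = 2 * τ + m by ring] at h1
  exact (h1.add (hf.err.const_mul c)).congr fun x _ => by ring

end LinApprox

end Decay

/-! ### The linearized curvature operators -/

section LinearizedOperators

variable {n : ℕ}

variable (n) in
/-- The space `C^∞(ℝⁿ)`, on which the partial derivatives are commuting linear operators. -/
def Smooth : Submodule ℝ (Eu n → ℝ) where
  carrier := {f | ContDiff ℝ ∞ f}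
  add_mem' {f g} (hf : ContDiff ℝ ∞ f) (hg : ContDiff ℝ ∞ g) := hf.add hg
  zero_mem' := show ContDiff ℝ ∞ (fun _ : Eu n => (0 : ℝ)) from contDiff_const
  smul_mem' c f (hf : ContDiff ℝ ∞ f) := show ContDiff ℝ ∞ (c • f) from hf.const_smul c

lemma contDiff_coe (f : Smooth n) : ContDiff ℝ ∞ (f : Eu n → ℝ) := f.2

lemma differentiable_coe (f : Smooth n) : Differentiable ℝ (f : Eu n → ℝ) :=
  (contDiff_coe f).differentiable (by simp)

/-- The partial derivative `∂_i` as a linear operator on `C^∞(ℝⁿ)`. -/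
def D (i : Fin n) : Smooth n →ₗ[ℝ] Smooth n where
  toFun f := ⟨pd i f, contDiff_pd (contDiff_coe f) i⟩
  map_add' f g := Subtype.ext <| funext fun x =>
    pd_add (differentiable_coe f x) (differentiable_coe g x) i
  map_smul' c f := Subtype.ext <| funext fun x => pd_const_mul c (differentiable_coe f x) i

lemma coe_D (i : Fin n) (f : Smooth n) : (D i f : Eu n → ℝ) = pd i f := rfl

lemma D_comm (i j : Fin n) (f : Smooth n) : D i (D j f) = D j (D i f) :=
  Subtype.ext <| funext fun x => pd_comm isOpen_univ (contDiff_coe f).contDiffOn (mem_univ x) i j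

lemma Smooth.sum_apply {ι : Type*} (s : Finset ι) (f : ι → Smooth n) (x : Eu n) :
    (↑(∑ a ∈ s, f a) : Eu n → ℝ) x = ∑ a ∈ s, (f a : Eu n → ℝ) x := by
  simp

/-- The Kronecker delta. -/
abbrev kron (i j : Fin n) : ℝ := (1 : Matrix (Fin n) (Fin n) ℝ) i j

variable (h : Fin n → Fin n → Smooth n)

/-- The linearization at `δ` of the Christoffel symbols. -/
def linChristoffel (k i j : Fin n) : Smooth n :=
  (1 / 2 : ℝ) • (D i (h j k) + D j (h i k) - D k (h i j))

/-- The linearization at `δ` of the curvature tensor. -/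
def linRiem (i j k l : Fin n) : Smooth n :=
  D k (linChristoffel h i l j) - D l (linChristoffel h i k j)

/-- The linearization at `δ` of the Ricci tensor. -/
def linRic (i j : Fin n) : Smooth n := ∑ k, linRiem h k i k j

/-- The linearization at `δ` of the scalar curvature. -/
def linScal : Smooth n := ∑ i, linRic h i i

/-- The linearization at `δ` of the Schouten tensor. -/
def linSchouten (i j : Fin n) : Smooth n :=
  (1 / ((n : ℝ) - 2)) • (linRic h i j - (1 / (2 * ((n : ℝ) - 1)) * kron i j) • linScal h)

/-- The linearization at `δ` of the Cotton tensor. -/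
def linCotton (k i j : Fin n) : Smooth n := D k (linSchouten h i j) - D i (linSchouten h k j)

/-- The linearization at `δ` of the Bach tensor. -/
def linBach (i j : Fin n) : Smooth n := ∑ k, D k (linCotton h k i j)

/-- The linearization at `δ` of the trace of the Schouten tensor. -/
def linTrSchouten : Smooth n := ∑ i, linSchouten h i i

/-- The Euclidean Laplacian on `C^∞(ℝⁿ)`. -/
def euclLap (f : Smooth n) : Smooth n := ∑ a, D a (D a f)

/-- The linearization at `δ` of the `Q`-curvature. -/
def linQ : Smooth n := (-(1 / (2 * ((n : ℝ) - 1)))) • euclLap (linScal h)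

/-- The linearization at `δ` of the tensor `T`. -/
def linT (i j : Fin n) : Smooth n :=
  ((n : ℝ) - 2) • (D i (D j (linTrSchouten h)) - (1 / (n : ℝ) * kron i j) •
    euclLap (linTrSchouten h))

/-- The linearization at `δ` of the `J`-tensor. -/
def linJ (i j : Fin n) : Smooth n :=
  (1 / (n : ℝ) * kron i j) • linQ h - (1 / ((n : ℝ) - 2)) • linBach h i j
    - (((n : ℝ) - 4) / (4 * ((n : ℝ) - 1) * ((n : ℝ) - 2))) • linT h i j

/-- The linearization at `δ` of the `J`-Einstein tensor. -/
def linG (i j : Fin n) : Smooth n := linJ h i j - (1 / 4 * kron i j) • linQ h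

end LinearizedOperators

/-! ### Quadratic remainder estimates for the curvature -/

section Remainders

variable {n : ℕ}

/-- `g = δ + h` on `{|x| > R}`, where `h` and `g⁻¹ - δ` are `O(|x|^{-τ})` together with four
derivatives.  The perturbation `h` is defined and smooth on all of `ℝⁿ`. -/
structure MetricApprox (R τ : ℝ) (g : Eu n → Matrix (Fin n) (Fin n) ℝ)
    (h : Fin n → Fin n → Smooth n) : Prop where
  one_le : 1 ≤ R
  pos : 0 < τ
  eqOn : ∀ i j, EqOn (fun x => g x i j - kron i j) (h i j : Eu n → ℝ) (exterior n R)
  decay : ∀ i j, SymbolDecay R 4 τ (h i j : Eu n → ℝ)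
  ginv_decay : ∀ i j, SymbolDecay R 4 τ (fun x => ginv g i j x - kron i j)

namespace LinApprox

variable {R τ : ℝ} {k : ℕ} {m m' : ℝ} {f f₀ u : Eu n → ℝ}

lemma cast (H : LinApprox R τ k m f f₀) (hm : m = m') : LinApprox R τ k m' f f₀ := hm ▸ H

/-- Errors of quadratic order do not change the linear part. -/
lemma add_quad (H : LinApprox R τ k m f f₀) (hu : LinApprox R τ k m u fun _ => 0) :
    LinApprox R τ k m (fun x => f x + u x) f₀ :=
  (H.add hu).congr (fun _ _ => rfl) fun _ _ => by simp

lemma sub_quad (H : LinApprox R τ k m f f₀) (hu : LinApprox R τ k m u fun _ => 0) :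
    LinApprox R τ k m (fun x => f x - u x) f₀ :=
  (H.sub hu).congr (fun _ _ => rfl) fun _ _ => by simp

lemma sum_quad {ι : Type*} (s : Finset ι) {f : ι → Eu n → ℝ}
    (H : ∀ i ∈ s, LinApprox R τ k m (f i) fun _ => 0) :
    LinApprox R τ k m (fun x => ∑ i ∈ s, f i x) fun _ => 0 :=
  (LinApprox.sum s H).congr (fun _ _ => rfl) fun _ _ => by simp

end LinApprox

namespace MetricApprox

variable {R τ : ℝ} {g : Eu n → Matrix (Fin n) (Fin n) ℝ} {h : Fin n → Fin n → Smooth n}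

lemma metric (H : MetricApprox R τ g h) (i j : Fin n) :
    LinApprox R τ 4 0 (fun x => g x i j - kron i j) (h i j) :=
  ⟨by simpa using H.decay i j, (SymbolDecay.zero R 4 _).congr fun x hx => by
    simp only [H.eqOn i j hx, sub_self]⟩

lemma metric_decay (H : MetricApprox R τ g h) (i j : Fin n) :
    SymbolDecay R 4 τ (fun x => g x i j - kron i j) := (H.decay i j).congr (H.eqOn i j)

lemma pd_metric (H : MetricApprox R τ g h) (a i j : Fin n) :
    LinApprox R τ 3 1 (pd a fun y => g y i j) (pd a (h i j)) := by
  refine ((H.metric i j).pd a).cast (by norm_num) |>.congr (fun x hx => ?_) fun _ _ => rfl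
  have hd : DifferentiableAt ℝ (fun y => g y i j) x := by
    refine (((H.metric_decay i j).differentiableAt hx).add_const (kron i j)).congr_of_eventuallyEq
      (Eventually.of_forall fun y => ?_)
    simp
  rw [pd_sub hd (differentiableAt_const _), pd_const, sub_zero]

variable {k : ℕ} {m m' : ℝ}

/-- Multiplication by a component of the inverse metric. -/
lemma ginv_mul (H : MetricApprox R τ g h) {f f₀ : Eu n → ℝ} (hk : k ≤ 4) (i j : Fin n)
    (hf : LinApprox R τ k m f f₀) :
    LinApprox R τ k m (fun x => ginv g i j x * f x) (fun x => kron i j * f₀ x) :=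
  hf.coeff_mul H.one_le H.pos ((H.ginv_decay i j).of_le hk)

/-- Multiplication by a component of the metric. -/
lemma metric_mul (H : MetricApprox R τ g h) {f f₀ : Eu n → ℝ} (hk : k ≤ 4) (i j : Fin n)
    (hf : LinApprox R τ k m f f₀) :
    LinApprox R τ k m (fun x => g x i j * f x) (fun x => kron i j * f₀ x) :=
  hf.coeff_mul H.one_le H.pos ((H.metric_decay i j).of_le hk)

lemma mul (H : MetricApprox R τ g h) {f f₀ u u₀ : Eu n → ℝ} {l : ℕ}
    (hf : LinApprox R τ k m f f₀) (hu : LinApprox R τ l m' u u₀) (hkl : k ≤ l) :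
    LinApprox R τ k (m + m') (fun x => f x * u x) (fun _ => 0) :=
  hf.mul H.one_le H.pos (hu.of_le hkl)

lemma trace2 (H : MetricApprox R τ g h) (hk : k ≤ 4) {T : Fin n → Fin n → Eu n → ℝ}
    {T₀ : Fin n → Fin n → Smooth n} (hT : ∀ i j, LinApprox R τ k m (T i j) (T₀ i j)) :
    LinApprox R τ k m (trace2 g T) (∑ i, T₀ i i : Smooth n) := by
  refine (LinApprox.sum Finset.univ fun i _ => LinApprox.sum Finset.univ fun j _ =>
    H.ginv_mul hk i j (hT i j)).congr (fun _ _ => rfl) fun x _ => ?_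
  simp [Smooth.sum_apply, kron, Matrix.one_apply]

lemma christoffel (H : MetricApprox R τ g h) (k i j : Fin n) :
    LinApprox R τ 3 1 (christoffel g k i j) (linChristoffel h k i j) := by
  refine ((LinApprox.sum Finset.univ fun l _ => H.ginv_mul (by norm_num) k l
    (((H.pd_metric i j l).add (H.pd_metric j i l)).sub
      (H.pd_metric l i j))).const_mul (1 / 2)).congr
    (fun _ _ => rfl) fun x _ => ?_
  simp [linChristoffel, coe_D, kron, Matrix.one_apply]

lemma riem (H : MetricApprox R τ g h) (i j k l : Fin n) :
    LinApprox R τ 2 2 (riem g i j k l) (linRiem h i j k l) := by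
  have h1 := ((H.christoffel i l j).pd k).sub ((H.christoffel i k j).pd l)
  have h2 := LinApprox.sum_quad Finset.univ fun m _ => (H.mul ((H.christoffel i k m).of_le
    (by norm_num : 2 ≤ 3)) (H.christoffel m l j) (by norm_num)).sub_quad
    (H.mul ((H.christoffel i l m).of_le (by norm_num : 2 ≤ 3)) (H.christoffel m k j) (by norm_num))
  exact ((h1.add_quad h2).cast (by norm_num)).congr (fun _ _ => rfl) fun _ _ => rfl

lemma ric (H : MetricApprox R τ g h) (i j : Fin n) :
    LinApprox R τ 2 2 (ric g i j) (linRic h i j) :=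
  (LinApprox.sum Finset.univ fun k _ => H.riem k i k j).congr (fun _ _ => rfl) fun _ _ => by
    simp [linRic, Smooth.sum_apply]

lemma scal (H : MetricApprox R τ g h) : LinApprox R τ 2 2 (scal g) (linScal h) :=
  H.trace2 (by norm_num) H.ric

lemma schouten (H : MetricApprox R τ g h) (i j : Fin n) :
    LinApprox R τ 2 2 (schouten g i j) (linSchouten h i j) := by
  refine (((H.ric i j).sub ((H.metric_mul (by norm_num) i j H.scal).const_mul
    (1 / (2 * ((n : ℝ) - 1))))).const_mul (1 / ((n : ℝ) - 2))).congr (fun x _ => ?_) fun x _ => ?_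
  · simp only [AEGeom.schouten]; ring
  · simp only [linSchouten, Submodule.coe_smul, Submodule.coe_sub, Pi.smul_apply, Pi.sub_apply,
      smul_eq_mul]
    ring

lemma hess (H : MetricApprox R τ g h) {f : Eu n → ℝ} {f₀ : Smooth n}
    (hf : LinApprox R τ 2 m f f₀) (i j : Fin n) :
    LinApprox R τ 0 (m + 2) (hess g f i j) (D i (D j f₀)) := by
  refine ((((hf.pd j).pd i).cast (by ring)).sub_quad (LinApprox.sum_quad Finset.univ fun k _ =>
    (((H.mul ((H.christoffel k i j).of_le (by norm_num : 0 ≤ 3)) (hf.pd k)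
      (by norm_num)).cast (by ring))))).congr (fun _ _ => rfl) fun _ _ => rfl

lemma lap (H : MetricApprox R τ g h) {f : Eu n → ℝ} {f₀ : Smooth n}
    (hf : LinApprox R τ 2 m f f₀) :
    LinApprox R τ 0 (m + 2) (lap g f) (euclLap f₀) :=
  H.trace2 (by norm_num) (H.hess hf)

lemma cov2 (H : MetricApprox R τ g h) (hk : k ≤ 3) {T : Fin n → Fin n → Eu n → ℝ}
    {T₀ : Fin n → Fin n → Smooth n} (hT : ∀ i j, LinApprox R τ (k + 1) m (T i j) (T₀ i j))
    (a i j : Fin n) : LinApprox R τ k (m + 1) (cov2 g T a i j) (D a (T₀ i j)) := by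
  have hq : ∀ b c d p q, LinApprox R τ k (m + 1)
      (fun x => AEGeom.christoffel g b c d x * T p q x) (fun _ => 0) := fun b c d p q =>
    (H.mul ((H.christoffel b c d).of_le hk) (hT p q) (Nat.le_succ k)).cast (by ring)
  exact ((hT i j).pd a).sub_quad
    (LinApprox.sum_quad Finset.univ fun b _ => (hq _ _ _ _ _).add_quad (hq _ _ _ _ _))

lemma cov3 (H : MetricApprox R τ g h) (hk : k ≤ 3) {T : Fin n → Fin n → Fin n → Eu n → ℝ}
    {T₀ : Fin n → Fin n → Fin n → Smooth n}
    (hT : ∀ c i j, LinApprox R τ (k + 1) m (T c i j) (T₀ c i j))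
    (a c i j : Fin n) : LinApprox R τ k (m + 1) (cov3 g T a c i j) (D a (T₀ c i j)) := by
  have hq : ∀ b c d p q r, LinApprox R τ k (m + 1)
      (fun x => AEGeom.christoffel g b c d x * T p q r x) (fun _ => 0) := fun b c d p q r =>
    (H.mul ((H.christoffel b c d).of_le hk) (hT p q r) (Nat.le_succ k)).cast (by ring)
  exact ((hT c i j).pd a).sub_quad (LinApprox.sum_quad Finset.univ fun b _ =>
    ((hq _ _ _ _ _ _).add_quad (hq _ _ _ _ _ _)).add_quad (hq _ _ _ _ _ _))

lemma cotton (H : MetricApprox R τ g h) (k i j : Fin n) :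
    LinApprox R τ 1 3 (cotton g k i j) (linCotton h k i j) :=
  ((H.cov2 (by norm_num) H.schouten k i j).sub (H.cov2 (by norm_num) H.schouten i k j)).cast
    (by norm_num)

lemma weyl (H : MetricApprox R τ g h) (i j k l : Fin n) :
    ∃ w : Eu n → ℝ, LinApprox R τ 2 2 (weyl g i j k l) w := by
  have hS := fun a b c d => H.metric_mul (by norm_num : 2 ≤ 4) a b (H.schouten c d)
  exact ⟨_, (LinApprox.sum Finset.univ fun m _ =>
    H.metric_mul (by norm_num) i m (H.riem m j k l)).sub
      ((((hS i k j l).add (hS j l i k)).sub (hS i l j k)).sub (hS j k i l))⟩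

lemma bach (H : MetricApprox R τ g h) (i j : Fin n) :
    LinApprox R τ 0 4 (bach g i j) (linBach h i j) := by
  have h1 : LinApprox R τ 0 4
      (fun x => ∑ k, ∑ l, ginv g k l x * AEGeom.cov3 g (AEGeom.cotton g) l k i j x)
      (linBach h i j) := by
    refine ((LinApprox.sum Finset.univ fun k _ => LinApprox.sum Finset.univ fun l _ =>
      H.ginv_mul (by norm_num) k l (H.cov3 (by norm_num) H.cotton l k i j)).cast
      (by norm_num)).congr (fun _ _ => rfl) fun x _ => ?_
    simp [linBach, Smooth.sum_apply, kron, Matrix.one_apply]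
  refine h1.add_quad (LinApprox.sum_quad Finset.univ fun k _ => LinApprox.sum_quad Finset.univ
    fun l _ => LinApprox.sum_quad Finset.univ fun a _ => LinApprox.sum_quad Finset.univ
    fun b _ => ?_)
  obtain ⟨w, hw⟩ := H.weyl k i l j
  refine ((H.mul (H.ginv_mul (by norm_num) k a hw) (H.ginv_mul (by norm_num) l b
    (H.schouten a b)) le_rfl).of_le (by norm_num) |>.cast (by norm_num)).congr
    (fun x _ => ?_) fun _ _ => rfl
  ring

lemma normSq2 (H : MetricApprox R τ g h) (hk : k ≤ 4) {T : Fin n → Fin n → Eu n → ℝ}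
    {T₀ : Fin n → Fin n → Smooth n} (hT : ∀ i j, LinApprox R τ k m (T i j) (T₀ i j)) :
    LinApprox R τ k (m + m) (normSq2 g T) (fun _ => 0) := by
  refine LinApprox.sum_quad Finset.univ fun i _ => LinApprox.sum_quad Finset.univ
    fun j _ => LinApprox.sum_quad Finset.univ fun a _ => LinApprox.sum_quad Finset.univ
    fun b _ => ?_
  refine (H.mul (H.ginv_mul hk i a (hT i j)) (H.ginv_mul hk j b (hT a b)) le_rfl).congr
    (fun x _ => ?_) fun _ _ => rfl
  ring

lemma sq2 (H : MetricApprox R τ g h) (hk : k ≤ 4) {T : Fin n → Fin n → Eu n → ℝ}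
    {T₀ : Fin n → Fin n → Smooth n} (hT : ∀ i j, LinApprox R τ k m (T i j) (T₀ i j))
    (i j : Fin n) : LinApprox R τ k (m + m) (sq2 g T i j) (fun _ => 0) :=
  LinApprox.sum_quad Finset.univ fun a _ => LinApprox.sum_quad Finset.univ fun b _ =>
    H.mul (H.ginv_mul hk a b (hT i a)) (hT b j) le_rfl

lemma qcurv (H : MetricApprox R τ g h) : LinApprox R τ 0 4 (qcurv g) (linQ h) := by
  have h1 := ((H.lap H.scal).cast (by norm_num : (2 : ℝ) + 2 = 4)).const_mul
    (-(1 / (2 * ((n : ℝ) - 1))))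
  have h2 := ((H.normSq2 (by norm_num) H.ric).cast (by norm_num : (2 : ℝ) + 2 = 4)).of_le
    (by norm_num : 0 ≤ 2) |>.const_mul (2 / ((n : ℝ) - 2) ^ 2)
  have h3 := ((H.mul H.scal H.scal le_rfl).cast (by norm_num : (2 : ℝ) + 2 = 4)).of_le
    (by norm_num : 0 ≤ 2) |>.const_mul (((n : ℝ) ^ 3 - 4 * (n : ℝ) ^ 2 + 16 * (n : ℝ) - 16)
        / (8 * ((n : ℝ) - 1) ^ 2 * ((n : ℝ) - 2) ^ 2))
  refine ((h1.sub h2).add h3).congr (fun x _ => ?_) fun x _ => ?_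
  · simp only [AEGeom.qcurv]; ring
  · simp [linQ]

lemma tTensor (H : MetricApprox R τ g h) (i j : Fin n) :
    LinApprox R τ 0 4 (tTensor g i j) (linT h i j) := by
  have htr : LinApprox R τ 2 2 (AEGeom.trace2 g (AEGeom.schouten g)) (linTrSchouten h) :=
    H.trace2 (by norm_num) H.schouten
  have h1 := (((H.hess htr i j).sub ((H.metric_mul (by norm_num) i j (H.lap htr)).const_mul
    (1 / (n : ℝ)))).const_mul ((n : ℝ) - 2)).cast (by norm_num : (2 : ℝ) + 2 = 4)
  have hn := (H.normSq2 (by norm_num) H.schouten).of_le (by norm_num : 0 ≤ 2)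
  have h2 := ((((H.sq2 (by norm_num) H.schouten i j).of_le (by norm_num : 0 ≤ 2)).sub
    ((H.metric_mul (by norm_num) i j hn).const_mul (1 / (n : ℝ)))).const_mul
      (4 * ((n : ℝ) - 1))).cast (by norm_num : (2 : ℝ) + 2 = 4)
  have h3 := ((H.mul htr ((H.schouten i j).sub ((H.metric_mul (by norm_num) i j htr).const_mul
    (1 / (n : ℝ)))) le_rfl).of_le (by norm_num : 0 ≤ 2)).cast (by norm_num : (2 : ℝ) + 2 = 4)
    |>.const_mul ((n : ℝ) ^ 2)
  refine ((h1.add h2).sub h3).congr (fun x _ => ?_) fun x _ => ?_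
  · simp only [AEGeom.tTensor]; ring
  · simp [linT, mul_assoc]

lemma jTensor (H : MetricApprox R τ g h) (i j : Fin n) :
    LinApprox R τ 0 4 (jTensor g i j) (linJ h i j) := by
  refine ((((H.metric_mul (by norm_num) i j H.qcurv).const_mul (1 / (n : ℝ))).sub
    ((H.bach i j).const_mul (1 / ((n : ℝ) - 2)))).sub ((H.tTensor i j).const_mul
    (((n : ℝ) - 4) / (4 * ((n : ℝ) - 1) * ((n : ℝ) - 2))))).congr (fun x _ => ?_) fun x _ => ?_
  · simp only [AEGeom.jTensor]; ring
  · simp [linJ, mul_assoc]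

lemma jEinstein (H : MetricApprox R τ g h) (i j : Fin n) :
    LinApprox R τ 0 4 (jEinstein g i j) (linG h i j) := by
  refine ((H.jTensor i j).sub ((H.metric_mul (by norm_num) i j H.qcurv).const_mul (1 / 4))).congr
    (fun x _ => ?_) fun x _ => ?_
  · simp only [AEGeom.jEinstein]; ring
  · simp [linG, mul_assoc]

end MetricApprox

end Remainders

/-! ### The linearized Bianchi identity and the conservation law -/

section Conservation

variable {n : ℕ} {h : Fin n → Fin n → Smooth n}

lemma linRic_eq (hs : ∀ i j, h i j = h j i) (i j : Fin n) :
    linRic h i j = (1 / 2 : ℝ) • ∑ k, (D k (D j (h i k)) + D k (D i (h j k))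
      - D k (D k (h i j)) - D i (D j (h k k))) := by
  rw [linRic, Finset.smul_sum]
  refine Finset.sum_congr rfl fun k _ => ?_
  simp only [linRiem, linChristoffel, map_smul, map_add, map_sub]
  rw [hs k i, hs j i, D_comm j k (h i k), D_comm j i (h k k)]
  module

/-- The classical formula `DR(h) = ∂_i ∂_k h_{ik} - Δ tr h`. -/
lemma linScal_eq (hs : ∀ i j, h i j = h j i) :
    linScal h = ∑ i, ∑ k, (D i (D k (h i k)) - D i (D i (h k k))) := by
  have e1 : ∀ i, linRic h i i = ∑ k, D i (D k (h i k))
      - (1 / 2 : ℝ) • ∑ k, D k (D k (h i i)) - (1 / 2 : ℝ) • ∑ k, D i (D i (h k k)) := by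
    intro i
    rw [linRic_eq hs, Finset.smul_sum, Finset.smul_sum, Finset.smul_sum,
      ← Finset.sum_sub_distrib, ← Finset.sum_sub_distrib]
    refine Finset.sum_congr rfl fun k _ => ?_
    rw [D_comm k i]
    module
  have e2 : ∑ i, ∑ k, D k (D k (h i i)) = ∑ i, ∑ k, D i (D i (h k k)) := Finset.sum_comm
  simp only [linScal, e1, Finset.sum_sub_distrib, ← Finset.smul_sum, e2]
  module

/-- The linearized contracted Bianchi identity `∂_j Ric_{ij} = ∂_i R / 2`. -/
lemma linRic_div (hs : ∀ i j, h i j = h j i) (i : Fin n) :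
    ∑ j, D j (linRic h i j) = (1 / 2 : ℝ) • D i (linScal h) := by
  have e : ∑ j, ∑ k, D j (D k (D i (h j k))) = D i (∑ j, ∑ k, D j (D k (h j k))) := by
    simp only [map_sum]
    refine Finset.sum_congr rfl fun j _ => Finset.sum_congr rfl fun k _ => ?_
    rw [D_comm k i, D_comm j i]
  have e' : ∑ j, ∑ k, D j (D k (D j (h i k))) = ∑ j, ∑ k, D j (D k (D k (h i j))) := by
    rw [Finset.sum_comm]
    refine Finset.sum_congr rfl fun j _ => Finset.sum_congr rfl fun k _ => ?_
    rw [D_comm k j]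
  have e'' : ∑ j, ∑ k, D j (D i (D j (h k k))) = D i (∑ j, ∑ k, D j (D j (h k k))) := by
    simp only [map_sum]
    refine Finset.sum_congr rfl fun j _ => Finset.sum_congr rfl fun k _ => ?_
    rw [D_comm j i]
  have : ∑ j, D j (linRic h i j) = (1 / 2 : ℝ) • (∑ j, ∑ k, D j (D k (D j (h i k)))
      + ∑ j, ∑ k, D j (D k (D i (h j k))) - ∑ j, ∑ k, D j (D k (D k (h i j)))
      - ∑ j, ∑ k, D j (D i (D j (h k k)))) := by
    simp only [linRic_eq hs, map_smul, map_sum, map_sub, map_add, ← Finset.sum_add_distrib,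
      ← Finset.sum_sub_distrib, ← Finset.smul_sum]
  rw [this, e, e', e'', linScal_eq hs]
  simp only [Finset.sum_sub_distrib, map_sub]
  module

lemma sum_kron_smul (i : Fin n) (f : Fin n → Smooth n) :
    ∑ j, kron i j • f j = f i := by
  simp [kron, Matrix.one_apply]

lemma sum_kron_self : ∑ i : Fin n, kron i i = n := by simp [kron]

lemma linTrSchouten_eq (hn : 3 ≤ n) : linTrSchouten h = (1 / (2 * ((n : ℝ) - 1))) • linScal h := by
  have h3 : (3 : ℝ) ≤ n := by exact_mod_cast hn
  have h1 : (n : ℝ) - 1 ≠ 0 := by linarith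
  have h2 : (n : ℝ) - 2 ≠ 0 := by linarith
  simp only [linTrSchouten, linSchouten, ← Finset.smul_sum, Finset.sum_sub_distrib, mul_smul,
    ← Finset.sum_smul, sum_kron_self]
  rw [← linScal]
  match_scalars
  field_simp
  ring

/-- The linearized identity `∂_j S_{ij} = ∂_i tr S`. -/
lemma linSchouten_div (hn : 3 ≤ n) (hs : ∀ i j, h i j = h j i) (i : Fin n) :
    ∑ j, D j (linSchouten h i j) = D i (linTrSchouten h) := by
  have h3 : (3 : ℝ) ≤ n := by exact_mod_cast hn
  have h1 : (n : ℝ) - 1 ≠ 0 := by linarith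
  have h2 : (n : ℝ) - 2 ≠ 0 := by linarith
  simp only [linSchouten, map_smul, map_sub, ← Finset.smul_sum, Finset.sum_sub_distrib,
    linRic_div hs, mul_smul, sum_kron_smul, linTrSchouten_eq hn]
  match_scalars
  field_simp
  ring

lemma linBach_trace (hn : 3 ≤ n) (hs : ∀ i j, h i j = h j i) : ∑ i, linBach h i i = 0 := by
  simp only [linBach]
  rw [Finset.sum_comm]
  refine Finset.sum_eq_zero fun k _ => ?_
  rw [← map_sum]
  simp only [linCotton, Finset.sum_sub_distrib, linSchouten_div hn hs, ← map_sum]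
  simp [linTrSchouten]

/-- The Bach tensor is divergence free at the linear level: derivatives commute, and
`∂_j S_{ij} = ∂_i tr S`. -/
lemma linBach_div (hn : 3 ≤ n) (hs : ∀ i j, h i j = h j i) (i : Fin n) :
    ∑ j, D j (linBach h i j) = 0 := by
  simp only [linBach, linCotton, map_sum, map_sub]
  rw [Finset.sum_comm]
  have : ∀ k, ∑ j, (D j (D k (D k (linSchouten h i j))) - D j (D k (D i (linSchouten h k j))))
      = D k (D k (∑ j, D j (linSchouten h i j))) - D k (D i (∑ j, D j (linSchouten h k j))) := by
    intro k
    rw [Finset.sum_sub_distrib]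
    simp only [map_sum]
    congr 1 <;> refine Finset.sum_congr rfl fun j _ => ?_
    · rw [D_comm j k, D_comm j k]
    · rw [D_comm j k, D_comm j i]
  refine Finset.sum_eq_zero fun k _ => ?_
  rw [this, linSchouten_div hn hs, linSchouten_div hn hs, D_comm i k, sub_self]

lemma linT_trace (hn : 3 ≤ n) : ∑ i, linT h i i = 0 := by
  have h0 : (n : ℝ) ≠ 0 := by positivity
  simp only [linT, ← Finset.smul_sum, Finset.sum_sub_distrib, mul_smul, ← Finset.sum_smul,
    sum_kron_self]
  rw [← euclLap, smul_smul, one_div, inv_mul_cancel₀ h0, one_smul, sub_self, smul_zero]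

lemma linT_div (i : Fin n) : ∑ j, D j (linT h i j)
    = (((n : ℝ) - 2) * (1 - 1 / (n : ℝ))) • D i (euclLap (linTrSchouten h)) := by
  have : ∑ j, D j (D i (D j (linTrSchouten h))) = D i (euclLap (linTrSchouten h)) := by
    simp only [euclLap, map_sum]
    exact Finset.sum_congr rfl fun j _ => D_comm j i _
  simp only [linT, map_smul, map_sub, ← Finset.smul_sum, Finset.sum_sub_distrib, this, mul_smul,
    sum_kron_smul]
  module

lemma linQ_eq (hn : 3 ≤ n) : linQ h = -euclLap (linTrSchouten h) := by
  rw [linTrSchouten_eq hn, linQ]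
  simp only [euclLap, map_smul, ← Finset.smul_sum]
  module

/-- `tr J = Q` at the linear level. -/
lemma linJ_trace (hn : 3 ≤ n) (hs : ∀ i j, h i j = h j i) : ∑ i, linJ h i i = linQ h := by
  have h0 : (n : ℝ) ≠ 0 := by positivity
  simp only [linJ, Finset.sum_sub_distrib, ← Finset.smul_sum, linBach_trace hn hs,
    linT_trace hn, mul_smul, ← Finset.sum_smul, sum_kron_self]
  rw [smul_smul, one_div, inv_mul_cancel₀ h0]
  simp

lemma linG_trace (hn : 3 ≤ n) (hs : ∀ i j, h i j = h j i) :
    ∑ i, linG h i i = (((n : ℝ) - 4) / (8 * ((n : ℝ) - 1))) • euclLap (linScal h) := by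
  have h3 : (3 : ℝ) ≤ n := by exact_mod_cast hn
  have h1 : (n : ℝ) - 1 ≠ 0 := by linarith
  simp only [linG, Finset.sum_sub_distrib, linJ_trace hn hs, mul_smul, ← Finset.smul_sum,
    ← Finset.sum_smul, sum_kron_self, linQ]
  match_scalars
  field_simp
  ring

/-- The linearization of `div G_J = 0`. -/
lemma linG_div (hn : 3 ≤ n) (hs : ∀ i j, h i j = h j i) (i : Fin n) :
    ∑ j, D j (linG h i j) = 0 := by
  have h3 : (3 : ℝ) ≤ n := by exact_mod_cast hn
  have h0 : (n : ℝ) ≠ 0 := by linarith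
  have h1 : (n : ℝ) - 1 ≠ 0 := by linarith
  have h2 : (n : ℝ) - 2 ≠ 0 := by linarith
  simp only [linG, linJ, map_sub, map_smul, Finset.sum_sub_distrib, mul_smul, ← Finset.smul_sum,
    sum_kron_smul, linBach_div hn hs, linT_div, linQ_eq hn, map_neg]
  match_scalars
  field_simp
  ring

end Conservation

/-! ### Polar coordinates and the flux of a vector field through spheres -/

section Polar

variable {n : ℕ}

/-- Integration in polar coordinates, together with the integrability of the radial integrand. -/
lemma integral_polar (hn : 0 < n) {f : Eu n → ℝ} (hf : Integrable f) :
    IntegrableOn (fun r => sphereIntegral r f) (Ioi 0) ∧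
      ∫ x, f x = ∫ r in Ioi 0, sphereIntegral r f := by
  have : Nonempty (Fin n) := ⟨⟨0, hn⟩⟩
  have : Nontrivial (Eu n) := inferInstance
  have hdim : Module.finrank ℝ (Eu n) = n := finrank_euclideanSpace_fin
  have hmp := (volume : Measure (Eu n)).measurePreserving_homeomorphUnitSphereProd
  have hemb := (homeomorphUnitSphereProd (Eu n)).measurableEmbedding
  rw [hdim] at hmp
  set F : Metric.sphere (0 : Eu n) 1 × Ioi (0 : ℝ) → ℝ := fun z => f (z.2.1 • (z.1 : Eu n)) with hF
  have hcomp : F ∘ homeomorphUnitSphereProd (Eu n) = fun x : ({0}ᶜ : Set (Eu n)) => f x := by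
    funext x
    have hx : ‖(x : Eu n)‖ ≠ 0 := norm_ne_zero_iff.mpr x.2
    simp [F, smul_smul, hx]
  have hres : volume.restrict ({0}ᶜ : Set (Eu n)) = volume := by
    rw [restrict_compl_singleton]
  have hint : Integrable F ((volume : Measure (Eu n)).toSphere.prod
      (Measure.volumeIoiPow (n - 1))) := by
    rw [← hmp.integrable_comp_emb hemb, hcomp]
    have := (integrableOn_iff_comap_subtypeVal (μ := (volume : Measure (Eu n))) (f := f)
      (measurableSet_singleton (0 : Eu n)).compl).mp hf.integrableOn
    exact this
  have hval : ∫ x, f x = ∫ z, F z ∂((volume : Measure (Eu n)).toSphere.prod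
      (Measure.volumeIoiPow (n - 1))) := by
    rw [← hmp.integral_comp hemb]
    have h2 := congrFun hcomp
    simp only [Function.comp_apply] at h2
    simp only [h2]
    rw [integral_subtype_comap (measurableSet_singleton (0 : Eu n)).compl f, hres]
  have hsph : ∀ r : Ioi (0 : ℝ), r.1 ^ (n - 1) * ∫ θ, F (θ, r) ∂(volume : Measure (Eu n)).toSphere
      = sphereIntegral r.1 f := fun r => rfl
  have hmeas : Measurable fun r : Ioi (0 : ℝ) => Real.toNNReal (r.1 ^ (n - 1)) := by fun_prop
  constructor
  · have h1 := hint.integral_prod_right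
    rw [Measure.volumeIoiPow] at h1
    simp only [ENNReal.ofReal] at h1
    rw [integrable_withDensity_iff_integrable_smul hmeas] at h1
    rw [integrableOn_iff_comap_subtypeVal measurableSet_Ioi]
    refine h1.congr (Eventually.of_forall fun r => ?_)
    have hr : (0 : ℝ) ≤ r.1 ^ (n - 1) := pow_nonneg (le_of_lt r.2) _
    simp only [NNReal.smul_def, Real.coe_toNNReal _ hr, smul_eq_mul]
    exact hsph r
  · rw [hval, integral_prod_symm _ hint, Measure.volumeIoiPow]
    simp only [ENNReal.ofReal]
    rw [integral_withDensity_eq_integral_smul hmeas,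
      ← integral_subtype_comap measurableSet_Ioi (fun r => sphereIntegral r f)]
    refine integral_congr_ae (Eventually.of_forall fun r => ?_)
    have hr : (0 : ℝ) ≤ r.1 ^ (n - 1) := pow_nonneg (le_of_lt r.2) _
    simp only [NNReal.smul_def, Real.coe_toNNReal _ hr, smul_eq_mul]
    exact hsph r

/-- Values outside the sphere of radius `r` do not matter. -/
lemma sphereIntegral_congr {r : ℝ} (hr : 0 ≤ r) {f g : Eu n → ℝ} (h : ∀ x, ‖x‖ = r → f x = g x) :
    sphereIntegral r f = sphereIntegral r g := by
  unfold sphereIntegral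
  congr 1
  refine integral_congr_ae (Eventually.of_forall fun θ => h _ ?_)
  have : ‖(θ : Eu n)‖ = 1 := by simp
  rw [norm_smul, this, mul_one, Real.norm_of_nonneg hr]

lemma abs_sphereIntegral_le {r C : ℝ} (hr : 0 ≤ r) {f : Eu n → ℝ}
    (h : ∀ x, ‖x‖ = r → |f x| ≤ C) :
    |sphereIntegral r f| ≤ r ^ (n - 1) * (C * ((volume : Measure (Eu n)).toSphere).real univ) := by
  unfold sphereIntegral
  rw [abs_mul, abs_of_nonneg (pow_nonneg hr _)]
  refine mul_le_mul_of_nonneg_left ?_ (pow_nonneg hr _)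
  refine norm_integral_le_of_norm_le_const (Eventually.of_forall fun θ =>
    (Real.norm_eq_abs _).trans_le (h _ ?_))
  have : ‖(θ : Eu n)‖ = 1 := by simp
  rw [norm_smul, this, mul_one, Real.norm_of_nonneg hr]

lemma integrable_sphere_of_continuousOn {r R : ℝ} (hr : 0 ≤ r) (hR : R < r) {f : Eu n → ℝ}
    (hf : ContinuousOn f (exterior n R)) :
    Integrable (fun θ : Metric.sphere (0 : Eu n) 1 => f (r • (θ : Eu n)))
      (volume : Measure (Eu n)).toSphere := by
  have : Continuous fun θ : Metric.sphere (0 : Eu n) 1 => f (r • (θ : Eu n)) := by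
    refine hf.comp_continuous (by fun_prop) fun θ => ?_
    have : ‖(θ : Eu n)‖ = 1 := by simp
    simpa [exterior, norm_smul, this, abs_of_nonneg hr] using hR
  exact this.integrable_of_hasCompactSupport (HasCompactSupport.of_compactSpace _)

lemma sphereIntegral_add {r R : ℝ} (hr : 0 ≤ r) (hR : R < r) {f g : Eu n → ℝ}
    (hf : ContinuousOn f (exterior n R)) (hg : ContinuousOn g (exterior n R)) :
    sphereIntegral r (fun x => f x + g x) = sphereIntegral r f + sphereIntegral r g := by
  unfold sphereIntegral
  rw [integral_add (integrable_sphere_of_continuousOn hr hR hf)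
    (integrable_sphere_of_continuousOn hr hR hg), mul_add]

lemma sphereIntegral_const_mul (r c : ℝ) (f : Eu n → ℝ) :
    sphereIntegral r (fun x => c * f x) = c * sphereIntegral r f := by
  unfold sphereIntegral
  rw [integral_const_mul]
  ring

/-- The flux of the vector field `F` through the sphere of radius `r`. -/
def flux (F : Fin n → Eu n → ℝ) (r : ℝ) : ℝ :=
  sphereIntegral r fun x => ∑ j, F j x * (x j / ‖x‖)

lemma continuous_integral_sphere {G : ℝ → Metric.sphere (0 : Eu n) 1 → ℝ}
    (hG : Continuous G.uncurry) :
    Continuous fun r => ∫ θ, G r θ ∂(volume : Measure (Eu n)).toSphere := by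
  have := continuous_parametric_integral_of_continuous
    (μ := (volume : Measure (Eu n)).toSphere) hG isCompact_univ
  simpa using this

lemma hasDerivAt_integral_sphere {G G' : ℝ → Metric.sphere (0 : Eu n) 1 → ℝ}
    (hG : Continuous G.uncurry) (hG' : Continuous G'.uncurry)
    (hd : ∀ r θ, HasDerivAt (fun s => G s θ) (G' r θ) r) (r : ℝ) :
    HasDerivAt (fun s => ∫ θ, G s θ ∂(volume : Measure (Eu n)).toSphere)
      (∫ θ, G' r θ ∂(volume : Measure (Eu n)).toSphere) r := by
  obtain ⟨C, hC⟩ := ((isCompact_closedBall r 1).prod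
    (isCompact_univ (X := Metric.sphere (0 : Eu n) 1))).bddAbove_image hG'.norm.continuousOn
  have hint : ∀ s, Continuous (G s) := fun s =>
    hG.comp (continuous_const.prodMk continuous_id)
  have hint' : ∀ s, Continuous (G' s) := fun s =>
    hG'.comp (continuous_const.prodMk continuous_id)
  refine (hasDerivAt_integral_of_dominated_loc_of_deriv_le (bound := fun _ => C)
    (Metric.closedBall_mem_nhds r one_pos) (Eventually.of_forall fun s =>
      (hint s).aestronglyMeasurable) ?_ (hint' r).aestronglyMeasurable ?_
      (integrable_const C) ?_).2
  · exact (hint r).integrable_of_hasCompactSupport (HasCompactSupport.of_compactSpace _)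
  · refine Eventually.of_forall fun θ s hs => ?_
    exact hC ⟨(s, θ), ⟨hs, mem_univ _⟩, rfl⟩
  · exact Eventually.of_forall fun θ s _ => hd s θ

lemma pd_norm {x : Eu n} (hx : x ≠ 0) (j : Fin n) : pd j (fun y => ‖y‖) x = x j / ‖x‖ := by
  have hd : HasFDerivAt (fun y : Eu n => ‖y‖) (fderiv ℝ (fun y : Eu n => ‖y‖) x) x :=
    ((contDiffAt_norm ℝ hx (n := 1)).differentiableAt one_ne_zero).hasFDerivAt
  have h2 := (hd.pow 2).unique (hasStrictFDerivAt_norm_sq x).hasFDerivAt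
  have h3 := congrArg (fun L => L (EuclideanSpace.single j (1 : ℝ))) h2
  have hx' : ‖x‖ ≠ 0 := norm_ne_zero_iff.mpr hx
  simp [EuclideanSpace.inner_single_right] at h3
  rw [pd, eq_div_iff hx']
  linarith

/-- Radial test functions. -/
lemma contDiff_comp_norm {ψ : ℝ → ℝ} (hψ : ContDiff ℝ ∞ ψ) (h0 : tsupport ψ ⊆ Ioi 0) :
    ContDiff ℝ ∞ (fun x : Eu n => ψ ‖x‖) := by
  rw [contDiff_iff_contDiffAt]
  intro x
  rcases eq_or_ne x 0 with rfl | hx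
  · have h1 : ∀ᶠ s in 𝓝 (0 : ℝ), ψ s = 0 := by
      have : (0 : ℝ) ∉ tsupport ψ := fun h => lt_irrefl (0 : ℝ) (h0 h)
      exact notMem_tsupport_iff_eventuallyEq.mp this
    have h2 : Tendsto (fun y : Eu n => ‖y‖) (𝓝 0) (𝓝 0) := by
      simpa using (continuous_norm (E := Eu n)).tendsto 0
    exact contDiffAt_const.congr_of_eventuallyEq (h2.eventually h1)
  · exact hψ.contDiffAt.comp x (contDiffAt_norm ℝ hx)

lemma pd_comp_norm {ψ : ℝ → ℝ} (hψ : ContDiff ℝ ∞ ψ) (h0 : tsupport ψ ⊆ Ioi 0) (j : Fin n)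
    (x : Eu n) : pd j (fun y => ψ ‖y‖) x = deriv ψ ‖x‖ * (x j / ‖x‖) := by
  rcases eq_or_ne x 0 with rfl | hx
  · have h1 : ∀ᶠ s in 𝓝 (0 : ℝ), ψ s = 0 := by
      have : (0 : ℝ) ∉ tsupport ψ := fun h => lt_irrefl (0 : ℝ) (h0 h)
      exact notMem_tsupport_iff_eventuallyEq.mp this
    have h2 : Tendsto (fun y : Eu n => ‖y‖) (𝓝 0) (𝓝 0) := by
      simpa using (continuous_norm (E := Eu n)).tendsto 0
    have h3 : (fun y : Eu n => ψ ‖y‖) =ᶠ[𝓝 0] fun _ => 0 := h2.eventually h1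
    rw [pd_congr_nhds h3, pd_const]
    simp
  · rw [← pd_norm hx]
    have hd : HasFDerivAt (fun y : Eu n => ‖y‖) (fderiv ℝ (fun y : Eu n => ‖y‖) x) x :=
      ((contDiffAt_norm ℝ hx (n := 1)).differentiableAt one_ne_zero).hasFDerivAt
    have h1 : HasDerivAt ψ (deriv ψ ‖x‖) ‖x‖ :=
      ((hψ.differentiable (by simp)) ‖x‖).hasDerivAt
    have h2 : HasFDerivAt (fun y : Eu n => ψ ‖y‖)
        (deriv ψ ‖x‖ • fderiv ℝ (fun y : Eu n => ‖y‖) x) x := h1.comp_hasFDerivAt x hd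
    simp only [pd]
    rw [h2.fderiv]
    simp

lemma hasCompactSupport_comp_norm {ψ : ℝ → ℝ} (hc : HasCompactSupport ψ) :
    HasCompactSupport (fun x : Eu n => ψ ‖x‖) := by
  obtain ⟨R, hR⟩ := hc.isCompact.isBounded.subset_closedBall 0
  refine HasCompactSupport.intro (isCompact_closedBall (0 : Eu n) R) fun x hx => ?_
  by_contra h
  have := hR (subset_tsupport ψ h)
  apply hx
  simpa using this

/-- The weak form of the divergence theorem: testing against `ψ(|x|)`. -/
lemma integral_flux_test (hn : 0 < n) {F : Fin n → Eu n → ℝ} (hF : ∀ j, ContDiff ℝ ∞ (F j))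
    {ψ : ℝ → ℝ} (hψ : ContDiff ℝ ∞ ψ) (hc : HasCompactSupport ψ) (h0 : tsupport ψ ⊆ Ioi 0) :
    ∫ r in Ioi 0, ψ r * sphereIntegral r (fun x => ∑ j, pd j (F j) x)
      = -∫ r in Ioi 0, deriv ψ r * flux F r := by
  set w : Eu n → ℝ := fun x => ψ ‖x‖ with hw
  have hws : ContDiff ℝ ∞ w := contDiff_comp_norm hψ h0
  have hwc : HasCompactSupport w := hasCompactSupport_comp_norm hc
  have hpw : ∀ j, HasCompactSupport (pd j w) := fun j =>
    (hwc.fderiv ℝ).comp_left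
      (g := fun L : Eu n →L[ℝ] ℝ => L (EuclideanSpace.single j (1 : ℝ))) (by simp)
  have i1 : ∀ j, Integrable fun x => w x * pd j (F j) x := fun j =>
    (hws.continuous.mul (contDiff_pd (hF j) j).continuous).integrable_of_hasCompactSupport
      hwc.mul_right
  have i2 : ∀ j, Integrable fun x => pd j w x * F j x := fun j =>
    ((contDiff_pd hws j).continuous.mul (hF j).continuous).integrable_of_hasCompactSupport
      (hpw j).mul_right
  have i3 : ∀ j, Integrable fun x => w x * F j x := fun j =>
    (hws.continuous.mul (hF j).continuous).integrable_of_hasCompactSupport hwc.mul_right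
  have hparts : ∀ j, ∫ x, w x * pd j (F j) x = -∫ x, pd j w x * F j x := fun j =>
    integral_mul_fderiv_eq_neg_fderiv_mul_of_integrable (i2 j) (i1 j) (i3 j)
      (fun x _ => hws.differentiable (by simp) x) (fun x _ => (hF j).differentiable (by simp) x)
  have hsum : ∫ x, ∑ j, w x * pd j (F j) x = -∫ x, ∑ j, pd j w x * F j x := by
    rw [integral_finsetSum _ fun j _ => i1 j, integral_finsetSum _ fun j _ => i2 j,
      ← Finset.sum_neg_distrib]
    exact Finset.sum_congr rfl fun j _ => hparts j
  rw [(integral_polar hn (integrable_finsetSum _ fun j _ => i1 j)).2,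
    (integral_polar hn (integrable_finsetSum _ fun j _ => i2 j)).2] at hsum
  calc _ = ∫ r in Ioi 0, sphereIntegral r fun x => ∑ j, w x * pd j (F j) x := by
        refine setIntegral_congr_fun measurableSet_Ioi fun r hr => ?_
        rw [← sphereIntegral_const_mul]
        refine sphereIntegral_congr (le_of_lt hr) fun x hx => ?_
        rw [Finset.mul_sum, ← hx]
    _ = -∫ r in Ioi 0, sphereIntegral r fun x => ∑ j, pd j w x * F j x := hsum
    _ = _ := by
        congr 1
        refine setIntegral_congr_fun measurableSet_Ioi fun r hr => ?_
        simp only [flux]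
        rw [← sphereIntegral_const_mul]
        refine sphereIntegral_congr (le_of_lt hr) fun x hx => ?_
        rw [Finset.mul_sum, ← hx]
        refine Finset.sum_congr rfl fun j _ => ?_
        rw [pd_comp_norm hψ h0]
        ring

/-- The divergence theorem on spherical shells, in differential form: the derivative of the flux
through the sphere of radius `r` is the integral of the divergence over that sphere. -/
theorem hasDerivAt_flux (hn : 0 < n) {F : Fin n → Eu n → ℝ} (hF : ∀ j, ContDiff ℝ ∞ (F j))
    {r : ℝ} (hr : 0 < r) :
    HasDerivAt (flux F) (sphereIntegral r fun x => ∑ j, pd j (F j) x) r := by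
  -- `Φ` is the flux, written so that it is differentiable on all of `ℝ`.
  set A : ℝ → ℝ := fun r => ∫ θ : Metric.sphere (0 : Eu n) 1,
    ∑ j, F j (r • (θ : Eu n)) * (θ : Eu n) j ∂(volume : Measure (Eu n)).toSphere with hA
  set A' : ℝ → ℝ := fun r => ∫ θ : Metric.sphere (0 : Eu n) 1,
    ∑ j, fderiv ℝ (F j) (r • (θ : Eu n)) (θ : Eu n) * (θ : Eu n) j
      ∂(volume : Measure (Eu n)).toSphere with hA'
  have hcF : ∀ j, Continuous fun p : ℝ × Metric.sphere (0 : Eu n) 1 => F j (p.1 • (p.2 : Eu n)) :=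
    fun j => (hF j).continuous.comp (by fun_prop)
  have hcF' : ∀ j, Continuous fun p : ℝ × Metric.sphere (0 : Eu n) 1 =>
      fderiv ℝ (F j) (p.1 • (p.2 : Eu n)) (p.2 : Eu n) := fun j => by
    have h1 : Continuous (fderiv ℝ (F j)) := (hF j).continuous_fderiv (by simp)
    have h2 : Continuous fun p : ℝ × Metric.sphere (0 : Eu n) 1 =>
      fderiv ℝ (F j) (p.1 • (p.2 : Eu n)) := h1.comp (by fun_prop)
    exact h2.clm_apply (by fun_prop)
  have hAd : ∀ r, HasDerivAt A (A' r) r := by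
    refine hasDerivAt_integral_sphere ?_ ?_ ?_
    · exact continuous_finsetSum _ fun j _ => (hcF j).mul (by fun_prop)
    · exact continuous_finsetSum _ fun j _ => (hcF' j).mul (by fun_prop)
    · intro r θ
      refine HasDerivAt.fun_sum fun j _ => HasDerivAt.mul_const ?_ _
      have h1 : HasDerivAt (fun s : ℝ => s • (θ : Eu n)) (θ : Eu n) r := by
        simpa using (hasDerivAt_id r).smul_const (θ : Eu n)
      exact (((hF j).differentiable (by simp)) _).hasFDerivAt.comp_hasDerivAt r h1
  have hA'c : Continuous A' := continuous_integral_sphere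
    (continuous_finsetSum _ fun j _ => (hcF' j).mul (by fun_prop))
  set Φ : ℝ → ℝ := fun r => r ^ (n - 1) * A r with hΦ
  set Φ' : ℝ → ℝ := fun r => ((n - 1 : ℕ) : ℝ) * r ^ (n - 1 - 1) * A r + r ^ (n - 1) * A' r with hΦ'
  have hΦd : ∀ r, HasDerivAt Φ (Φ' r) r := fun r => (hasDerivAt_pow (n - 1) r).mul (hAd r)
  have hAc : Continuous A := continuous_iff_continuousAt.mpr fun r => (hAd r).continuousAt
  have hΦc : Continuous Φ := by fun_prop
  have hΦ'c : Continuous Φ' := by fun_prop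
  have hΦeq : ∀ r, 0 < r → flux F r = Φ r := by
    intro r hr
    simp only [flux, sphereIntegral, hΦ, hA]
    congr 1
    refine integral_congr_ae (Eventually.of_forall fun θ => ?_)
    have : ‖(θ : Eu n)‖ = 1 := by simp
    refine Finset.sum_congr rfl fun j _ => ?_
    rw [norm_smul, this, mul_one, Real.norm_of_nonneg hr.le, PiLp.smul_apply, smul_eq_mul,
      mul_div_cancel_left₀ _ hr.ne']
  set B : ℝ → ℝ := fun r => sphereIntegral r fun x => ∑ j, pd j (F j) x with hB
  have hBc : Continuous B := by
    refine (continuous_pow (n - 1)).mul (continuous_integral_sphere ?_)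
    exact continuous_finsetSum _ fun j _ =>
      ((contDiff_pd (hF j) j).continuous).comp (by fun_prop)
  have hae : ∀ᵐ r ∂(volume : Measure ℝ), r ∈ Ioi (0 : ℝ) → B r - Φ' r = 0 := by
    refine isOpen_Ioi.ae_eq_zero_of_integral_contDiff_smul_eq_zero
      ((hBc.sub hΦ'c).locallyIntegrable.locallyIntegrableOn _) fun ψ hψ hc h0 => ?_
    have hψz : ∀ r, r ∉ Ioi (0 : ℝ) → ψ r = 0 := fun r hr => by
      by_contra h
      exact hr (h0 (subset_tsupport ψ h))
    have hψz' : ∀ r, r ∉ Ioi (0 : ℝ) → deriv ψ r = 0 := fun r hr => by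
      by_contra h
      exact hr (h0 (support_deriv_subset h))
    have hψ'c : Continuous (deriv ψ) := hψ.continuous_deriv (by simp)
    have j1 : Integrable fun r => ψ r * B r :=
      (hψ.continuous.mul hBc).integrable_of_hasCompactSupport hc.mul_right
    have j2 : Integrable fun r => ψ r * Φ' r :=
      (hψ.continuous.mul hΦ'c).integrable_of_hasCompactSupport hc.mul_right
    have j3 : Integrable fun r => deriv ψ r * Φ r :=
      (hψ'c.mul hΦc).integrable_of_hasCompactSupport hc.deriv.mul_right
    have j4 : Integrable fun r => ψ r * Φ r :=
      (hψ.continuous.mul hΦc).integrable_of_hasCompactSupport hc.mul_right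
    have e1 : ∫ r, ψ r * B r = -∫ r, deriv ψ r * Φ r := by
      have := integral_flux_test hn hF hψ hc h0
      rw [setIntegral_congr_fun measurableSet_Ioi
        (fun r hr => by simp only [hΦeq r hr] : EqOn (fun r => deriv ψ r * flux F r)
          (fun r => deriv ψ r * Φ r) (Ioi 0)),
        setIntegral_eq_integral_of_forall_compl_eq_zero (fun r hr => by rw [hψz r hr, zero_mul]),
        setIntegral_eq_integral_of_forall_compl_eq_zero (fun r hr => by rw [hψz' r hr, zero_mul])]
        at this
      exact this
    have e2 : ∫ r, (deriv ψ r * Φ r + ψ r * Φ' r) = 0 :=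
      integral_eq_zero_of_hasDerivAt_of_integrable
        (fun r => ((hψ.differentiable (by simp)) r).hasDerivAt.mul (hΦd r)) (j3.add j2) j4
    rw [integral_add j3 j2] at e2
    simp only [smul_eq_mul, mul_sub]
    rw [integral_sub j1 j2, e1]
    linarith
  have heq : EqOn B Φ' (Ioi 0) := by
    refine Measure.eqOn_open_of_ae_eq (μ := volume) ?_ isOpen_Ioi hBc.continuousOn
      hΦ'c.continuousOn
    rw [EventuallyEq, ae_restrict_iff' measurableSet_Ioi]
    filter_upwards [hae] with r h hr
    exact sub_eq_zero.mp (h hr)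
  rw [show (sphereIntegral r fun x => ∑ j, pd j (F j) x) = Φ' r from heq hr]
  refine (hΦd r).congr_of_eventuallyEq ?_
  filter_upwards [lt_mem_nhds hr] with s hs using hΦeq s hs

/-- A divergence-free vector field on `ℝⁿ` has no flux. -/
theorem flux_eq_zero (hn : 2 ≤ n) {F : Fin n → Eu n → ℝ} (hF : ∀ j, ContDiff ℝ ∞ (F j))
    (hdiv : ∀ x, ∑ j, pd j (F j) x = 0) {r : ℝ} (hr : 0 < r) : flux F r = 0 := by
  have hn0 : 0 < n := by omega
  have hd : ∀ s ∈ Ioi (0 : ℝ), HasDerivAt (flux F) 0 s := by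
    intro s hs
    have := hasDerivAt_flux hn0 hF hs
    simpa [hdiv, sphereIntegral] using this
  have hconst : ∀ s ∈ Ioi (0 : ℝ), flux F s = flux F r := fun s hs =>
    isOpen_Ioi.is_const_of_deriv_eq_zero (convex_Ioi (0 : ℝ)).isPreconnected
      (fun t ht => (hd t ht).differentiableAt.differentiableWithinAt)
      (fun t ht => (hd t ht).deriv) hs hr
  -- The flux is `O(sⁿ⁻¹)` as `s → 0`.
  obtain ⟨C, hC⟩ : ∃ C, ∀ x : Eu n, ‖x‖ ≤ 1 → ‖∑ j, |F j x|‖ ≤ C := by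
    have hc : Continuous fun x => ∑ j, |F j x| :=
      continuous_finsetSum _ fun j _ => (hF j).continuous.abs
    obtain ⟨C, hC⟩ := (isCompact_closedBall (0 : Eu n) 1).exists_bound_of_continuousOn
      hc.continuousOn
    exact ⟨C, fun x hx => hC x (by simpa using hx)⟩
  have hb : ∀ s ∈ Ioc (0 : ℝ) 1, |flux F r|
      ≤ s ^ (n - 1) * (C * ((volume : Measure (Eu n)).toSphere).real univ) := by
    intro s hs
    rw [← hconst s hs.1]
    refine abs_sphereIntegral_le hs.1.le fun x hx => ?_
    refine le_trans ?_ (hC x (hx.trans_le hs.2))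
    refine (Finset.abs_sum_le_sum_abs _ _).trans (le_trans ?_ (le_abs_self _))
    refine Finset.sum_le_sum fun j _ => ?_
    rw [abs_mul]
    refine mul_le_of_le_one_right (abs_nonneg _) ?_
    rw [abs_div, abs_norm]
    exact div_le_one_of_le₀ (PiLp.norm_apply_le x j) (norm_nonneg x)
  have hlim : Tendsto (fun s : ℝ => s ^ (n - 1) *
      (C * ((volume : Measure (Eu n)).toSphere).real univ)) (𝓝[>] 0) (𝓝 0) := by
    have : Continuous fun s : ℝ => s ^ (n - 1) *
      (C * ((volume : Measure (Eu n)).toSphere).real univ) := by fun_prop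
    have h := this.tendsto 0
    rw [zero_pow (by omega), zero_mul] at h
    exact h.mono_left nhdsWithin_le_nhds
  have hle : |flux F r| ≤ 0 := ge_of_tendsto hlim (by
    filter_upwards [Ioc_mem_nhdsGT (zero_lt_one' ℝ)] with s hs using hb s hs)
  exact abs_eq_zero.mp (le_antisymm hle (abs_nonneg _))

/-- The flux of a vector field with integrable divergence converges. -/
theorem exists_tendsto_flux (hn : 0 < n) {F : Fin n → Eu n → ℝ} (hF : ∀ j, ContDiff ℝ ∞ (F j))
    {R : ℝ} (hR : 0 ≤ R) (hint : IntegrableOn (fun x => ∑ j, pd j (F j) x) (exterior n R)) :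
    ∃ c, Tendsto (flux F) atTop (𝓝 c) := by
  have hm : MeasurableSet (exterior n R) := (isOpen_exterior R).measurableSet
  have h1 := (integral_polar hn ((integrable_indicator_iff hm).mpr hint)).1
  have h2 : IntegrableOn (fun r => sphereIntegral r fun x => ∑ j, pd j (F j) x) (Ioi R) := by
    refine (h1.mono_set (Ioi_subset_Ioi hR)).congr_fun (fun r hr => ?_) measurableSet_Ioi
    refine sphereIntegral_congr (hR.trans (le_of_lt hr)) fun x hx => ?_
    rw [indicator_of_mem]
    exact (show R < ‖x‖ from hx.symm ▸ hr)
  exact ⟨_, tendsto_limUnder_of_hasDerivAt_of_integrableOn_Ioi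
    (fun r hr => hasDerivAt_flux hn hF (hR.trans_lt hr)) h2⟩

end Polar

/-! ### Fluxes of asymptotically Euclidean metrics in coordinates -/

section Fluxes

variable {n : ℕ} {R τ : ℝ}

lemma abs_coord_div_norm_le (x : Eu n) (j : Fin n) : |x j / ‖x‖| ≤ 1 := by
  rw [abs_div, abs_norm]
  exact div_le_one_of_le₀ (PiLp.norm_apply_le x j) (norm_nonneg x)

/-- The terms `O(|x|^{-a})` with `a > n - 1` do not contribute to integrals over large spheres. -/
lemma tendsto_sphereIntegral_zero (hR : 1 ≤ R) (hn : 0 < n) {a C : ℝ} (ha : (n : ℝ) - 1 < a)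
    {f : Eu n → ℝ} (hf : ∀ x ∈ exterior n R, |f x| ≤ C * ‖x‖ ^ (-a)) :
    Tendsto (fun r => sphereIntegral r f) atTop (𝓝 0) := by
  set K := C * ((volume : Measure (Eu n)).toSphere).real univ with hK
  have hlim : Tendsto (fun r : ℝ => r ^ (-(a - ((n : ℝ) - 1))) * K) atTop (𝓝 0) := by
    simpa using (tendsto_rpow_neg_atTop (by linarith : 0 < a - ((n : ℝ) - 1))).mul_const K
  refine squeeze_zero_norm' ?_ hlim
  filter_upwards [eventually_gt_atTop R] with r hr
  have hr0 : 0 < r := by linarith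
  have h1 := abs_sphereIntegral_le hr0.le (f := f) (C := C * r ^ (-a)) fun x hx => by
    have := hf x (show R < ‖x‖ from hx.symm ▸ hr)
    rwa [hx] at this
  rw [Real.norm_eq_abs]
  refine h1.trans (le_of_eq ?_)
  have h2 : r ^ (n - 1) = r ^ ((n : ℝ) - 1) := by
    rw [← Real.rpow_natCast, Nat.cast_sub (by omega), Nat.cast_one]
  rw [h2, neg_sub, sub_eq_add_neg _ a, Real.rpow_add hr0, hK]
  ring

lemma tendsto_flux_zero (hR : 1 ≤ R) (hn : 0 < n) {a : ℝ} (ha : (n : ℝ) - 1 < a)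
    {F : Fin n → Eu n → ℝ} (hF : ∀ j, SymbolDecay R 0 a (F j)) :
    Tendsto (flux F) atTop (𝓝 0) := by
  choose C hC using fun j => (hF j).bound
  refine tendsto_sphereIntegral_zero (C := ∑ j, C j) hR hn ha fun x hx => ?_
  rw [Finset.sum_mul]
  refine (Finset.abs_sum_le_sum_abs _ _).trans (Finset.sum_le_sum fun j _ => ?_)
  rw [abs_mul]
  exact (mul_le_of_le_one_right (abs_nonneg _) (abs_coord_div_norm_le x j)).trans (hC j x hx)

/-- As `X` has length `r`, contraction with `X` costs one order of decay. -/
lemma tendsto_sphereIntegral_contraction_zero (hR : 1 ≤ R) (hn : 0 < n) {a : ℝ} (ha : (n : ℝ) < a)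
    {E : Fin n → Fin n → Eu n → ℝ} (hE : ∀ i j, SymbolDecay R 0 a (E i j)) :
    Tendsto (fun r => sphereIntegral r fun x => ∑ i, ∑ j, E i j x * x i * (x j / ‖x‖))
      atTop (𝓝 0) := by
  choose C hC using fun i j => (hE i j).bound
  refine tendsto_sphereIntegral_zero (C := ∑ i, ∑ j, C i j) (a := a - 1) hR hn (by linarith)
    fun x hx => ?_
  simp only [Finset.sum_mul]
  refine (Finset.abs_sum_le_sum_abs _ _).trans (Finset.sum_le_sum fun i _ => ?_)
  refine (Finset.abs_sum_le_sum_abs _ _).trans (Finset.sum_le_sum fun j _ => ?_)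
  have hx0 : 0 < ‖x‖ := by
    have : R < ‖x‖ := hx
    linarith
  have hpow : ‖x‖ ^ (-(a - 1)) = ‖x‖ ^ (-a) * ‖x‖ := by
    rw [show -(a - 1) = -a + 1 by ring, Real.rpow_add hx0, Real.rpow_one]
  rw [hpow, ← mul_assoc, abs_mul, abs_mul]
  exact (mul_le_of_le_one_right (by positivity) (abs_coord_div_norm_le x j)).trans
    (mul_le_mul (hC i j x hx) (PiLp.norm_apply_le x i) (abs_nonneg _)
      ((abs_nonneg _).trans (hC i j x hx)))

lemma SymbolDecay.integrableOn (hR : 1 ≤ R) {a : ℝ} (ha : (n : ℝ) < a) {f : Eu n → ℝ}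
    (hf : SymbolDecay R 0 a f) : IntegrableOn f (exterior n R) := by
  have hm : MeasurableSet (exterior n R) := (isOpen_exterior R).measurableSet
  obtain ⟨C, hC⟩ := hf.bound
  have ha0 : 0 ≤ a := (Nat.cast_nonneg n).trans ha.le
  have hint : Integrable fun x : Eu n => |C| * (2 ^ a * (1 + ‖x‖) ^ (-a)) :=
    ((integrable_one_add_norm (by rwa [finrank_euclideanSpace_fin])).const_mul _).const_mul _
  refine hint.integrableOn.mono' (hf.contDiffOn.continuousOn.aestronglyMeasurable hm) ?_
  refine (ae_restrict_iff' hm).mpr (Eventually.of_forall fun x hx => ?_)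
  have hx1 : 1 ≤ ‖x‖ := hR.trans (le_of_lt hx)
  have hx0 : 0 < ‖x‖ := by linarith
  rw [Real.norm_eq_abs]
  refine (hC x hx).trans (mul_le_mul (le_abs_self C) ?_ (by positivity) (abs_nonneg C))
  rw [Real.rpow_neg hx0.le, Real.rpow_neg (by positivity), ← div_eq_mul_inv,
    ← Real.div_rpow (by norm_num) (by positivity), ← Real.inv_rpow hx0.le]
  refine Real.rpow_le_rpow (by positivity) ?_ ha0
  rw [inv_eq_one_div, div_le_div_iff₀ hx0 (by positivity)]
  linarith

variable {g : Eu n → Matrix (Fin n) (Fin n) ℝ} {h : Fin n → Fin n → Smooth n}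

/-- The vector field `-∇ DR(h)` whose flux is the fourth-order energy. -/
def energyField (h : Fin n → Fin n → Smooth n) (j : Fin n) : Eu n → ℝ := -(D j (linScal h))

/-- The contraction of the linearized `J`-Einstein tensor with the position field `X = x^i ∂_i`. -/
def linJField (h : Fin n → Fin n → Smooth n) (j : Fin n) (x : Eu n) : ℝ :=
  ∑ i, (linG h i j : Eu n → ℝ) x * x i

lemma contDiff_energyField (j : Fin n) : ContDiff ℝ ∞ (energyField h j) :=
  (contDiff_coe (D j (linScal h))).neg

lemma contDiff_coord (i : Fin n) : ContDiff ℝ ∞ (fun x : Eu n => x i) :=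
  (EuclideanSpace.proj (𝕜 := ℝ) i).contDiff

lemma contDiff_linJField (j : Fin n) : ContDiff ℝ ∞ (linJField h j) :=
  ContDiff.sum fun i _ => (contDiff_coe _).mul (contDiff_coord i)

lemma pd_coord (i j : Fin n) (x : Eu n) : pd j (fun y : Eu n => y i) x = kron i j := by
  have : fderiv ℝ (fun y : Eu n => y i) x = EuclideanSpace.proj (𝕜 := ℝ) i :=
    (EuclideanSpace.proj (𝕜 := ℝ) i).fderiv
  rw [pd, this]
  simp [kron, Matrix.one_apply]

lemma div_energyField (x : Eu n) :
    ∑ j, pd j (energyField h j) x = -(euclLap (linScal h) : Eu n → ℝ) x := by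
  have : ∀ j, pd j (energyField h j) = ((D j (-(D j (linScal h))) : Smooth n) : Eu n → ℝ) :=
    fun j => rfl
  simp [this, euclLap, Smooth.sum_apply]

/-- Contracting the divergence-free tensor `DG_J(h)` with the conformal Killing field `X` leaves
its trace. -/
lemma div_linJField (hn : 3 ≤ n) (hs : ∀ i j, h i j = h j i) (x : Eu n) :
    ∑ j, pd j (linJField h j) x
      = ((n : ℝ) - 4) / (8 * ((n : ℝ) - 1)) * (euclLap (linScal h) : Eu n → ℝ) x := by
  have e : ∀ j, pd j (linJField h j) x
      = ∑ i, ((D j (linG h i j) : Eu n → ℝ) x * x i + (linG h i j : Eu n → ℝ) x * kron i j) := by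
    intro j
    have hd : ∀ i ∈ Finset.univ, DifferentiableAt ℝ
        (fun y : Eu n => (linG h i j : Eu n → ℝ) y * y i) x := fun i _ =>
      (differentiable_coe _ x).mul ((contDiff_coord i).differentiable (by simp) x)
    have := pd_sum Finset.univ hd j
    rw [show linJField h j = fun y => ∑ i, (linG h i j : Eu n → ℝ) y * y i from rfl, this]
    refine Finset.sum_congr rfl fun i _ => ?_
    rw [pd_mul (differentiable_coe _ x) ((contDiff_coord i).differentiable (by simp) x), pd_coord]
    rfl
  have e1 : ∑ j, ∑ i, (D j (linG h i j) : Eu n → ℝ) x * x i = 0 := by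
    rw [Finset.sum_comm]
    refine Finset.sum_eq_zero fun i _ => ?_
    rw [← Finset.sum_mul, ← Smooth.sum_apply, linG_div hn hs]
    simp
  have e2 : ∑ j, ∑ i, (linG h i j : Eu n → ℝ) x * kron i j
      = (∑ i, linG h i i : Smooth n).1 x := by
    simp [kron, Matrix.one_apply, Smooth.sum_apply]
  simp only [e, Finset.sum_add_distrib, e1, e2, linG_trace hn hs]
  simp

/-- The exact flux identity at the linear level. -/
lemma flux_linJField (hn : 3 ≤ n) (hs : ∀ i j, h i j = h j i) {r : ℝ} (hr : 0 < r) :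
    flux (linJField h) r = -(((n : ℝ) - 4) / (8 * ((n : ℝ) - 1)) * flux (energyField h) r) := by
  set c := ((n : ℝ) - 4) / (8 * ((n : ℝ) - 1)) with hc
  have h0 : flux (fun j x => linJField h j x + c * energyField h j x) r = 0 := by
    refine flux_eq_zero (by omega) (fun j => (contDiff_linJField j).add
      (contDiff_const.mul (contDiff_energyField j))) (fun x => ?_) hr
    have : ∀ j, pd j (fun x => linJField h j x + c * energyField h j x) x
        = pd j (linJField h j) x + c * pd j (energyField h j) x := fun j => by
      have hd := (contDiff_energyField (h := h) j).differentiable (by simp) x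
      rw [pd_add ((contDiff_linJField j).differentiable (by simp) x) (hd.const_mul c),
        pd_const_mul c hd]
    simp only [this, Finset.sum_add_distrib, ← Finset.mul_sum, div_linJField hn hs,
      div_energyField]
    ring
  have hcont : ∀ F : Fin n → Eu n → ℝ, (∀ j, ContDiff ℝ ∞ (F j)) →
      ContinuousOn (fun x => ∑ j, F j x * (x j / ‖x‖)) (exterior n 0) := fun F hF =>
    continuousOn_finsetSum _ fun j _ => (hF j).continuous.continuousOn.mul
      ((contDiff_coord j).continuous.continuousOn.div continuous_norm.continuousOn
        fun x (hx : 0 < ‖x‖) => hx.ne')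
  have h1 : flux (fun j x => linJField h j x + c * energyField h j x) r
      = flux (linJField h) r + c * flux (energyField h) r := by
    have h2 : ContinuousOn (fun x => c * ∑ j, energyField h j x * (x j / ‖x‖)) (exterior n 0) :=
      continuousOn_const.mul (hcont _ contDiff_energyField)
    simp only [flux]
    rw [← sphereIntegral_const_mul, ← sphereIntegral_add hr.le hr (hcont _ contDiff_linJField) h2]
    congr 1
    funext x
    rw [Finset.mul_sum, ← Finset.sum_add_distrib]
    exact Finset.sum_congr rfl fun j _ => by ring
  linarith

namespace MetricApprox

/-- The integrand of the energy is linear in `g`, so that the energy flux agrees exactly with the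
flux of `-∇ DR(h)`. -/
lemma energyFlux_eq (H : MetricApprox R τ g h) (hs : ∀ i j, h i j = h j i) {r : ℝ} (hr : R < r) :
    energyFlux g r = flux (energyField h) r := by
  have hr0 : 0 ≤ r := by linarith [H.one_le]
  refine sphereIntegral_congr hr0 fun x hx => Finset.sum_congr rfl fun j _ => ?_
  have hx' : x ∈ exterior n R := show R < ‖x‖ from hx.symm ▸ hr
  congr 1
  have e1 : ∀ i a b, EqOn (pd i fun y => g y a b) (pd i (h a b)) (exterior n R) := by
    intro i a b y hy
    have he : EqOn (fun y => g y a b) (fun y => (h a b : Eu n → ℝ) y + kron a b)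
        (exterior n R) := fun z hz => by
      have := H.eqOn a b hz
      simp only at this ⊢
      linarith
    rw [pd_congr (isOpen_exterior R) he i hy,
      pd_add (differentiable_coe _ y) (differentiableAt_const _), pd_const, add_zero]
  have e3 : ∀ c d i a b, pd c (pd d (pd i fun y => g y a b)) x
      = (D c (D d (D i (h a b))) : Eu n → ℝ) x := fun c d i a b =>
    pd_congr (isOpen_exterior R) (pd_congr (isOpen_exterior R) (e1 i a b) d) c hx'
  simp only [e3]
  have : energyField h j x = -(D j (linScal h) : Eu n → ℝ) x := rfl
  rw [this, linScal_eq hs]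
  simp only [map_sum, map_sub, Smooth.sum_apply, Submodule.coe_sub, Pi.sub_apply,
    ← Finset.sum_neg_distrib, neg_sub]
  refine Finset.sum_congr rfl fun i _ => Finset.sum_congr rfl fun a _ => ?_
  rw [hs a i, D_comm a i]

/-- The quadratic remainder of `G_J` has no flux at infinity. -/
lemma jEinsteinFlux_sub_tendsto (H : MetricApprox R τ g h) (hn : 0 < n)
    (hτ : (n : ℝ) < 2 * τ + 4) :
    Tendsto (fun r => jEinsteinFlux g r - flux (linJField h) r) atTop (𝓝 0) := by
  refine (tendsto_sphereIntegral_contraction_zero H.one_le hn hτ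
    fun i j => (H.jEinstein i j).err).congr' ?_
  filter_upwards [eventually_gt_atTop R] with r hr
  have hr0 : 0 < r := by linarith [H.one_le]
  have hq : ∀ j : Fin n, ContinuousOn (fun x : Eu n => x j / ‖x‖) (exterior n R) := fun j =>
    (contDiff_coord j).continuous.continuousOn.div continuous_norm.continuousOn
      fun x (hx : R < ‖x‖) => by linarith [H.one_le]
  have hcont : ∀ E : Fin n → Fin n → Eu n → ℝ, (∀ i j, ContinuousOn (E i j) (exterior n R)) →
      ContinuousOn (fun x => ∑ i, ∑ j, E i j x * x i * (x j / ‖x‖)) (exterior n R) := fun E hE =>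
    continuousOn_finsetSum _ fun i _ => continuousOn_finsetSum _ fun j _ =>
      ((hE i j).mul (contDiff_coord i).continuous.continuousOn).mul (hq j)
  have hadd := sphereIntegral_add hr0.le hr
    (hcont _ fun i j => (H.jEinstein i j).err.contDiffOn.continuousOn)
    (hcont (fun i j => linG h i j) fun i j => (contDiff_coe _).continuous.continuousOn)
  have e1 : jEinsteinFlux g r = sphereIntegral r fun x =>
      ∑ i, ∑ j, (AEGeom.jEinstein g i j x - (linG h i j : Eu n → ℝ) x) * x i * (x j / ‖x‖)
      + ∑ i, ∑ j, (linG h i j : Eu n → ℝ) x * x i * (x j / ‖x‖) := by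
    unfold jEinsteinFlux
    congr 1
    funext x
    simp only [← Finset.sum_add_distrib]
    exact Finset.sum_congr rfl fun i _ => Finset.sum_congr rfl fun j _ => by ring
  have e2 : flux (linJField h) r = sphereIntegral r fun x =>
      ∑ i, ∑ j, (linG h i j : Eu n → ℝ) x * x i * (x j / ‖x‖) := by
    unfold flux linJField
    congr 1
    funext x
    simp only [Finset.sum_mul]
    exact Finset.sum_comm
  rw [e1, hadd, e2]
  ring

/-- If `J = 0`, then `Q` is of quadratic order, because `tr J = Q` at the linear level. -/
lemma qcurv_decay_of_jTensor_eq_zero (H : MetricApprox R τ g h) (hn : 3 ≤ n)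
    (hs : ∀ i j, h i j = h j i) (hJ : ∀ x ∈ exterior n R, ∀ i j, AEGeom.jTensor g i j x = 0) :
    SymbolDecay R 0 (2 * τ + 4) (AEGeom.qcurv g) := by
  have h1 : SymbolDecay R 0 (2 * τ + 4) (linQ h : Eu n → ℝ) := by
    refine (SymbolDecay.sum Finset.univ fun i _ => (H.jTensor i i).err.neg).congr fun x hx => ?_
    simp only [hJ x hx, zero_sub, neg_neg]
    rw [← linJ_trace hn hs, Smooth.sum_apply]
  exact (h1.add H.qcurv.err).congr fun x _ => by ring

/-- If `J = 0`, then `G_J = -Q g / 4` is of quadratic order and has no flux at infinity. -/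
lemma jEinsteinFlux_tendsto_zero (H : MetricApprox R τ g h) (hn : 3 ≤ n)
    (hτ : (n : ℝ) < 2 * τ + 4) (hs : ∀ i j, h i j = h j i)
    (hJ : ∀ x ∈ exterior n R, ∀ i j, AEGeom.jTensor g i j x = 0) :
    Tendsto (jEinsteinFlux g) atTop (𝓝 0) := by
  refine tendsto_sphereIntegral_contraction_zero H.one_le (by omega) hτ fun i j => ?_
  have hQ := H.qcurv_decay_of_jTensor_eq_zero hn hs hJ
  have hg : SymbolDecay R 0 0 (fun x => g x i j) :=
    (((H.metric_decay i j).of_le (by norm_num)).mono H.one_le H.pos.le |>.add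
      (SymbolDecay.const R 0 (kron i j))).congr fun x _ => by ring
  have := (hQ.mul hg).const_mul (-(1 / 4))
  rw [add_zero] at this
  refine this.congr fun x hx => ?_
  simp only [AEGeom.jEinstein, hJ x hx]
  ring

/-- In dimension four the integrand of the energy is `O(r^{-τ-3})`, against the area `O(r³)`. -/
lemma energyFlux_tendsto_zero_of_eq_four (H : MetricApprox R τ g h) (hn : n = 4)
    (hs : ∀ i j, h i j = h j i) : Tendsto (energyFlux g) atTop (𝓝 0) := by
  have hV : ∀ j, SymbolDecay R 0 (τ + 3) (energyField h j) := fun j => by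
    have := (H.scal.lin.pd j).neg.of_le (Nat.zero_le 1)
    rw [show τ + 2 + 1 = τ + 3 by ring] at this
    exact this
  refine (tendsto_flux_zero H.one_le (by omega) (a := τ + 3) ?_ hV).congr' ?_
  · rw [hn]
    push_cast
    linarith [H.pos]
  · filter_upwards [eventually_gt_atTop R] with r hr using (H.energyFlux_eq hs hr).symm

/-- The energy identity for a metric given in coordinates on an exterior domain. -/
theorem energy_identity (H : MetricApprox R τ g h) (hn : 3 ≤ n) (hτ : (n : ℝ) < 2 * τ + 4)
    (hs : ∀ i j, h i j = h j i) (hQ : IntegrableOn (AEGeom.qcurv g) (exterior n R)) :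
    ∃ energy limitG : ℝ, Tendsto (energyFlux g) atTop (𝓝 energy) ∧
      Tendsto (jEinsteinFlux g) atTop (𝓝 limitG) ∧
      ((n : ℝ) - 4) / (8 * ((n : ℝ) - 1)) * energy = -limitG ∧
      ((∀ x ∈ exterior n R, ∀ i j, AEGeom.jTensor g i j x = 0) → energy = 0) := by
  have h3 : (3 : ℝ) ≤ n := by exact_mod_cast hn
  have h1 : (n : ℝ) - 1 ≠ 0 := by linarith
  have hR0 : 0 ≤ R := zero_le_one.trans H.one_le
  have hdiv : IntegrableOn (fun x => ∑ j, pd j (energyField h j) x) (exterior n R) := by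
    have hlin : IntegrableOn (linQ h : Eu n → ℝ) (exterior n R) :=
      (hQ.sub (H.qcurv.err.integrableOn H.one_le hτ)).congr_fun (fun x _ => by simp)
        (isOpen_exterior R).measurableSet
    refine IntegrableOn.congr_fun (hlin.const_mul (2 * ((n : ℝ) - 1))) (fun x _ => ?_)
      (isOpen_exterior R).measurableSet
    simp only [div_energyField, linQ, Submodule.coe_smul, Pi.smul_apply, smul_eq_mul]
    field_simp
  obtain ⟨energy, hE⟩ := exists_tendsto_flux (by omega) (contDiff_energyField (h := h)) hR0 hdiv
  set c := ((n : ℝ) - 4) / (8 * ((n : ℝ) - 1)) with hc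
  have hE' : Tendsto (energyFlux g) atTop (𝓝 energy) := hE.congr' (by
    filter_upwards [eventually_gt_atTop R] with r hr using (H.energyFlux_eq hs hr).symm)
  have hG : Tendsto (jEinsteinFlux g) atTop (𝓝 (-(c * energy))) := by
    have h2 : Tendsto (flux (linJField h)) atTop (𝓝 (-(c * energy))) :=
      (hE.const_mul c).neg.congr' (by
        filter_upwards [eventually_gt_atTop 0] with r hr using (flux_linJField hn hs hr).symm)
    simpa using (H.jEinsteinFlux_sub_tendsto (by omega) hτ).add h2
  refine ⟨energy, -(c * energy), hE', hG, by ring, fun hJ => ?_⟩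
  by_cases h4 : n = 4
  · exact tendsto_nhds_unique hE' (H.energyFlux_tendsto_zero_of_eq_four h4 hs)
  · have h0 := tendsto_nhds_unique hG (H.jEinsteinFlux_tendsto_zero hn hτ hs hJ)
    have h4' : (n : ℝ) - 4 ≠ 0 := sub_ne_zero.mpr (by exact_mod_cast h4)
    have hc0 : c ≠ 0 := div_ne_zero h4' (mul_ne_zero (by norm_num) h1)
    exact (mul_eq_zero.mp (neg_eq_zero.mp h0)).resolve_left hc0

end MetricApprox

end Fluxes

/-! ### Morrey's inequality and the decay of weighted Sobolev functions -/

section Morrey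

variable {n : ℕ} {W : Type*} [NormedAddCommGroup W] [NormedSpace ℝ W]

/-- The fundamental theorem of calculus on the segment from `x` to `y`, in a form without
integrability conditions. -/
lemma enorm_le_add_lintegral_segment {v : Eu n → W} {x y : Eu n} {ρ : ℝ}
    (hv : ContDiffOn ℝ 1 v (Metric.ball x ρ)) (hy : y ∈ Metric.ball x ρ) :
    ‖v x‖ₑ ≤ ‖v y‖ₑ
      + ∫⁻ t in Icc (0 : ℝ) 1, ENNReal.ofReal ρ * ‖fderiv ℝ v (x + t • (y - x))‖ₑ := by
  have hρ : ‖y - x‖ < ρ := by simpa [dist_eq_norm] using hy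
  have hρ0 : 0 < ρ := (norm_nonneg _).trans_lt hρ
  have hmem : ∀ t ∈ Icc (0 : ℝ) 1, x + t • (y - x) ∈ Metric.ball x ρ := by
    intro t ht
    rw [Metric.mem_ball, dist_eq_norm, add_sub_cancel_left, norm_smul, Real.norm_eq_abs,
      abs_of_nonneg ht.1]
    exact (mul_le_of_le_one_left (norm_nonneg _) ht.2).trans_lt hρ
  have hγ : ContDiffOn ℝ 1 (fun t : ℝ => v (x + t • (y - x))) (Icc 0 1) :=
    hv.comp (ContDiff.contDiffOn (by fun_prop)) hmem
  have h1 := enorm_sub_le_lintegral_deriv_of_contDiffOn_Icc hγ zero_le_one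
  simp only [one_smul, zero_smul, add_zero, add_sub_cancel] at h1
  have h2 : ∫⁻ t in Icc (0 : ℝ) 1, ‖deriv (fun t : ℝ => v (x + t • (y - x))) t‖ₑ
      ≤ ∫⁻ t in Icc (0 : ℝ) 1, ENNReal.ofReal ρ * ‖fderiv ℝ v (x + t • (y - x))‖ₑ := by
    refine setLIntegral_mono' measurableSet_Icc fun t ht => ?_
    have hd : HasDerivAt (fun t : ℝ => x + t • (y - x)) (y - x) t := by
      simpa using ((hasDerivAt_id t).smul_const (y - x)).const_add x
    have hv' : DifferentiableAt ℝ v (x + t • (y - x)) :=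
      (hv.contDiffAt (Metric.isOpen_ball.mem_nhds (hmem t ht))).differentiableAt one_ne_zero
    have hc : HasDerivAt (fun t : ℝ => v (x + t • (y - x)))
        (fderiv ℝ v (x + t • (y - x)) (y - x)) t := hv'.hasFDerivAt.comp_hasDerivAt t hd
    rw [hc.deriv, mul_comm]
    refine (ContinuousLinearMap.le_opENorm _ _).trans (mul_le_mul_right ?_ _)
    rw [← ofReal_norm]
    exact ENNReal.ofReal_le_ofReal hρ.le
  have h3 : ‖v x‖ₑ ≤ ‖v y‖ₑ + ‖v y - v x‖ₑ := by
    calc ‖v x‖ₑ = ‖v y - (v y - v x)‖ₑ := by rw [sub_sub_cancel]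
      _ ≤ _ := enorm_sub_le
  exact h3.trans (add_le_add le_rfl (h1.trans h2))

/-- The homothety of ratio `t` centred at `x` maps `B(x, ρ)` onto `B(x, tρ)`. -/
lemma lintegral_ball_homothety {G : Eu n → ℝ≥0∞} (hG : Measurable G) (x : Eu n) (ρ : ℝ) {t : ℝ}
    (ht : 0 < t) : ∫⁻ y in Metric.ball x ρ, G (x + t • (y - x))
      = ENNReal.ofReal ((t ^ n)⁻¹) * ∫⁻ z in Metric.ball x (t * ρ), G z := by
  set H : Eu n → ℝ≥0∞ := (Metric.ball x (t * ρ)).indicator G with hH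
  have hHm : Measurable H := hG.indicator measurableSet_ball
  have h1 : ∫⁻ y in Metric.ball x ρ, G (x + t • (y - x)) = ∫⁻ y, H (t • y + (x - t • x)) := by
    rw [← lintegral_indicator measurableSet_ball]
    refine lintegral_congr fun y => ?_
    have e : t • y + (x - t • x) = x + t • (y - x) := by
      rw [smul_sub]
      abel
    rw [e]
    have hiff : x + t • (y - x) ∈ Metric.ball x (t * ρ) ↔ y ∈ Metric.ball x ρ := by
      simp only [Metric.mem_ball, dist_eq_norm, add_sub_cancel_left, norm_smul, Real.norm_eq_abs,
        abs_of_pos ht, mul_lt_mul_iff_right₀ ht]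
    by_cases hy : y ∈ Metric.ball x ρ
    · rw [indicator_of_mem hy, hH, indicator_of_mem (hiff.mpr hy)]
    · rw [indicator_of_notMem hy, hH, indicator_of_notMem (mt hiff.mp hy)]
  have h2 : ∫⁻ y, H (t • y + (x - t • x))
      = ENNReal.ofReal ((t ^ n)⁻¹) * ∫⁻ z, H (z + (x - t • x)) := by
    have := Measure.map_addHaar_smul (volume : Measure (Eu n)) ht.ne'
    rw [finrank_euclideanSpace_fin, abs_of_pos (by positivity)] at this
    have h3 : ∫⁻ z, H (z + (x - t • x)) ∂(Measure.map (t • ·) (volume : Measure (Eu n)))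
        = ∫⁻ y, H (t • y + (x - t • x)) :=
      lintegral_map (hHm.comp (measurable_add_const _)) (measurable_const_smul t)
    rw [← h3, this, lintegral_smul_measure, smul_eq_mul]
  rw [h1, h2, lintegral_add_right_eq_self H, hH, lintegral_indicator measurableSet_ball]

lemma lintegral_enorm_le_eLpNorm {W : Type*} [NormedAddCommGroup W] {p : ℝ≥0∞} (hp : 1 ≤ p)
    {f : Eu n → W} {s t : Set (Eu n)} (hst : s ⊆ t)
    (hf : AEStronglyMeasurable f (volume.restrict s)) :
    ∫⁻ y in s, ‖f y‖ₑ ≤ eLpNorm f p (volume.restrict t) * volume s ^ (1 - 1 / p.toReal) := by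
  have h1 := eLpNorm_le_eLpNorm_mul_rpow_measure_univ hp hf
  rw [eLpNorm_one_eq_lintegral_enorm, Measure.restrict_apply_univ] at h1
  simp only [ENNReal.toReal_one, div_one] at h1
  exact h1.trans (mul_le_mul_left (eLpNorm_mono_measure _ (Measure.restrict_mono hst le_rfl)) _)

/-- Morrey's inequality: for `p > n`, the value of a `C¹` function at the centre of a ball of
radius `ρ` is bounded by `ρ^{-n/p} (‖v‖_p + ρ ‖∇v‖_p)`.  It comes from averaging
`|v(x) - v(y)| ≤ ρ ∫₀¹ |∇v(x + t(y - x))| dt` over `y`: by scaling and Hölder, the slice at `t`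
contributes at most a multiple of `t^{-n/p}`, which is integrable. -/
theorem morrey (hn : 0 < n) {p : ℝ≥0∞} (hp : (n : ℝ≥0∞) < p) (hp' : p ≠ ⊤)
    (W : Type*) [NormedAddCommGroup W] [NormedSpace ℝ W] [CompleteSpace W] :
    ∃ K : ℝ, 0 ≤ K ∧ ∀ (v : Eu n → W) (x : Eu n) (ρ A₀ A₁ : ℝ), 0 < ρ → 0 ≤ A₀ → 0 ≤ A₁ →
      ContDiffOn ℝ 1 v (Metric.ball x ρ) →
      eLpNorm v p (volume.restrict (Metric.ball x ρ)) ≤ ENNReal.ofReal A₀ →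
      eLpNorm (fderiv ℝ v) p (volume.restrict (Metric.ball x ρ)) ≤ ENNReal.ofReal A₁ →
      ‖v x‖ ≤ K * ρ ^ (-((n : ℝ) / p.toReal)) * (A₀ + ρ * A₁) := by
  have hn1 : (1 : ℝ≥0∞) ≤ n := by exact_mod_cast hn
  have hp1 : 1 ≤ p := hn1.trans hp.le
  have hpr : (n : ℝ) < p.toReal := by
    have := (ENNReal.toReal_lt_toReal (ENNReal.natCast_ne_top n) hp').mpr hp
    simpa using this
  set q := p.toReal with hq
  have hn0 : (0 : ℝ) < n := by exact_mod_cast hn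
  have hq0 : 0 < q := hn0.trans hpr
  set θ : ℝ := (n : ℝ) / q with hθ
  have hθ0 : 0 ≤ θ := by positivity
  have hθ1 : θ < 1 := (div_lt_one hq0).mpr hpr
  set K₀ : ℝ≥0∞ := ∫⁻ t in Icc (0 : ℝ) 1, ENNReal.ofReal (t ^ (-θ)) with hK₀
  have hK₀top : K₀ ≠ ⊤ := by
    have h1 : IntegrableOn (fun t : ℝ => t ^ (-θ)) (Icc 0 1) := by
      rw [integrableOn_Icc_iff_integrableOn_Ioc, ← intervalIntegrable_iff_integrableOn_Ioc_of_le
        zero_le_one]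
      exact intervalIntegral.intervalIntegrable_rpow' (by linarith)
    exact (Integrable.lintegral_lt_top h1).ne
  set V₁ : ℝ≥0∞ := volume (Metric.ball (0 : Eu n) 1) with hV₁
  have hV₁0 : V₁ ≠ 0 := (Metric.measure_ball_pos volume (0 : Eu n) one_pos).ne'
  have hV₁top : V₁ ≠ ⊤ := measure_ball_lt_top.ne
  refine ⟨(V₁.toReal ^ (1 / q))⁻¹ * (1 + K₀.toReal), by positivity, ?_⟩
  intro v x ρ A₀ A₁ hρ hA₀ hA₁ hv h₀ h₁
  set B := Metric.ball x ρ with hB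
  have hVt : ∀ s, 0 < s → volume (Metric.ball x (s * ρ)) = ENNReal.ofReal (s ^ n) * volume B := by
    intro s hs
    rw [Measure.addHaar_ball_mul_of_pos _ _ hs, finrank_euclideanSpace_fin, hB,
      Measure.addHaar_ball_center _ x]
  set V := volume B with hV
  have hVeq : V = ENNReal.ofReal (ρ ^ n) * V₁ := by
    rw [hV, hB, Measure.addHaar_ball_of_pos _ _ hρ, finrank_euclideanSpace_fin]
  have hV0 : V ≠ 0 := (Metric.measure_ball_pos volume x hρ).ne'
  have hVtop : V ≠ ⊤ := measure_ball_lt_top.ne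
  have hDm : Measurable (fderiv ℝ v) := measurable_fderiv ℝ v
  have hDe : Measurable fun y => ‖fderiv ℝ v y‖ₑ := hDm.enorm
  have hcont : ContinuousOn (fderiv ℝ v) B :=
    hv.continuousOn_fderiv_of_isOpen Metric.isOpen_ball le_rfl
  -- the contribution of the slice at `t`
  have hslice : ∀ t ∈ Ioc (0 : ℝ) 1, ∫⁻ y in B, ‖fderiv ℝ v (x + t • (y - x))‖ₑ
      ≤ ENNReal.ofReal A₁ * V ^ (1 - 1 / q) * ENNReal.ofReal (t ^ (-θ)) := by
    intro t ht
    have ht0 := ht.1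
    have hsub : Metric.ball x (t * ρ) ⊆ B :=
      Metric.ball_subset_ball (mul_le_of_le_one_left hρ.le ht.2)
    have hH := lintegral_enorm_le_eLpNorm hp1 hsub
      ((hcont.mono hsub).aestronglyMeasurable measurableSet_ball)
    rw [lintegral_ball_homothety hDe x ρ ht0]
    have hpw : volume (Metric.ball x (t * ρ)) ^ (1 - 1 / q)
        = ENNReal.ofReal (t ^ ((n : ℝ) - θ)) * V ^ (1 - 1 / q) := by
      have h1q : 0 ≤ 1 - 1 / q := by
        have : 1 / q ≤ 1 := by
          rw [div_le_one hq0]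
          have : (1 : ℝ) ≤ n := by exact_mod_cast hn
          linarith
        linarith
      rw [hVt t ht0, ENNReal.mul_rpow_of_nonneg _ _ h1q,
        ENNReal.ofReal_rpow_of_pos (by positivity), ← Real.rpow_natCast, ← Real.rpow_mul ht0.le]
      congr 3
      rw [hθ]
      ring
    calc ENNReal.ofReal ((t ^ n)⁻¹) * ∫⁻ z in Metric.ball x (t * ρ), ‖fderiv ℝ v z‖ₑ
        ≤ ENNReal.ofReal ((t ^ n)⁻¹) * (ENNReal.ofReal A₁
            * (ENNReal.ofReal (t ^ ((n : ℝ) - θ)) * V ^ (1 - 1 / q))) := by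
          rw [← hpw]
          exact mul_le_mul_right (hH.trans (mul_le_mul_left h₁ _)) _
      _ = ENNReal.ofReal A₁ * V ^ (1 - 1 / q)
            * (ENNReal.ofReal ((t ^ n)⁻¹) * ENNReal.ofReal (t ^ ((n : ℝ) - θ))) := by ring
      _ = _ := by
          rw [← ENNReal.ofReal_mul (by positivity), ← Real.rpow_natCast, ← Real.rpow_neg ht0.le,
            ← Real.rpow_add ht0]
          congr 3
          ring
  -- average over the ball
  have hmain : V * ‖v x‖ₑ ≤ ENNReal.ofReal A₀ * V ^ (1 - 1 / q)
      + ENNReal.ofReal ρ * (ENNReal.ofReal A₁ * V ^ (1 - 1 / q) * K₀) := by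
    have hjoint : Measurable fun z : Eu n × ℝ =>
        ENNReal.ofReal ρ * ‖fderiv ℝ v (x + z.2 • (z.1 - x))‖ₑ :=
      (hDe.comp (by fun_prop : Measurable fun z : Eu n × ℝ => x + z.2 • (z.1 - x))).const_mul _
    calc V * ‖v x‖ₑ = ∫⁻ _ in B, ‖v x‖ₑ := by rw [setLIntegral_const, mul_comm]
      _ ≤ ∫⁻ y in B, (‖v y‖ₑ
          + ∫⁻ t in Icc (0 : ℝ) 1, ENNReal.ofReal ρ * ‖fderiv ℝ v (x + t • (y - x))‖ₑ) :=
          setLIntegral_mono' measurableSet_ball fun y hy =>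
            enorm_le_add_lintegral_segment hv hy
      _ = (∫⁻ y in B, ‖v y‖ₑ) + ∫⁻ y in B,
          ∫⁻ t in Icc (0 : ℝ) 1, ENNReal.ofReal ρ * ‖fderiv ℝ v (x + t • (y - x))‖ₑ :=
          lintegral_add_right _ hjoint.lintegral_prod_right'
      _ ≤ _ := add_le_add ?_ ?_
    · exact (lintegral_enorm_le_eLpNorm hp1 subset_rfl
        (hv.continuousOn.aestronglyMeasurable measurableSet_ball)).trans (mul_le_mul_left h₀ _)
    · rw [lintegral_lintegral_swap hjoint.aemeasurable, hK₀,
        ← lintegral_const_mul' _ _ (ENNReal.mul_ne_top ENNReal.ofReal_ne_top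
          (ENNReal.rpow_ne_top_of_ne_zero hV0 hVtop)),
        ← lintegral_const_mul' _ _ ENNReal.ofReal_ne_top]
      refine lintegral_mono_ae ?_
      have hne : ∀ᵐ t : ℝ ∂volume.restrict (Icc (0 : ℝ) 1), t ≠ 0 :=
        ae_restrict_of_ae (Measure.ae_ne volume (0 : ℝ))
      filter_upwards [ae_restrict_mem measurableSet_Icc, hne] with t ht ht0
      rw [lintegral_const_mul' _ _ ENNReal.ofReal_ne_top]
      exact mul_le_mul_right (hslice t ⟨lt_of_le_of_ne ht.1 (Ne.symm ht0), ht.2⟩) _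
  -- in real numbers
  have hVr : V.toReal = ρ ^ n * V₁.toReal := by
    rw [hVeq, ENNReal.toReal_mul, ENNReal.toReal_ofReal (by positivity)]
  have hV₁r : 0 < V₁.toReal := ENNReal.toReal_pos hV₁0 hV₁top
  have hVr0 : 0 < V.toReal := ENNReal.toReal_pos hV0 hVtop
  have hreal : V.toReal * ‖v x‖ ≤ A₀ * V.toReal ^ (1 - 1 / q)
      + ρ * (A₁ * V.toReal ^ (1 - 1 / q) * K₀.toReal) := by
    have hfin : ENNReal.ofReal A₀ * V ^ (1 - 1 / q)
      + ENNReal.ofReal ρ * (ENNReal.ofReal A₁ * V ^ (1 - 1 / q) * K₀) ≠ ⊤ := by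
      have := ENNReal.rpow_ne_top_of_ne_zero (y := 1 - 1 / q) hV0 hVtop
      finiteness
    have h2 := ENNReal.toReal_mono hfin hmain
    rw [ENNReal.toReal_add (by
        have := ENNReal.rpow_ne_top_of_ne_zero (y := 1 - 1 / q) hV0 hVtop
        finiteness) (by
        have := ENNReal.rpow_ne_top_of_ne_zero (y := 1 - 1 / q) hV0 hVtop
        finiteness)] at h2
    simpa only [ENNReal.toReal_mul, ENNReal.toReal_ofReal hA₀, ENNReal.toReal_ofReal hA₁,
      ENNReal.toReal_ofReal hρ.le, ← ENNReal.toReal_rpow, toReal_enorm] using h2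
  have hsplit : V.toReal ^ (1 - 1 / q) = V.toReal * (V.toReal ^ (1 / q))⁻¹ := by
    rw [Real.rpow_sub hVr0, Real.rpow_one, div_eq_mul_inv]
  have hroot : (V.toReal ^ (1 / q))⁻¹ = ρ ^ (-θ) * (V₁.toReal ^ (1 / q))⁻¹ := by
    rw [hVr, Real.mul_rpow (by positivity) hV₁r.le, mul_inv, ← Real.rpow_natCast,
      ← Real.rpow_mul hρ.le, ← Real.rpow_neg hρ.le]
    congr 3
    rw [hθ]
    ring
  rw [hsplit] at hreal
  have h4 : ‖v x‖ ≤ (V.toReal ^ (1 / q))⁻¹ * (A₀ + ρ * A₁ * K₀.toReal) := by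
    refine le_of_mul_le_mul_left (hreal.trans (le_of_eq ?_)) hVr0
    ring
  rw [hroot] at h4
  refine h4.trans ?_
  have hKn : 0 ≤ K₀.toReal := ENNReal.toReal_nonneg
  have : A₀ + ρ * A₁ * K₀.toReal ≤ (1 + K₀.toReal) * (A₀ + ρ * A₁) := by
    nlinarith [mul_nonneg hKn hA₀, mul_nonneg hρ.le hA₁]
  calc _ ≤ ρ ^ (-θ) * (V₁.toReal ^ (1 / q))⁻¹ * ((1 + K₀.toReal) * (A₀ + ρ * A₁)) :=
        mul_le_mul_of_nonneg_left this (by positivity)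
    _ = _ := by ring

end Morrey

section WeightedDecay

variable {n : ℕ}

/-- An almost everywhere bound for a continuous function on an open set holds everywhere. -/
lemma le_of_ae_le_of_continuousOn {U : Set (Eu n)} (hU : IsOpen U) {f : Eu n → ℝ} {C : ℝ}
    (hf : ContinuousOn f U) (h : ∀ᵐ x ∂volume.restrict U, f x ≤ C) : ∀ x ∈ U, f x ≤ C := by
  have h1 : (fun x => max (f x) C) =ᵐ[volume.restrict U] fun _ => C :=
    h.mono fun x hx => max_eq_right hx
  have h2 := Measure.eqOn_open_of_ae_eq h1 hU (ContinuousOn.sup hf continuousOn_const)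
    continuousOn_const
  exact fun x hx => (le_max_left _ _).trans (h2 hx).le

lemma contDiffOn_iteratedFDeriv {U : Set (Eu n)} (hU : IsOpen U) {u : Eu n → ℝ}
    (hu : ContDiffOn ℝ ∞ u U) (j : ℕ) : ContDiffOn ℝ ∞ (iteratedFDeriv ℝ j u) U := by
  intro x hx
  exact ((hu.contDiffAt (hU.mem_nhds hx)).iteratedFDeriv_right
    (m := ∞) (i := j) (by exact_mod_cast le_top)).contDiffWithinAt

lemma norm_le_sqrt_one_add (x : Eu n) : ‖x‖ ≤ Real.sqrt (1 + ‖x‖ ^ 2) :=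
  Real.le_sqrt_of_sq_le (by linarith)

lemma sqrt_one_add_le {x : Eu n} (hx : 1 ≤ ‖x‖) : Real.sqrt (1 + ‖x‖ ^ 2) ≤ 2 * ‖x‖ := by
  rw [Real.sqrt_le_left (by linarith)]
  nlinarith

lemma WeightedSobolev.pointwise_top {k : ℕ} {τ R : ℝ} (hτ : 0 < τ) (hR : 0 < R) {u : Eu n → ℝ}
    (hu : WeightedSobolev k ⊤ (-τ) (exterior n R) u) {j : ℕ} (hj : j ≤ k) :
    ∃ C, ∀ x ∈ exterior n R, ‖iteratedFDeriv ℝ j u x‖ ≤ C * ‖x‖ ^ (-(τ + j)) := by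
  have hm := hu.2 j hj
  simp only [ENNReal.toReal_top, div_zero, sub_zero, neg_sub, sub_neg_eq_add] at hm
  set f : Eu n → ℝ := fun x => ‖iteratedFDeriv ℝ j u x‖ * Real.sqrt (1 + ‖x‖ ^ 2) ^ ((j : ℝ) + τ)
    with hf
  set C := (eLpNorm f ⊤ (volume.restrict (exterior n R))).toReal with hC
  have hae : ∀ᵐ x ∂volume.restrict (exterior n R), f x ≤ C := by
    have h1 : eLpNormEssSup f (volume.restrict (exterior n R)) ≠ ⊤ := by
      have := hm.2.ne
      rwa [eLpNorm_exponent_top] at this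
    filter_upwards [ae_le_eLpNormEssSup (f := f) (μ := volume.restrict (exterior n R))] with x hx
    have h2 := ENNReal.toReal_mono h1 hx
    rw [toReal_enorm, ← eLpNorm_exponent_top] at h2
    exact (le_abs_self _).trans h2
  have hcont : ContinuousOn f (exterior n R) := by
    refine (contDiffOn_iteratedFDeriv (isOpen_exterior R) hu.1 j).continuousOn.norm.mul ?_
    refine ContinuousOn.rpow_const (by fun_prop) fun x _ => Or.inr (by positivity)
  refine ⟨C, fun x hx => ?_⟩
  have h1 := le_of_ae_le_of_continuousOn (isOpen_exterior R) hcont hae x hx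
  have hx0 : 0 < ‖x‖ := hR.trans hx
  rw [Real.rpow_neg hx0.le, ← div_eq_mul_inv, le_div_iff₀ (by positivity), add_comm τ]
  refine le_trans (mul_le_mul_of_nonneg_left ?_ (norm_nonneg _)) h1
  exact Real.rpow_le_rpow hx0.le (norm_le_sqrt_one_add x) (by positivity)

/-- Powers of comparable quantities are comparable, whatever the sign of the exponent. -/
lemma rpow_le_of_ratio_mem {a b : ℝ} (ha : 0 < a) (hb : 0 < b) (h1 : a ≤ 3 * b) (h2 : b ≤ 3 * a)
    (w : ℝ) : a ^ w ≤ 3 ^ |w| * b ^ w := by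
  have hq : 0 < a / b := div_pos ha hb
  have hab : a ^ w = (a / b) ^ w * b ^ w := by
    rw [← Real.mul_rpow hq.le hb.le, div_mul_cancel₀ _ hb.ne']
  rw [hab]
  refine mul_le_mul_of_nonneg_right ?_ (by positivity)
  rcases le_total 0 w with hw | hw
  · rw [abs_of_nonneg hw]
    exact Real.rpow_le_rpow hq.le ((div_le_iff₀ hb).mpr h1) hw
  · rw [abs_of_nonpos hw, ← inv_inv (a / b), Real.inv_rpow (by positivity), ← Real.rpow_neg
      (by positivity)]
    refine Real.rpow_le_rpow (by positivity) ?_ (by linarith)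
    rw [inv_div]
    exact (div_le_iff₀ ha).mpr h2

/-- On the ball `B(x, |x|/2)` the weight of the Sobolev norm is comparable to a power of `|x|`. -/
lemma eLpNorm_le_of_weight {V : Type*} [NormedAddCommGroup V] {v : Eu n → V} {f : Eu n → ℝ}
    {p : ℝ≥0∞} {w R : ℝ} (hR : 1 ≤ R)
    (hv : ∀ y, f y = ‖v y‖ * Real.sqrt (1 + ‖y‖ ^ 2) ^ w)
    (hf : MemLp f p (volume.restrict (exterior n R))) {x : Eu n} (hx : 2 * R < ‖x‖) :
    eLpNorm v p (volume.restrict (Metric.ball x (‖x‖ / 2))) ≤ ENNReal.ofReal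
      (3 ^ |(-w)| * ‖x‖ ^ (-w) * (eLpNorm f p (volume.restrict (exterior n R))).toReal) := by
  have hsub : Metric.ball x (‖x‖ / 2) ⊆ exterior n R := by
    intro y hy
    have h1 : ‖y - x‖ < ‖x‖ / 2 := by simpa [dist_eq_norm] using hy
    have h2 : ‖x‖ ≤ ‖y‖ + ‖y - x‖ := by
      calc ‖x‖ = ‖y - (y - x)‖ := by rw [sub_sub_cancel]
        _ ≤ _ := norm_sub_le _ _
    show R < ‖y‖
    linarith
  have hx0 : 0 < ‖x‖ := by linarith
  rw [ENNReal.ofReal_mul (by positivity), ENNReal.ofReal_toReal hf.2.ne]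
  refine (eLpNorm_le_mul_eLpNorm_of_ae_le_mul (c := 3 ^ |(-w)| * ‖x‖ ^ (-w)) (g := f) ?_ p).trans
    (mul_le_mul_right (eLpNorm_mono_measure _ (Measure.restrict_mono hsub le_rfl)) _)
  refine (ae_restrict_iff' measurableSet_ball).mpr (Eventually.of_forall fun y hy => ?_)
  have h1 : ‖y - x‖ < ‖x‖ / 2 := by simpa [dist_eq_norm] using hy
  have h2 : ‖x‖ ≤ ‖y‖ + ‖y - x‖ := by
    calc ‖x‖ = ‖y - (y - x)‖ := by rw [sub_sub_cancel]
      _ ≤ _ := norm_sub_le _ _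
  have h3 : ‖y‖ ≤ ‖x‖ + ‖y - x‖ := by
    calc ‖y‖ = ‖x + (y - x)‖ := by rw [add_sub_cancel]
      _ ≤ _ := norm_add_le _ _
  have hy1 : 1 ≤ ‖y‖ := by linarith
  set s := Real.sqrt (1 + ‖y‖ ^ 2) with hs
  have hs1 : ‖y‖ ≤ s := norm_le_sqrt_one_add y
  have hs2 : s ≤ 2 * ‖y‖ := sqrt_one_add_le hy1
  have hs0 : 0 < s := by linarith
  have h4 := rpow_le_of_ratio_mem hs0 hx0 (by linarith) (by linarith) (-w)
  have hfn : ‖f y‖ = ‖v y‖ * s ^ w := by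
    rw [hv y, Real.norm_of_nonneg (by positivity)]
  rw [hfn]
  calc ‖v y‖ = s ^ (-w) * (‖v y‖ * s ^ w) := by
        rw [Real.rpow_neg hs0.le]
        have : s ^ w ≠ 0 := (Real.rpow_pos_of_pos hs0 w).ne'
        field_simp
    _ ≤ _ := mul_le_mul_of_nonneg_right h4 (by positivity)

/-- For `n < p < ∞` the decay follows from Morrey's inequality on the balls `B(x, |x|/2)`, at the
cost of one derivative. -/
lemma WeightedSobolev.pointwise_of_lt_top (hn : 0 < n) {k : ℕ} {p : ℝ≥0∞} (hp : (n : ℝ≥0∞) < p)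
    (hp' : p ≠ ⊤) {τ R : ℝ} (hR : 1 ≤ R) {u : Eu n → ℝ}
    (hu : WeightedSobolev k p (-τ) (exterior n R) u) {j : ℕ} (hj : j < k) :
    ∃ C, ∀ x ∈ exterior n (2 * R), ‖iteratedFDeriv ℝ j u x‖ ≤ C * ‖x‖ ^ (-(τ + j)) := by
  obtain ⟨K, hK0, hK⟩ := morrey hn hp hp' (ContinuousMultilinearMap ℝ (fun _ : Fin j => Eu n) ℝ)
  have hm₀ := hu.2 j hj.le
  have hm₁ := hu.2 (j + 1) hj
  set θ := (n : ℝ) / p.toReal with hθ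
  set w : ℝ := -(-τ - (j : ℝ)) - θ with hw
  have hw1 : -(-τ - ((j + 1 : ℕ) : ℝ)) - θ = w + 1 := by rw [hw]; push_cast; ring
  rw [hw1] at hm₁
  set N₀ := (eLpNorm (fun x => ‖iteratedFDeriv ℝ j u x‖ * Real.sqrt (1 + ‖x‖ ^ 2) ^ w) p
    (volume.restrict (exterior n R))).toReal with hN₀
  set N₁ := (eLpNorm (fun x => ‖iteratedFDeriv ℝ (j + 1) u x‖ * Real.sqrt (1 + ‖x‖ ^ 2) ^ (w + 1))
    p (volume.restrict (exterior n R))).toReal with hN₁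
  have hN₀n : 0 ≤ N₀ := ENNReal.toReal_nonneg
  have hN₁n : 0 ≤ N₁ := ENNReal.toReal_nonneg
  refine ⟨K * 2 ^ θ * (3 ^ |(-w)| * N₀ + 1 / 2 * (3 ^ |(-(w + 1))| * N₁)), fun x hx => ?_⟩
  have hx' : 2 * R < ‖x‖ := hx
  have hx0 : 0 < ‖x‖ := by linarith
  have hsub : Metric.ball x (‖x‖ / 2) ⊆ exterior n R := by
    intro y hy
    have h1 : ‖y - x‖ < ‖x‖ / 2 := by simpa [dist_eq_norm] using hy
    have h2 : ‖x‖ ≤ ‖y‖ + ‖y - x‖ := by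
      calc ‖x‖ = ‖y - (y - x)‖ := by rw [sub_sub_cancel]
        _ ≤ _ := norm_sub_le _ _
    show R < ‖y‖
    linarith
  have h₁ := eLpNorm_le_of_weight (v := fderiv ℝ (iteratedFDeriv ℝ j u)) hR
    (fun y => by rw [norm_fderiv_iteratedFDeriv]) hm₁ hx'
  have key := hK (iteratedFDeriv ℝ j u) x (‖x‖ / 2) _ _ (by positivity) (by positivity)
    (by positivity)
    (((contDiffOn_iteratedFDeriv (isOpen_exterior R) hu.1 j).mono hsub).of_le
      (by exact_mod_cast le_top))
    (eLpNorm_le_of_weight hR (fun y => rfl) hm₀ hx') h₁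
  refine key.trans (le_of_eq ?_)
  have e1 : (‖x‖ / 2) ^ (-θ) = 2 ^ θ * ‖x‖ ^ (-θ) := by
    rw [Real.div_rpow hx0.le (by norm_num), Real.rpow_neg (by norm_num : (0 : ℝ) ≤ 2),
      div_inv_eq_mul, mul_comm]
  have e2 : ‖x‖ ^ (-(w + 1)) * ‖x‖ = ‖x‖ ^ (-w) := by
    rw [neg_add, Real.rpow_add hx0, Real.rpow_neg_one, mul_assoc, inv_mul_cancel₀ hx0.ne', mul_one]
  have e3 : ‖x‖ ^ (-θ) * ‖x‖ ^ (-w) = ‖x‖ ^ (-(τ + (j : ℝ))) := by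
    rw [← Real.rpow_add hx0, hw]
    congr 1
    ring
  rw [e1, ← e3, ← e2]
  ring

lemma symbolDecay_of_iteratedFDeriv {k : ℕ} {a R : ℝ} {u : Eu n → ℝ}
    (hu : ContDiffOn ℝ ∞ u (exterior n R))
    (hb : ∀ j ≤ k, ∃ C, ∀ x ∈ exterior n R, ‖iteratedFDeriv ℝ j u x‖ ≤ C * ‖x‖ ^ (-(a + j))) :
    SymbolDecay R k a u := by
  have h0 : ∀ {u : Eu n → ℝ} {a : ℝ},
      (∃ C, ∀ x ∈ exterior n R, ‖iteratedFDeriv ℝ 0 u x‖ ≤ C * ‖x‖ ^ (-(a + (0 : ℕ)))) →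
      ∃ C, ∀ x ∈ exterior n R, |u x| ≤ C * ‖x‖ ^ (-a) := fun ⟨C, hC⟩ => ⟨C, fun x hx => by
    simpa using hC x hx⟩
  induction k generalizing a u with
  | zero => exact ⟨hu, h0 (hb 0 le_rfl)⟩
  | succ k ih =>
    refine ⟨⟨hu, h0 (hb 0 (Nat.zero_le _))⟩, fun i => ih (contDiffOn_pd (isOpen_exterior R) hu i)
      fun j hj => ?_⟩
    obtain ⟨C, hC⟩ := hb (j + 1) (by omega)
    set L : (Eu n →L[ℝ] ℝ) →L[ℝ] ℝ :=
      ContinuousLinearMap.apply ℝ ℝ (EuclideanSpace.single i (1 : ℝ)) with hL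
    refine ⟨‖L‖ * C, fun x hx => ?_⟩
    have hd : ContDiffAt ℝ ∞ (fderiv ℝ u) x :=
      (hu.fderiv_of_isOpen (isOpen_exterior R) (by simp)).contDiffAt
        ((isOpen_exterior R).mem_nhds hx)
    have h1 := L.norm_iteratedFDeriv_comp_left hd (n := j) (by exact_mod_cast le_top)
    rw [norm_iteratedFDeriv_fderiv] at h1
    have h2 := hC x hx
    push_cast at h2
    calc ‖iteratedFDeriv ℝ j (pd i u) x‖ ≤ ‖L‖ * ‖iteratedFDeriv ℝ (j + 1) u x‖ := h1
      _ ≤ ‖L‖ * (C * ‖x‖ ^ (-(a + 1 + j))) := by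
          rw [show a + 1 + (j : ℝ) = a + (j + 1) by ring]
          exact mul_le_mul_of_nonneg_left h2 (norm_nonneg L)
      _ = _ := by ring

lemma WeightedSobolev.mono {k : ℕ} {p : ℝ≥0∞} {δ : ℝ} {Ω Ω' : Set (Eu n)} {u : Eu n → ℝ}
    (hu : WeightedSobolev k p δ Ω u) (h : Ω' ⊆ Ω) : WeightedSobolev k p δ Ω' u :=
  ⟨hu.1.mono h, fun j hj => (hu.2 j hj).mono_measure (Measure.restrict_mono h le_rfl)⟩

/-- The Sobolev embedding in the form in which it is used: functions in `W^{k,p}_{-τ}` decay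
pointwise with four derivatives. -/
theorem WeightedSobolev.symbolDecay (hn : 0 < n) {k : ℕ} {p : ℝ≥0∞}
    (hkp : (5 ≤ k ∧ (n : ℝ≥0∞) < p) ∨ (4 ≤ k ∧ p = ⊤)) {τ R : ℝ} (hτ : 0 < τ) (hR : 1 ≤ R)
    {u : Eu n → ℝ} (hu : WeightedSobolev k p (-τ) (exterior n R) u) :
    SymbolDecay (2 * R) 4 τ u := by
  have hsub : exterior n (2 * R) ⊆ exterior n R := fun x hx =>
    lt_of_le_of_lt (by linarith) (show 2 * R < ‖x‖ from hx)
  refine symbolDecay_of_iteratedFDeriv (hu.1.mono hsub) fun j hj => ?_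
  by_cases hp : p = ⊤
  · subst hp
    obtain ⟨C, hC⟩ := hu.pointwise_top hτ (by linarith) (j := j) (by omega)
    exact ⟨C, fun x hx => hC x (hsub hx)⟩
  · have := hkp.resolve_right fun h => hp h.2
    exact hu.pointwise_of_lt_top hn this.2 hp hR (by omega)

end WeightedDecay

/-! ### The inverse metric and the extension of the perturbation to `ℝⁿ` -/

section MetricApproxConstruction

variable {n : ℕ} {R τ : ℝ}

/-- A smooth function on `{|x| > R}`, multiplied by a cutoff function. -/
lemma exists_smooth_cutoff (hR : 0 ≤ R) : ∃ χ : Eu n → ℝ,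
    (∀ x ∈ exterior n (R + 2), χ x = 1) ∧
    ∀ u : Eu n → ℝ, ContDiffOn ℝ ∞ u (exterior n R) → ContDiff ℝ ∞ fun x => χ x * u x := by
  set χ : Eu n → ℝ := fun x => Real.smoothTransition (‖x‖ ^ 2 - (R + 1) ^ 2) with hχ
  have hχs : ContDiff ℝ ∞ χ :=
    Real.smoothTransition.contDiff.comp ((contDiff_norm_sq ℝ).sub contDiff_const)
  refine ⟨χ, fun x hx => ?_, fun u hu => contDiff_iff_contDiffAt.mpr fun x => ?_⟩
  · refine Real.smoothTransition.one_of_one_le ?_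
    have : R + 2 < ‖x‖ := hx
    nlinarith
  · by_cases hx : R < ‖x‖
    · exact hχs.contDiffAt.mul (hu.contDiffAt ((isOpen_exterior R).mem_nhds hx))
    · have : (fun x => χ x * u x) =ᶠ[𝓝 x] fun _ => 0 := by
        have hlt : ‖x‖ < R + 1 := by linarith [not_lt.mp hx]
        filter_upwards [continuous_norm.continuousAt.eventually_lt continuousAt_const hlt] with y hy
        have : χ y = 0 := Real.smoothTransition.zero_of_nonpos (by
          have := norm_nonneg y
          nlinarith)
        rw [this, zero_mul]
      exact contDiffAt_const.congr_of_eventuallyEq this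

lemma contDiffOn_det {U : Set (Eu n)} {A : Eu n → Matrix (Fin n) (Fin n) ℝ}
    (hA : ∀ i j, ContDiffOn ℝ ∞ (fun x => A x i j) U) :
    ContDiffOn ℝ ∞ (fun x => (A x).det) U := by
  simp only [Matrix.det_apply]
  refine ContDiffOn.sum fun σ _ => ContDiffOn.const_smul _ ?_
  exact contDiffOn_prod fun i _ => hA _ _

lemma contDiffOn_ginv {U : Set (Eu n)} {g : Eu n → Matrix (Fin n) (Fin n) ℝ}
    (hg : ∀ i j, ContDiffOn ℝ ∞ (fun x => g x i j) U) (hdet : ∀ x ∈ U, (g x).det ≠ 0)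
    (i j : Fin n) : ContDiffOn ℝ ∞ (ginv g i j) U := by
  have h1 : ContDiffOn ℝ ∞ (fun x => (g x).adjugate i j) U := by
    simp only [Matrix.adjugate_apply]
    refine contDiffOn_det fun a b => ?_
    by_cases h : a = j
    · subst h
      simpa using contDiffOn_const
    · simpa [Matrix.updateRow_ne h] using hg a b
  have h2 : ginv g i j = fun x => (g x).det⁻¹ * (g x).adjugate i j := by
    funext x
    simp [ginv, Matrix.inv_def, Ring.inverse_eq_inv']
  rw [h2]
  exact ((contDiffOn_det hg).inv hdet).mul h1

lemma sum_ginv_mul {g : Eu n → Matrix (Fin n) (Fin n) ℝ} {x : Eu n} (hdet : (g x).det ≠ 0)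
    (i j : Fin n) : ∑ k, ginv g i k x * g x k j = kron i j := by
  have := congrFun (congrFun (Matrix.nonsing_inv_mul (g x) (isUnit_iff_ne_zero.mpr hdet)) i) j
  rw [Matrix.mul_apply] at this
  exact this

lemma sum_mul_ginv {g : Eu n → Matrix (Fin n) (Fin n) ℝ} {x : Eu n} (hdet : (g x).det ≠ 0)
    (i j : Fin n) : ∑ k, g x i k * ginv g k j x = kron i j := by
  have := congrFun (congrFun (Matrix.mul_nonsing_inv (g x) (isUnit_iff_ne_zero.mpr hdet)) i) j
  rw [Matrix.mul_apply] at this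
  exact this

/-- `∂_a g^{ij} = -g^{ik} (∂_a g_{kl}) g^{lj}`. -/
lemma pd_ginv {U : Set (Eu n)} (hU : IsOpen U) {g : Eu n → Matrix (Fin n) (Fin n) ℝ}
    (hg : ∀ i j, ContDiffOn ℝ ∞ (fun x => g x i j) U) (hdet : ∀ x ∈ U, (g x).det ≠ 0)
    (a i j : Fin n) {x : Eu n} (hx : x ∈ U) : pd a (ginv g i j) x
      = ∑ k, ∑ l, -(ginv g i k x * pd a (fun y => g y k l) x * ginv g l j x) := by
  have hgd : ∀ i j, DifferentiableAt ℝ (fun x => g x i j) x := fun i j =>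
    differentiableAt_of_contDiffOn hU (hg i j) hx
  have hid : ∀ i j, DifferentiableAt ℝ (ginv g i j) x := fun i j =>
    differentiableAt_of_contDiffOn hU (contDiffOn_ginv hg hdet i j) hx
  have h1 : ∀ k, ∑ l, (pd a (fun y => g y k l) x * ginv g l j x + g x k l * pd a (ginv g l j) x)
      = 0 := by
    intro k
    have h2 : EqOn (fun y => ∑ l, g y k l * ginv g l j y) (fun _ => kron k j) U := fun y hy =>
      sum_mul_ginv (hdet y hy) k j
    have h3 := pd_congr hU h2 a hx
    have h4 := pd_sum (f := fun l y => g y k l * ginv g l j y) Finset.univ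
      (fun l _ => (hgd k l).mul (hid l j)) a
    rw [pd_const] at h3
    rw [← h3, h4]
    exact Finset.sum_congr rfl fun l _ => (pd_mul (hgd k l) (hid l j) a).symm
  have h4 : pd a (ginv g i j) x = ∑ l, kron i l * pd a (ginv g l j) x := by
    simp [kron, Matrix.one_apply]
  have h5 : ∑ l, kron i l * pd a (ginv g l j) x
      = ∑ k, ginv g i k x * ∑ l, g x k l * pd a (ginv g l j) x := by
    simp only [← sum_ginv_mul (hdet x hx) i, Finset.sum_mul, Finset.mul_sum]
    rw [Finset.sum_comm]
    exact Finset.sum_congr rfl fun k _ => Finset.sum_congr rfl fun l _ => by ring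
  rw [h4, h5]
  refine Finset.sum_congr rfl fun k _ => ?_
  have h6 := h1 k
  rw [Finset.sum_add_distrib] at h6
  rw [eq_neg_of_add_eq_zero_right h6, mul_neg, Finset.mul_sum, Finset.sum_neg_distrib]
  congr 1
  exact Finset.sum_congr rfl fun l _ => by ring

/-- A metric asymptotic to `δ` is uniformly invertible near infinity. -/
lemma exists_radius_ginv_bounded {g : Eu n → Matrix (Fin n) (Fin n) ℝ} (hτ : 0 < τ)
    (hg : ∀ i j, SymbolDecay R 4 τ (fun x => g x i j - kron i j)) :
    ∃ R', ∀ x ∈ exterior n R', 1 / 4 < (g x).det ∧ ∀ i j, |ginv g i j x| ≤ 2 := by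
  set l : Filter (Eu n) := comap (fun x => ‖x‖) atTop with hl
  have hentry : ∀ i j, Tendsto (fun x => g x i j) l (𝓝 (kron i j)) := by
    intro i j
    obtain ⟨C, hC⟩ := (hg i j).bound
    have h1 : Tendsto (fun x : Eu n => C * ‖x‖ ^ (-τ)) l (𝓝 0) := by
      simpa using ((tendsto_rpow_neg_atTop hτ).comp tendsto_comap).const_mul C
    have h2 : Tendsto (fun x => g x i j - kron i j) l (𝓝 0) := by
      refine squeeze_zero_norm' ?_ h1
      filter_upwards [tendsto_comap.eventually (eventually_gt_atTop R)] with x hx using hC x hx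
    simpa using h2.add_const (kron i j)
  have hmat : Tendsto g l (𝓝 1) :=
    tendsto_pi_nhds.mpr fun i => tendsto_pi_nhds.mpr fun j => hentry i j
  have hdet : Tendsto (fun x => (g x).det) l (𝓝 1) := by
    have hc : Continuous fun A : Matrix (Fin n) (Fin n) ℝ => A.det := continuous_id.matrix_det
    have := (hc.tendsto 1).comp hmat
    rwa [Matrix.det_one] at this
  have hadj : ∀ i j, Tendsto (fun x => (g x).adjugate i j) l (𝓝 (kron i j)) := by
    intro i j
    have hc : Continuous fun A : Matrix (Fin n) (Fin n) ℝ => A.adjugate i j :=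
      continuous_id.matrix_adjugate.matrix_elem i j
    have := (hc.tendsto 1).comp hmat
    rwa [Matrix.adjugate_one] at this
  have hginv : ∀ i j, Tendsto (fun x => ginv g i j x) l (𝓝 (kron i j)) := by
    intro i j
    have h2 : (fun x => ginv g i j x) = fun x => (g x).det⁻¹ * (g x).adjugate i j := by
      funext x
      simp [ginv, Matrix.inv_def, Ring.inverse_eq_inv']
    rw [h2]
    simpa using (hdet.inv₀ one_ne_zero).mul (hadj i j)
  have hev : ∀ᶠ x in l, 1 / 4 < (g x).det ∧ ∀ i j, |ginv g i j x| ≤ 2 := by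
    refine (hdet.eventually_const_lt (by norm_num)).and
      (eventually_all.mpr fun i => eventually_all.mpr fun j => ?_)
    have hk : |kron i j| < 2 := by
      simp only [kron, Matrix.one_apply]
      split_ifs <;> norm_num
    exact ((hginv i j).abs.eventually_lt_const hk).mono fun x hx => hx.le
  obtain ⟨s, hs, hsub⟩ := mem_comap.mp hev
  obtain ⟨R', hR'⟩ := mem_atTop_sets.mp hs
  exact ⟨R', fun x hx => hsub (hR' ‖x‖ (le_of_lt hx))⟩

/-- A metric whose components decay to `δ` with four derivatives satisfies `MetricApprox` outside a
large ball, with a perturbation that is cut off near the origin.  The volume density is bounded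
below there. -/
theorem exists_metricApprox {g : Eu n → Matrix (Fin n) (Fin n) ℝ} (hR : 0 ≤ R) (hτ : 0 < τ)
    (hg : ∀ i j, SymbolDecay R 4 τ (fun x => g x i j - kron i j))
    (hs : ∀ x i j, g x i j = g x j i) :
    ∃ (R' : ℝ) (h : Fin n → Fin n → Smooth n), R ≤ R' ∧ (∀ x ∈ exterior n R', 1 / 4 < (g x).det) ∧
      MetricApprox R' τ g h ∧ ∀ i j, h i j = h j i := by
  obtain ⟨R₁, hR₁⟩ := exists_radius_ginv_bounded hτ hg
  obtain ⟨χ, hχ1, hχ⟩ := exists_smooth_cutoff (n := n) hR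
  set R' := max (R + 2) (max R₁ 1) with hR'
  have hRR' : R ≤ R' := le_trans (by linarith) (le_max_left _ _)
  have hR1 : 1 ≤ R' := (le_max_right _ _).trans (le_max_right _ _)
  have hb : ∀ x ∈ exterior n R', 1 / 4 < (g x).det ∧ ∀ i j, |ginv g i j x| ≤ 2 := fun x hx =>
    hR₁ x (((le_max_left _ _).trans (le_max_right _ _)).trans_lt (show R' < ‖x‖ from hx))
  set h : Fin n → Fin n → Smooth n := fun i j =>
    ⟨fun x => χ x * (g x i j - kron i j), hχ _ (hg i j).contDiffOn⟩ with hh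
  have hgd : ∀ i j, SymbolDecay R' 4 τ (fun x => g x i j - kron i j) := fun i j =>
    (hg i j).mono_radius hRR'
  have heq : ∀ i j, EqOn (fun x => g x i j - kron i j) (h i j : Eu n → ℝ) (exterior n R') := by
    intro i j x hx
    have : χ x = 1 := hχ1 x ((le_max_left _ _).trans_lt (show R' < ‖x‖ from hx))
    simp [hh, this]
  have hgs : ∀ i j, ContDiffOn ℝ ∞ (fun x => g x i j) (exterior n R') := fun i j =>
    ((hgd i j).contDiffOn.add (contDiffOn_const (c := kron i j))).congr fun x _ => by simp
  have hdet : ∀ x ∈ exterior n R', (g x).det ≠ 0 := fun x hx =>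
    ((by norm_num : (0 : ℝ) < 1 / 4).trans (hb x hx).1).ne'
  -- The formula for `∂ g⁻¹` bootstraps the bound on `g⁻¹` to four derivatives.
  have hginv : ∀ k ≤ 4, ∀ i j, SymbolDecay R' k 0 (ginv g i j) := by
    intro k
    induction k with
    | zero =>
      exact fun _ i j => ⟨contDiffOn_ginv hgs hdet i j, 2, fun x hx => by
        simpa using (hb x hx).2 i j⟩
    | succ k ih =>
      intro hk i j
      have ih' := ih (by omega)
      refine ⟨(ih' i j).zero_order, fun a => ?_⟩
      refine (SymbolDecay.sum Finset.univ fun c _ => SymbolDecay.sum Finset.univ fun d _ =>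
        SymbolDecay.neg ?_).congr fun x hx => pd_ginv (isOpen_exterior R') hgs hdet a i j hx
      have h1 : SymbolDecay R' k 1 (pd a fun y => g y c d) := by
        have h2 := ((hgd c d).of_le hk).pd a
        refine (h2.mono hR1 (b := 1) (by linarith)).congr fun x hx => ?_
        rw [pd_sub (differentiableAt_of_contDiffOn (isOpen_exterior R') (hgs c d) hx)
          (differentiableAt_const _), pd_const, sub_zero]
      have := ((ih' i c).mul h1).mul (ih' d j)
      simpa using this
  refine ⟨R', h, hRR', fun x hx => (hb x hx).1, ⟨hR1, hτ, heq, fun i j => (hgd i j).congr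
    fun x hx => (heq i j hx).symm, fun i j => ?_⟩, fun i j => Subtype.ext (funext fun x => ?_)⟩
  · refine (SymbolDecay.sum Finset.univ fun k _ => (((hginv 4 le_rfl i k).mul
      (hgd k j)).neg)).congr (fun x hx => ?_) |> fun H => by simpa using H
    have h1 := sum_ginv_mul (hdet x hx) i j
    have h2 : ∑ k, ginv g i k x * kron k j = ginv g i j x := by simp [kron, Matrix.one_apply]
    simp only [mul_sub, Finset.sum_neg_distrib, Finset.sum_sub_distrib, h1, h2]
    ring
  · have : kron i j = kron j i := by simp [kron, Matrix.one_apply, eq_comm]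
    simp only [hh, hs x i j, this]

end MetricApproxConstruction

/-! ### Invariance of the `Q`-curvature under changes of coordinates -/

section Invariance

variable {n : ℕ}

/-- The derivative of a function in terms of its partial derivatives. -/
lemma fderiv_apply_eq_sum (f : Eu n → ℝ) (x v : Eu n) :
    fderiv ℝ f x v = ∑ i, pd i f x * v i := by
  have hv : v = ∑ i, v i • EuclideanSpace.single i (1 : ℝ) := by
    ext j
    simp [Finset.sum_apply, Pi.single_apply]
  conv_lhs => rw [hv]
  simp [pd, mul_comm]

/-- The Jacobian matrix `(∂_a φ^i)_{ia}`. -/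
def jacobian (φ : Eu n → Eu n) (y : Eu n) : Matrix (Fin n) (Fin n) ℝ :=
  Matrix.of fun i a => pd a (fun z => φ z i) y

lemma contDiffOn_component {O : Set (Eu n)} {φ : Eu n → Eu n} (hφ : ContDiffOn ℝ ∞ φ O)
    (i : Fin n) : ContDiffOn ℝ ∞ (fun z => φ z i) O :=
  (EuclideanSpace.proj (𝕜 := ℝ) i).contDiff.comp_contDiffOn hφ

lemma pd_component {φ : Eu n → Eu n} {y : Eu n} (hφ : DifferentiableAt ℝ φ y) (i a : Fin n) :
    pd a (fun z => φ z i) y = fderiv ℝ φ y (EuclideanSpace.single a 1) i := by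
  have h : HasFDerivAt (fun z => φ z i)
      ((EuclideanSpace.proj (𝕜 := ℝ) i).comp (fderiv ℝ φ y)) y :=
    (EuclideanSpace.proj (𝕜 := ℝ) i).hasFDerivAt.comp y hφ.hasFDerivAt
  rw [pd, h.fderiv]
  rfl

/-- The chain rule. -/
lemma pd_comp {f : Eu n → ℝ} {φ : Eu n → Eu n} {y : Eu n} (hf : DifferentiableAt ℝ f (φ y))
    (hφ : DifferentiableAt ℝ φ y) (a : Fin n) :
    pd a (fun z => f (φ z)) y = ∑ i, pd i f (φ y) * jacobian φ y i a := by
  have h : HasFDerivAt (fun z => f (φ z)) ((fderiv ℝ f (φ y)).comp (fderiv ℝ φ y)) y :=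
    hf.hasFDerivAt.comp y hφ.hasFDerivAt
  rw [pd, h.fderiv, ContinuousLinearMap.comp_apply, fderiv_apply_eq_sum]
  exact Finset.sum_congr rfl fun i _ => by rw [jacobian, Matrix.of_apply, pd_component hφ]

section Smoothness

variable {U : Set (Eu n)} {g : Eu n → Matrix (Fin n) (Fin n) ℝ}

lemma contDiffOn_christoffel (hU : IsOpen U) (hg : ∀ i j, ContDiffOn ℝ ∞ (fun x => g x i j) U)
    (hdet : ∀ x ∈ U, (g x).det ≠ 0) (k i j : Fin n) : ContDiffOn ℝ ∞ (christoffel g k i j) U :=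
  contDiffOn_const.mul (ContDiffOn.sum fun l _ => (contDiffOn_ginv hg hdet k l).mul
    (((contDiffOn_pd hU (hg j l) i).add (contDiffOn_pd hU (hg i l) j)).sub
      (contDiffOn_pd hU (hg i j) l)))

lemma contDiffOn_scal (hU : IsOpen U) (hg : ∀ i j, ContDiffOn ℝ ∞ (fun x => g x i j) U)
    (hdet : ∀ x ∈ U, (g x).det ≠ 0) : ContDiffOn ℝ ∞ (scal g) U := by
  have hΓ := contDiffOn_christoffel hU hg hdet
  have hriem : ∀ k i j, ContDiffOn ℝ ∞ (riem g k i k j) U := fun k i j =>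
    ((contDiffOn_pd hU (hΓ k j i) k).sub (contDiffOn_pd hU (hΓ k k i) j)).add
    (ContDiffOn.sum fun m _ => ((hΓ k k m).mul (hΓ m j i)).sub ((hΓ k j m).mul (hΓ m k i)))
  have hric : ∀ i j, ContDiffOn ℝ ∞ (ric g i j) U := fun i j =>
    ContDiffOn.sum fun k _ => hriem k i j
  have h : ContDiffOn ℝ ∞ (fun x => ∑ i, ∑ j, ginv g i j x * ric g i j x) U :=
    ContDiffOn.sum fun i _ => ContDiffOn.sum fun j _ =>
      (contDiffOn_ginv hg hdet i j).mul (hric i j)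
  exact h

end Smoothness

/-- `g'` is the pullback `φ^* g` on the open set `O` of the metric `g` on `U`, by a local
diffeomorphism `φ : O → U`. -/
structure IsPullback (O U : Set (Eu n)) (φ : Eu n → Eu n)
    (g g' : Eu n → Matrix (Fin n) (Fin n) ℝ) : Prop where
  isOpen_source : IsOpen O
  isOpen_target : IsOpen U
  smooth : ContDiffOn ℝ ∞ φ O
  mapsTo : MapsTo φ O U
  smooth_metric : ∀ i j, ContDiffOn ℝ ∞ (fun x => g x i j) U
  symm : ∀ x i j, g x i j = g x j i
  det_ne_zero : ∀ x ∈ U, (g x).det ≠ 0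
  jacobian_ne_zero : ∀ y ∈ O, (jacobian φ y).det ≠ 0
  pullback : ∀ y ∈ O, ∀ a b,
    g' y a b = ∑ i, ∑ j, jacobian φ y i a * jacobian φ y j b * g (φ y) i j

/-- The algebra behind the transformation law of the Christoffel symbols of the first kind: the
second derivatives `K` of the coordinate change enter only through one term. -/
lemma christoffel_first_kind_algebra (G : Fin n → Fin n → ℝ) (J : Fin n → Fin n → ℝ)
    (K dG : Fin n → Fin n → Fin n → ℝ) (hG : ∀ i j, G i j = G j i)
    (hK : ∀ i a b, K i a b = K i b a) (a b d : Fin n)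
    {A : Fin n → Fin n → Fin n → ℝ}
    (hA : ∀ a b d, A a b d = ∑ i, ∑ j, (K i a b * J j d * G i j + J i b * K j a d * G i j
      + J i b * J j d * ∑ m, dG m i j * J m a)) :
    A a b d + A b a d - A d a b = ∑ l, J l d * (2 * ∑ m, G l m * K m a b
      + ∑ i, ∑ j, (dG i j l + dG j i l - dG l i j) * (J i a * J j b)) := by
  set P : Fin n → Fin n → Fin n → ℝ := fun a b d => ∑ i, ∑ j, K i a b * J j d * G i j with hP
  set E : Fin n → Fin n → Fin n → ℝ := fun a b d =>
    ∑ i, ∑ j, J i b * J j d * ∑ m, dG m i j * J m a with hE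
  have hAE : ∀ a b d, A a b d = P a b d + P a d b + E a b d := by
    intro a b d
    have h2 : ∑ i, ∑ j, J i b * K j a d * G i j = P a d b := by
      rw [hP, Finset.sum_comm]
      exact Finset.sum_congr rfl fun i _ => Finset.sum_congr rfl fun j _ => by rw [hG j i]; ring
    simp only [hA, Finset.sum_add_distrib, h2, hP, hE]
  have hPs : ∀ a b d, P a b d = P b a d := fun a b d => by
    simp only [hP]
    exact Finset.sum_congr rfl fun i _ => Finset.sum_congr rfl fun j _ => by rw [hK i a b]
  have hR1 : ∑ l, J l d * ∑ m, G l m * K m a b = P a b d := by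
    simp only [hP, Finset.mul_sum]
    rw [Finset.sum_comm]
    exact Finset.sum_congr rfl fun i _ => Finset.sum_congr rfl fun j _ => by rw [hG j i]; ring
  have hR2 : ∑ l, J l d * ∑ i, ∑ j, dG i j l * (J i a * J j b) = E a b d := by
    simp only [hE, Finset.mul_sum]
    rw [Finset.sum_comm' (t' := Finset.univ) (s' := fun _ => Finset.univ) (by simp)]
    rw [Finset.sum_comm]
    rw [Finset.sum_comm]
    calc _ = ∑ i, ∑ l, ∑ j, J l d * (dG i j l * (J i a * J j b)) := rfl
      _ = ∑ i, ∑ j, ∑ l, J l d * (dG i j l * (J i a * J j b)) :=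
          Finset.sum_congr rfl fun i _ => Finset.sum_comm
      _ = ∑ j, ∑ i, ∑ l, J l d * (dG i j l * (J i a * J j b)) := Finset.sum_comm
      _ = ∑ j, ∑ l, ∑ i, J l d * (dG i j l * (J i a * J j b)) :=
          Finset.sum_congr rfl fun i _ => Finset.sum_comm
      _ = _ := Finset.sum_congr rfl fun j _ => Finset.sum_congr rfl fun l _ =>
          Finset.sum_congr rfl fun i _ => by ring
  have hR3 : ∑ l, J l d * ∑ i, ∑ j, dG j i l * (J i a * J j b) = E b a d := by
    simp only [hE, Finset.mul_sum]
    rw [Finset.sum_comm]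
    exact Finset.sum_congr rfl fun i _ => Finset.sum_congr rfl fun l _ =>
      Finset.sum_congr rfl fun j _ => by ring
  have hR4 : ∑ l, J l d * ∑ i, ∑ j, dG l i j * (J i a * J j b) = E d a b := by
    simp only [hE, Finset.mul_sum]
    rw [Finset.sum_comm]
    refine Finset.sum_congr rfl fun i _ => ?_
    rw [Finset.sum_comm]
    exact Finset.sum_congr rfl fun l _ => Finset.sum_congr rfl fun j _ => by ring
  have hRHS : ∑ l, J l d * (2 * ∑ m, G l m * K m a b
      + ∑ i, ∑ j, (dG i j l + dG j i l - dG l i j) * (J i a * J j b))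
      = 2 * P a b d + (E a b d + E b a d - E d a b) := by
    rw [← hR1, ← hR2, ← hR3, ← hR4, Finset.mul_sum, ← Finset.sum_add_distrib,
      ← Finset.sum_sub_distrib, ← Finset.sum_add_distrib]
    refine Finset.sum_congr rfl fun l _ => ?_
    simp only [sub_mul, add_mul, Finset.sum_sub_distrib, Finset.sum_add_distrib]
    ring
  rw [hRHS, hAE, hAE, hAE, hPs b a d, hPs d a b, hPs d b a]
  ring

namespace IsPullback

variable {O U : Set (Eu n)} {φ : Eu n → Eu n} {g g' : Eu n → Matrix (Fin n) (Fin n) ℝ}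

lemma contDiffOn_jacobian (H : IsPullback O U φ g g') (i a : Fin n) :
    ContDiffOn ℝ ∞ (fun y => jacobian φ y i a) O :=
  contDiffOn_pd H.isOpen_source (contDiffOn_component H.smooth i) a

lemma pd_jacobian_symm (H : IsPullback O U φ g g') {y : Eu n} (hy : y ∈ O) (i a b : Fin n) :
    pd a (fun z => jacobian φ z i b) y = pd b (fun z => jacobian φ z i a) y :=
  pd_comm H.isOpen_source (contDiffOn_component H.smooth i) hy a b

lemma contDiffOn_comp (H : IsPullback O U φ g g') {f : Eu n → ℝ} (hf : ContDiffOn ℝ ∞ f U) :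
    ContDiffOn ℝ ∞ (fun y => f (φ y)) O := hf.comp H.smooth H.mapsTo

lemma smooth_pullback (H : IsPullback O U φ g g') (a b : Fin n) :
    ContDiffOn ℝ ∞ (fun y => g' y a b) O := by
  refine ContDiffOn.congr ?_ fun y hy => H.pullback y hy a b
  exact ContDiffOn.sum fun i _ => ContDiffOn.sum fun j _ =>
    ((H.contDiffOn_jacobian i a).mul (H.contDiffOn_jacobian j b)).mul
      (H.contDiffOn_comp (H.smooth_metric i j))

lemma eq_mul (H : IsPullback O U φ g g') {y : Eu n} (hy : y ∈ O) :
    g' y = (jacobian φ y).transpose * g (φ y) * jacobian φ y := by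
  ext a b
  rw [H.pullback y hy, Matrix.mul_apply]
  simp only [Matrix.mul_apply, Matrix.transpose_apply, Finset.sum_mul]
  rw [Finset.sum_comm]
  exact Finset.sum_congr rfl fun j _ => Finset.sum_congr rfl fun i _ => by ring

lemma det_pullback_ne_zero (H : IsPullback O U φ g g') {y : Eu n} (hy : y ∈ O) :
    (g' y).det ≠ 0 := by
  rw [H.eq_mul hy, Matrix.det_mul, Matrix.det_mul, Matrix.det_transpose]
  exact mul_ne_zero (mul_ne_zero (H.jacobian_ne_zero y hy) (H.det_ne_zero _ (H.mapsTo hy)))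
    (H.jacobian_ne_zero y hy)

lemma jacobian_mul_inv (H : IsPullback O U φ g g') {y : Eu n} (hy : y ∈ O) :
    jacobian φ y * (jacobian φ y)⁻¹ = 1 :=
  Matrix.mul_nonsing_inv _ (isUnit_iff_ne_zero.mpr (H.jacobian_ne_zero y hy))

lemma jacobian_inv_mul (H : IsPullback O U φ g g') {y : Eu n} (hy : y ∈ O) :
    (jacobian φ y)⁻¹ * jacobian φ y = 1 :=
  Matrix.nonsing_inv_mul _ (isUnit_iff_ne_zero.mpr (H.jacobian_ne_zero y hy))

/-- `J g'⁻¹ Jᵀ = g⁻¹`. -/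
lemma jacobian_mul_inv_mul (H : IsPullback O U φ g g') {y : Eu n} (hy : y ∈ O) :
    jacobian φ y * (g' y)⁻¹ * (jacobian φ y).transpose = (g (φ y))⁻¹ := by
  set J := jacobian φ y with hJ
  have h1 : J * J⁻¹ = 1 := H.jacobian_mul_inv hy
  have h2 : J⁻¹.transpose * J.transpose = 1 := by
    rw [← Matrix.transpose_mul, h1, Matrix.transpose_one]
  rw [H.eq_mul hy, Matrix.mul_inv_rev, Matrix.mul_inv_rev, ← Matrix.transpose_nonsing_inv]
  calc J * (J⁻¹ * ((g (φ y))⁻¹ * J⁻¹.transpose)) * J.transpose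
      = (J * J⁻¹) * (g (φ y))⁻¹ * (J⁻¹.transpose * J.transpose) := by
        simp only [Matrix.mul_assoc]
    _ = _ := by rw [h1, h2, Matrix.one_mul, Matrix.mul_one]

lemma differentiableAt_jacobian (H : IsPullback O U φ g g') {y : Eu n} (hy : y ∈ O) (i a : Fin n) :
    DifferentiableAt ℝ (fun y => jacobian φ y i a) y :=
  differentiableAt_of_contDiffOn H.isOpen_source (H.contDiffOn_jacobian i a) hy

lemma differentiableAt_comp (H : IsPullback O U φ g g') {f : Eu n → ℝ} (hf : ContDiffOn ℝ ∞ f U)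
    {y : Eu n} (hy : y ∈ O) : DifferentiableAt ℝ (fun y => f (φ y)) y :=
  differentiableAt_of_contDiffOn H.isOpen_source (H.contDiffOn_comp hf) hy

lemma pd_comp (H : IsPullback O U φ g g') {f : Eu n → ℝ} (hf : ContDiffOn ℝ ∞ f U)
    {y : Eu n} (hy : y ∈ O) (a : Fin n) :
    pd a (fun z => f (φ z)) y = ∑ i, pd i f (φ y) * jacobian φ y i a :=
  AEGeom.pd_comp (differentiableAt_of_contDiffOn H.isOpen_target hf (H.mapsTo hy))
    (differentiableAt_of_contDiffOn H.isOpen_source H.smooth hy) a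

lemma pd_pullback (H : IsPullback O U φ g g') {y : Eu n} (hy : y ∈ O) (a b d : Fin n) :
    pd a (fun z => g' z b d) y = ∑ i, ∑ j,
      (pd a (fun z => jacobian φ z i b) y * jacobian φ y j d * g (φ y) i j
      + jacobian φ y i b * pd a (fun z => jacobian φ z j d) y * g (φ y) i j
      + jacobian φ y i b * jacobian φ y j d
        * ∑ m, pd m (fun x => g x i j) (φ y) * jacobian φ y m a) := by
  have e : EqOn (fun z => g' z b d)
      (fun z => ∑ i, ∑ j, jacobian φ z i b * jacobian φ z j d * g (φ z) i j) O :=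
    fun z hz => H.pullback z hz b d
  have hJ := H.differentiableAt_jacobian hy
  have hg := fun i j => H.differentiableAt_comp (H.smooth_metric i j) hy
  have hprod : ∀ i j, DifferentiableAt ℝ
      (fun z => jacobian φ z i b * jacobian φ z j d * g (φ z) i j) y := fun i j =>
    ((hJ i b).mul (hJ j d)).mul (hg i j)
  rw [pd_congr H.isOpen_source e a hy]
  have s1 := pd_sum (f := fun i z => ∑ j, jacobian φ z i b * jacobian φ z j d * g (φ z) i j)
    Finset.univ (fun i _ => DifferentiableAt.fun_sum fun j _ => hprod i j) a
  rw [s1]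
  refine Finset.sum_congr rfl fun i _ => ?_
  have s2 := pd_sum (f := fun j z => jacobian φ z i b * jacobian φ z j d * g (φ z) i j)
    Finset.univ (fun j _ => hprod i j) a
  rw [s2]
  refine Finset.sum_congr rfl fun j _ => ?_
  have s3 := pd_mul (f := fun z => jacobian φ z i b * jacobian φ z j d)
    (g := fun z => g (φ z) i j) ((hJ i b).mul (hJ j d)) (hg i j) a
  rw [s3, pd_mul (hJ i b) (hJ j d) a, H.pd_comp (H.smooth_metric i j) hy a]
  ring

/-- The transformation law of the Christoffel symbols. -/
lemma christoffel (H : IsPullback O U φ g g') {y : Eu n} (hy : y ∈ O) (k a b : Fin n) :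
    ∑ c, jacobian φ y k c * christoffel g' c a b y = pd a (fun z => jacobian φ z k b) y
      + ∑ i, ∑ j, christoffel g k i j (φ y) * (jacobian φ y i a * jacobian φ y j b) := by
  set J := jacobian φ y with hJ
  set dG : Fin n → Fin n → Fin n → ℝ := fun m i j => pd m (fun x => g x i j) (φ y) with hdG
  set K : Fin n → Fin n → Fin n → ℝ := fun i a b => pd a (fun z => jacobian φ z i b) y with hK
  have halg := fun d => christoffel_first_kind_algebra (fun i j => g (φ y) i j) J K dG
    (fun i j => H.symm _ i j) (fun i a b => H.pd_jacobian_symm hy i a b) a b d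
    (A := fun a b d => pd a (fun z => g' z b d) y) (fun a b d => H.pd_pullback hy a b d)
  -- the Christoffel symbols of the first kind of `g'` as a vector
  set Λ : Fin n → ℝ := fun d => pd a (fun z => g' z b d) y + pd b (fun z => g' z a d) y
    - pd d (fun z => g' z a b) y with hΛ
  set v : Fin n → ℝ := fun m => K m a b with hv
  set L : Fin n → ℝ := fun l => ∑ i, ∑ j, (dG i j l + dG j i l - dG l i j) * (J i a * J j b)
    with hL
  have hΛeq : Λ = J.transpose.mulVec ((2 : ℝ) • (g (φ y)).mulVec v + L) := by
    funext d
    rw [hΛ]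
    simp only
    rw [halg d]
    simp only [Matrix.mulVec, dotProduct, Matrix.transpose_apply, Pi.add_apply, Pi.smul_apply,
      smul_eq_mul, hv, hL]
  have hΓ : (fun c => AEGeom.christoffel g' c a b y) = (1 / 2 : ℝ) • ((g' y)⁻¹).mulVec Λ := rfl
  have hlhs : ∑ c, J k c * AEGeom.christoffel g' c a b y
      = (J.mulVec (fun c => AEGeom.christoffel g' c a b y)) k := rfl
  have hGG : (g (φ y))⁻¹ * g (φ y) = 1 :=
    Matrix.nonsing_inv_mul _ (isUnit_iff_ne_zero.mpr (H.det_ne_zero _ (H.mapsTo hy)))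
  have hmain : J.mulVec (fun c => AEGeom.christoffel g' c a b y)
      = v + (1 / 2 : ℝ) • ((g (φ y))⁻¹).mulVec L := by
    rw [hΓ, hΛeq, Matrix.mulVec_smul, Matrix.mulVec_mulVec, Matrix.mulVec_mulVec,
      H.jacobian_mul_inv_mul hy, Matrix.mulVec_add, Matrix.mulVec_smul, Matrix.mulVec_mulVec, hGG,
      Matrix.one_mulVec, smul_add, smul_smul]
    norm_num
  rw [hlhs, hmain]
  simp only [Pi.add_apply, Pi.smul_apply, smul_eq_mul, hv, hK]
  congr 1
  simp only [Matrix.mulVec, dotProduct, hL, AEGeom.christoffel, ginv, Finset.mul_sum,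
    Finset.sum_mul]
  rw [Finset.sum_comm]
  refine Finset.sum_congr rfl fun i _ => ?_
  rw [Finset.sum_comm]
  exact Finset.sum_congr rfl fun j _ => Finset.sum_congr rfl fun l _ => by
    simp only [hdG]
    ring

/-- The pullback connection `A_a = φ^* Γ`. -/
def pullbackConnection (φ : Eu n → Eu n) (g : Eu n → Matrix (Fin n) (Fin n) ℝ) (a : Fin n)
    (y : Eu n) : Matrix (Fin n) (Fin n) ℝ :=
  Matrix.of fun k i => ∑ m, jacobian φ y m a * AEGeom.christoffel g k m i (φ y)

/-- The curvature of the pullback connection is the pullback of the curvature. -/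
lemma curvature_pullbackConnection (H : IsPullback O U φ g g') {y : Eu n} (hy : y ∈ O)
    (k i a b : Fin n) :
    pd a (fun z => pullbackConnection φ g b z k i) y
      - pd b (fun z => pullbackConnection φ g a z k i) y
      + (pullbackConnection φ g a y * pullbackConnection φ g b y
        - pullbackConnection φ g b y * pullbackConnection φ g a y) k i
      = ∑ p, ∑ m, jacobian φ y p a * jacobian φ y m b * riem g k i p m (φ y) := by
  set J := jacobian φ y with hJ
  have hΓs := contDiffOn_christoffel H.isOpen_target H.smooth_metric H.det_ne_zero
  have hd : ∀ a b, pd a (fun z => pullbackConnection φ g b z k i) y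
      = ∑ m, (pd a (fun z => jacobian φ z m b) y * AEGeom.christoffel g k m i (φ y)
        + J m b * ∑ p, pd p (AEGeom.christoffel g k m i) (φ y) * J p a) := by
    intro a b
    have s1 := pd_sum (f := fun m z => jacobian φ z m b * AEGeom.christoffel g k m i (φ z))
      Finset.univ (fun m _ => (H.differentiableAt_jacobian hy m b).mul
        (H.differentiableAt_comp (hΓs k m i) hy)) a
    simp only [pullbackConnection, Matrix.of_apply]
    rw [s1]
    refine Finset.sum_congr rfl fun m _ => ?_
    have s2 := pd_mul (f := fun z => jacobian φ z m b)
      (g := fun z => AEGeom.christoffel g k m i (φ z)) (H.differentiableAt_jacobian hy m b)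
      (H.differentiableAt_comp (hΓs k m i) hy) a
    rw [s2, H.pd_comp (hΓs k m i) hy a]
  have hsym : ∑ m, pd a (fun z => jacobian φ z m b) y * AEGeom.christoffel g k m i (φ y)
      = ∑ m, pd b (fun z => jacobian φ z m a) y * AEGeom.christoffel g k m i (φ y) :=
    Finset.sum_congr rfl fun m _ => by rw [H.pd_jacobian_symm hy]
  have e1 : ∑ m, J m b * ∑ p, pd p (AEGeom.christoffel g k m i) (φ y) * J p a
      = ∑ p, ∑ m, J p a * J m b * pd p (AEGeom.christoffel g k m i) (φ y) := by
    simp only [Finset.mul_sum]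
    rw [Finset.sum_comm]
    exact Finset.sum_congr rfl fun p _ => Finset.sum_congr rfl fun m _ => by ring
  have e2 : ∑ m, J m a * ∑ p, pd p (AEGeom.christoffel g k m i) (φ y) * J p b
      = ∑ p, ∑ m, J p a * J m b * pd m (AEGeom.christoffel g k p i) (φ y) := by
    simp only [Finset.mul_sum]
    exact Finset.sum_congr rfl fun p _ => Finset.sum_congr rfl fun m _ => by ring
  have e3 : ∀ a b, (pullbackConnection φ g a y * pullbackConnection φ g b y) k i
      = ∑ p, ∑ m, J p a * J m b * ∑ q, AEGeom.christoffel g k p q (φ y)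
        * AEGeom.christoffel g q m i (φ y) := by
    intro a b
    simp only [pullbackConnection, Matrix.mul_apply, Matrix.of_apply, Finset.sum_mul_sum]
    rw [Finset.sum_comm]
    refine Finset.sum_congr rfl fun p _ => ?_
    rw [Finset.sum_comm]
    refine Finset.sum_congr rfl fun m _ => ?_
    rw [Finset.mul_sum]
    exact Finset.sum_congr rfl fun q _ => by ring
  have e4 : (pullbackConnection φ g b y * pullbackConnection φ g a y) k i
      = ∑ p, ∑ m, J p a * J m b * ∑ q, AEGeom.christoffel g k m q (φ y)
        * AEGeom.christoffel g q p i (φ y) := by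
    rw [e3, Finset.sum_comm]
    exact Finset.sum_congr rfl fun p _ => Finset.sum_congr rfl fun m _ => by ring
  rw [Matrix.sub_apply, e3, e4, hd, hd, Finset.sum_add_distrib, Finset.sum_add_distrib, hsym, e1,
    e2, add_sub_add_left_eq_sub, ← Finset.sum_sub_distrib, ← Finset.sum_sub_distrib,
    ← Finset.sum_add_distrib]
  refine Finset.sum_congr rfl fun p _ => ?_
  rw [← Finset.sum_sub_distrib, ← Finset.sum_sub_distrib, ← Finset.sum_add_distrib]
  refine Finset.sum_congr rfl fun m _ => ?_
  simp only [riem, Finset.sum_sub_distrib]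
  ring

/-- The transformation law of the curvature tensor.  In matrix notation the Christoffel symbols
of `g'` are the gauge transform `J Γ'_a = ∂_a J + A_a J` of the pullback connection `A`, so that
the curvatures are conjugate. -/
lemma riem (H : IsPullback O U φ g g') {y : Eu n} (hy : y ∈ O) (k d a b : Fin n) :
    ∑ c, jacobian φ y k c * riem g' c d a b y
      = ∑ i, (∑ p, ∑ m, jacobian φ y p a * jacobian φ y m b * AEGeom.riem g k i p m (φ y))
        * jacobian φ y i d := by
  have hΓs := contDiffOn_christoffel H.isOpen_target H.smooth_metric H.det_ne_zero
  have hΓ's := contDiffOn_christoffel H.isOpen_source H.smooth_pullback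
    fun y hy => H.det_pullback_ne_zero hy
  set J := jacobian φ y with hJ
  set Γ' : Fin n → Eu n → Matrix (Fin n) (Fin n) ℝ := fun a z =>
    Matrix.of fun c b => AEGeom.christoffel g' c a b z with hΓ'
  set A := pullbackConnection φ g with hA
  set dJ : Fin n → Matrix (Fin n) (Fin n) ℝ := fun a =>
    Matrix.of fun i b => pd a (fun z => jacobian φ z i b) y with hdJ
  set ddJ : Fin n → Fin n → Matrix (Fin n) (Fin n) ℝ := fun a b =>
    Matrix.of fun i c => pd a (pd b fun z => jacobian φ z i c) y with hddJ
  set dΓ' : Fin n → Fin n → Matrix (Fin n) (Fin n) ℝ := fun a b =>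
    Matrix.of fun c d => pd a (AEGeom.christoffel g' c b d) y with hdΓ'
  set dA : Fin n → Fin n → Matrix (Fin n) (Fin n) ℝ := fun a b =>
    Matrix.of fun k i => pd a (fun z => A b z k i) y with hdA
  -- the gauge transformation
  have hgauge : ∀ z ∈ O, ∀ a k b, ∑ c, jacobian φ z k c * AEGeom.christoffel g' c a b z
      = pd a (fun w => jacobian φ w k b) z + ∑ j, A a z k j * jacobian φ z j b := by
    intro z hz a k b
    rw [H.christoffel hz]
    congr 1
    simp only [hA, pullbackConnection, Matrix.of_apply, Finset.sum_mul]
    rw [Finset.sum_comm]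
    exact Finset.sum_congr rfl fun j _ => Finset.sum_congr rfl fun i _ => by ring
  have hG : ∀ a, J * Γ' a y = dJ a + A a y * J := fun a => by
    ext k b
    simpa [Matrix.mul_apply, hΓ', hdJ, hJ] using hgauge y hy a k b
  have hAd : ∀ a k i, DifferentiableAt ℝ (fun z => A a z k i) y := fun a k i => by
    simp only [hA, pullbackConnection, Matrix.of_apply]
    exact DifferentiableAt.fun_sum fun m _ => (H.differentiableAt_jacobian hy m a).mul
      (H.differentiableAt_comp (hΓs k m i) hy)
  -- its derivative
  have hdG : ∀ a b, dJ b * Γ' a y + J * dΓ' b a = ddJ b a + (dA b a * J + A a y * dJ b) := by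
    intro a b
    ext k d
    have e : EqOn (fun z => ∑ c, jacobian φ z k c * AEGeom.christoffel g' c a d z)
        (fun z => pd a (fun w => jacobian φ w k d) z + ∑ j, A a z k j * jacobian φ z j d) O :=
      fun z hz => hgauge z hz a k d
    have h1 := pd_congr H.isOpen_source e b hy
    have hΓ'd : ∀ c, DifferentiableAt ℝ (AEGeom.christoffel g' c a d) y := fun c =>
      differentiableAt_of_contDiffOn H.isOpen_source (hΓ's c a d) hy
    have s1 := pd_sum (f := fun c z => jacobian φ z k c * AEGeom.christoffel g' c a d z)
      Finset.univ (fun c _ => (H.differentiableAt_jacobian hy k c).mul (hΓ'd c)) b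
    have s2 := pd_sum (f := fun j z => A a z k j * jacobian φ z j d)
      Finset.univ (fun j _ => (hAd a k j).mul (H.differentiableAt_jacobian hy j d)) b
    have hpj : DifferentiableAt ℝ (fun z => pd a (fun w => jacobian φ w k d) z) y :=
      differentiableAt_of_contDiffOn H.isOpen_source
        (contDiffOn_pd H.isOpen_source (H.contDiffOn_jacobian k d) a) hy
    have s0 := pd_add (f := fun z => pd a (fun w => jacobian φ w k d) z)
      (g := fun z => ∑ j, A a z k j * jacobian φ z j d) hpj
      (DifferentiableAt.fun_sum fun j _ => (hAd a k j).mul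
        (H.differentiableAt_jacobian hy j d)) b
    rw [s1, s0, s2] at h1
    have h2 : ∀ c, pd b (fun z => jacobian φ z k c * AEGeom.christoffel g' c a d z) y
        = pd b (fun z => jacobian φ z k c) y * AEGeom.christoffel g' c a d y
          + J k c * pd b (AEGeom.christoffel g' c a d) y := fun c =>
      pd_mul (H.differentiableAt_jacobian hy k c) (hΓ'd c) b
    have h3 : ∀ j, pd b (fun z => A a z k j * jacobian φ z j d) y
        = pd b (fun z => A a z k j) y * J j d
          + A a y k j * pd b (fun z => jacobian φ z j d) y := fun j =>
      pd_mul (hAd a k j) (H.differentiableAt_jacobian hy j d) b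
    simp only [h2, h3, Finset.sum_add_distrib] at h1
    simpa only [Matrix.add_apply, Matrix.mul_apply, hdJ, hΓ', hdΓ', hddJ, hdA, Matrix.of_apply]
      using h1
  have hddJs : ddJ a b = ddJ b a := by
    ext i c
    exact pd_comm H.isOpen_source (H.contDiffOn_jacobian i c) hy a b
  have hF : J * (dΓ' a b - dΓ' b a + (Γ' a y * Γ' b y - Γ' b y * Γ' a y))
      = (dA a b - dA b a + (A a y * A b y - A b y * A a y)) * J := by
    have q1 : J * dΓ' a b = ddJ a b + (dA a b * J + A b y * dJ a) - dJ a * Γ' b y :=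
      eq_sub_of_add_eq' (hdG b a)
    have q2 : J * dΓ' b a = ddJ b a + (dA b a * J + A a y * dJ b) - dJ b * Γ' a y :=
      eq_sub_of_add_eq' (hdG a b)
    have q3 : J * (Γ' a y * Γ' b y) = dJ a * Γ' b y + A a y * (dJ b + A b y * J) := by
      rw [← Matrix.mul_assoc, hG a, Matrix.add_mul, Matrix.mul_assoc, hG b]
    have q4 : J * (Γ' b y * Γ' a y) = dJ b * Γ' a y + A b y * (dJ a + A a y * J) := by
      rw [← Matrix.mul_assoc, hG b, Matrix.add_mul, Matrix.mul_assoc, hG a]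
    rw [Matrix.mul_add, Matrix.mul_sub, Matrix.mul_sub, q1, q2, q3, q4, hddJs]
    noncomm_ring
  have hriem' : ∀ c d, AEGeom.riem g' c d a b y
      = (dΓ' a b - dΓ' b a + (Γ' a y * Γ' b y - Γ' b y * Γ' a y)) c d := by
    intro c d
    simp only [AEGeom.riem, Matrix.add_apply, Matrix.sub_apply, Matrix.mul_apply, hdΓ', hΓ',
      Matrix.of_apply, Finset.sum_sub_distrib]
  have hcurv : ∀ i, (dA a b - dA b a + (A a y * A b y - A b y * A a y)) k i
      = ∑ p, ∑ m, J p a * J m b * AEGeom.riem g k i p m (φ y) := fun i => by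
    rw [← H.curvature_pullbackConnection hy k i a b]
    rfl
  have hfinal := congrFun (congrFun hF k) d
  rw [Matrix.mul_apply, Matrix.mul_apply] at hfinal
  simp only [hriem']
  rw [hfinal]
  exact Finset.sum_congr rfl fun i _ => by rw [hcurv i]

/-- The Ricci tensor is a tensor. -/
lemma ric (H : IsPullback O U φ g g') {y : Eu n} (hy : y ∈ O) (a b : Fin n) :
    ric g' a b y = ∑ i, ∑ j, jacobian φ y i a * jacobian φ y j b * AEGeom.ric g i j (φ y) := by
  set J := jacobian φ y with hJ
  have hinv : ∀ c d e, AEGeom.riem g' c a d e y = ∑ k, J⁻¹ c k * ∑ i,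
      (∑ p, ∑ m, J p d * J m e * AEGeom.riem g k i p m (φ y)) * J i a := by
    intro c d e
    have h1 : ∀ c', ∑ k, J⁻¹ c k * J k c' = kron c c' := fun c' => by
      have := congrFun (congrFun (H.jacobian_inv_mul hy) c) c'
      rwa [Matrix.mul_apply] at this
    calc AEGeom.riem g' c a d e y = ∑ c', kron c c' * AEGeom.riem g' c' a d e y := by
          simp [kron, Matrix.one_apply]
      _ = ∑ k, J⁻¹ c k * ∑ c', J k c' * AEGeom.riem g' c' a d e y := by
          simp only [← h1, Finset.sum_mul, Finset.mul_sum]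
          rw [Finset.sum_comm]
          exact Finset.sum_congr rfl fun k _ => Finset.sum_congr rfl fun c' _ => by ring
      _ = _ := Finset.sum_congr rfl fun k _ => congrArg (J⁻¹ c k * ·) (H.riem hy k a d e)
  have h2 : ∀ p k, ∑ c, J p c * J⁻¹ c k = kron p k := fun p k => by
    have := congrFun (congrFun (H.jacobian_mul_inv hy) p) k
    rwa [Matrix.mul_apply] at this
  calc AEGeom.ric g' a b y = ∑ c, ∑ k, J⁻¹ c k * ∑ i,
      (∑ p, ∑ m, J p c * J m b * AEGeom.riem g k i p m (φ y)) * J i a := by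
        simp only [AEGeom.ric, hinv]
    _ = ∑ k, ∑ i, ∑ p, ∑ m, (∑ c, J p c * J⁻¹ c k)
          * (J i a * J m b * AEGeom.riem g k i p m (φ y)) := by
        rw [Finset.sum_comm]
        refine Finset.sum_congr rfl fun k _ => ?_
        simp only [Finset.mul_sum, Finset.sum_mul]
        rw [Finset.sum_comm]
        refine Finset.sum_congr rfl fun i _ => ?_
        rw [Finset.sum_comm]
        refine Finset.sum_congr rfl fun p _ => ?_
        rw [Finset.sum_comm]
        exact Finset.sum_congr rfl fun m _ => Finset.sum_congr rfl fun c _ => by ring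
    _ = ∑ k, ∑ i, ∑ m, J i a * J m b * AEGeom.riem g k i k m (φ y) := by
        simp only [h2]
        refine Finset.sum_congr rfl fun k _ => Finset.sum_congr rfl fun i _ => ?_
        rw [Finset.sum_comm]
        refine Finset.sum_congr rfl fun m _ => ?_
        simp [kron, Matrix.one_apply]
    _ = _ := by
        rw [Finset.sum_comm]
        refine Finset.sum_congr rfl fun i _ => ?_
        rw [Finset.sum_comm]
        exact Finset.sum_congr rfl fun j _ => by rw [AEGeom.ric, Finset.mul_sum]

/-- Traces of tensors do not depend on the coordinates. -/
lemma trace2 (H : IsPullback O U φ g g') {T T' : Fin n → Fin n → Eu n → ℝ} {y : Eu n}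
    (hy : y ∈ O)
    (hT : ∀ a b, T' a b y = ∑ i, ∑ j, jacobian φ y i a * jacobian φ y j b * T i j (φ y)) :
    trace2 g' T' y = AEGeom.trace2 g T (φ y) := by
  have hJ : ∀ i j, ∑ a, ∑ b, jacobian φ y i a * (g' y)⁻¹ a b * jacobian φ y j b
      = ginv g i j (φ y) := by
    intro i j
    have := congrFun (congrFun (H.jacobian_mul_inv_mul hy) i) j
    simp only [Matrix.mul_apply, Matrix.transpose_apply, Finset.sum_mul] at this
    rw [Finset.sum_comm, this]
    rfl
  simp only [AEGeom.trace2, ← hJ, hT, Finset.mul_sum, Finset.sum_mul]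
  calc _ = ∑ a, ∑ i, ∑ j, ∑ b, ginv g' a b y
          * (jacobian φ y i a * jacobian φ y j b * T i j (φ y)) :=
        Finset.sum_congr rfl fun a _ => by
          rw [Finset.sum_comm]
          exact Finset.sum_congr rfl fun i _ => Finset.sum_comm
    _ = ∑ i, ∑ a, ∑ j, ∑ b, ginv g' a b y
          * (jacobian φ y i a * jacobian φ y j b * T i j (φ y)) := Finset.sum_comm
    _ = ∑ i, ∑ j, ∑ a, ∑ b, ginv g' a b y
          * (jacobian φ y i a * jacobian φ y j b * T i j (φ y)) :=
        Finset.sum_congr rfl fun i _ => Finset.sum_comm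
    _ = _ := Finset.sum_congr rfl fun i _ => Finset.sum_congr rfl fun j _ =>
        Finset.sum_congr rfl fun a _ => Finset.sum_congr rfl fun b _ => by
          simp only [ginv]
          ring

/-- `|T|²_g` is the trace of the tensor `g^{jl} T_{ij} T_{kl}` in the indices `i, k`. -/
lemma normSq2_eq_trace2 (g : Eu n → Matrix (Fin n) (Fin n) ℝ) (T : Fin n → Fin n → Eu n → ℝ)
    (x : Eu n) : normSq2 g T x = AEGeom.trace2 g (fun i k y =>
      AEGeom.trace2 g (fun j l _ => T i j y * T k l y) y) x := by
  simp only [normSq2, AEGeom.trace2, Finset.mul_sum]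
  refine Finset.sum_congr rfl fun i _ => ?_
  rw [Finset.sum_comm]
  exact Finset.sum_congr rfl fun k _ => Finset.sum_congr rfl fun j _ =>
    Finset.sum_congr rfl fun l _ => by ring

lemma normSq2 (H : IsPullback O U φ g g') {T T' : Fin n → Fin n → Eu n → ℝ} {y : Eu n}
    (hy : y ∈ O)
    (hT : ∀ a b, T' a b y = ∑ i, ∑ j, jacobian φ y i a * jacobian φ y j b * T i j (φ y)) :
    normSq2 g' T' y = AEGeom.normSq2 g T (φ y) := by
  rw [normSq2_eq_trace2, normSq2_eq_trace2]
  refine H.trace2 hy fun a c => ?_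
  have h1 : ∀ a, ∀ b, T' a b y = ∑ j, jacobian φ y j b * ∑ i, jacobian φ y i a * T i j (φ y) := by
    intro a b
    rw [hT, Finset.sum_comm]
    refine Finset.sum_congr rfl fun j _ => ?_
    rw [Finset.mul_sum]
    exact Finset.sum_congr rfl fun i _ => by ring
  rw [H.trace2 (T := fun j l _ => (∑ i, jacobian φ y i a * T i j (φ y))
    * ∑ k, jacobian φ y k c * T k l (φ y)) hy fun b d => ?_]
  · simp only [AEGeom.trace2, Finset.sum_mul_sum]
    simp only [Finset.mul_sum]
    calc _ = ∑ j, ∑ i, ∑ l, ∑ k, ginv g j l (φ y) * (jacobian φ y i a * T i j (φ y)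
              * (jacobian φ y k c * T k l (φ y))) :=
          Finset.sum_congr rfl fun j _ => Finset.sum_comm
      _ = ∑ i, ∑ j, ∑ l, ∑ k, ginv g j l (φ y) * (jacobian φ y i a * T i j (φ y)
              * (jacobian φ y k c * T k l (φ y))) := Finset.sum_comm
      _ = ∑ i, ∑ j, ∑ k, ∑ l, ginv g j l (φ y) * (jacobian φ y i a * T i j (φ y)
              * (jacobian φ y k c * T k l (φ y))) :=
          Finset.sum_congr rfl fun i _ => Finset.sum_congr rfl fun j _ => Finset.sum_comm
      _ = ∑ i, ∑ k, ∑ j, ∑ l, ginv g j l (φ y) * (jacobian φ y i a * T i j (φ y)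
              * (jacobian φ y k c * T k l (φ y))) :=
          Finset.sum_congr rfl fun i _ => Finset.sum_comm
      _ = _ := Finset.sum_congr rfl fun i _ => Finset.sum_congr rfl fun k _ =>
          Finset.sum_congr rfl fun j _ => Finset.sum_congr rfl fun l _ => by ring
  · rw [h1, h1, Finset.sum_mul_sum]
    exact Finset.sum_congr rfl fun j _ => Finset.sum_congr rfl fun l _ => by ring

/-- The Hessian is a tensor. -/
lemma hess (H : IsPullback O U φ g g') {f f' : Eu n → ℝ} (hf : ContDiffOn ℝ ∞ f U)
    (hff : EqOn f' (fun y => f (φ y)) O) {y : Eu n} (hy : y ∈ O) (a b : Fin n) :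
    hess g' f' a b y
      = ∑ i, ∑ j, jacobian φ y i a * jacobian φ y j b * AEGeom.hess g f i j (φ y) := by
  set J := jacobian φ y with hJ
  have h1 : ∀ c, EqOn (pd c f') (fun z => ∑ i, pd i f (φ z) * jacobian φ z i c) O :=
      fun c z hz => by
    rw [pd_congr H.isOpen_source hff c hz, H.pd_comp hf hz]
  have hpf : ∀ i, ContDiffOn ℝ ∞ (pd i f) U := fun i => contDiffOn_pd H.isOpen_target hf i
  have h2 : pd a (pd b f') y = ∑ j, ((∑ i, pd i (pd j f) (φ y) * J i a) * J j b
      + pd j f (φ y) * pd a (fun z => jacobian φ z j b) y) := by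
    rw [pd_congr H.isOpen_source (h1 b) a hy]
    have s1 := pd_sum (f := fun j z => pd j f (φ z) * jacobian φ z j b) Finset.univ
      (fun j _ => (H.differentiableAt_comp (hpf j) hy).mul (H.differentiableAt_jacobian hy j b)) a
    rw [s1]
    refine Finset.sum_congr rfl fun j _ => ?_
    have s2 := pd_mul (f := fun z => pd j f (φ z)) (g := fun z => jacobian φ z j b)
      (H.differentiableAt_comp (hpf j) hy) (H.differentiableAt_jacobian hy j b) a
    rw [s2, H.pd_comp (hpf j) hy]
  have h3 : ∑ c, AEGeom.christoffel g' c a b y * pd c f' y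
      = ∑ k, pd k f (φ y) * (pd a (fun z => jacobian φ z k b) y
        + ∑ i, ∑ j, AEGeom.christoffel g k i j (φ y) * (J i a * J j b)) := by
    calc _ = ∑ c, ∑ k, AEGeom.christoffel g' c a b y * (pd k f (φ y) * J k c) :=
          Finset.sum_congr rfl fun c _ => by rw [h1 c hy, Finset.mul_sum]
      _ = ∑ k, pd k f (φ y) * ∑ c, J k c * AEGeom.christoffel g' c a b y := by
          rw [Finset.sum_comm]
          simp only [Finset.mul_sum]
          exact Finset.sum_congr rfl fun k _ => Finset.sum_congr rfl fun c _ => by ring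
      _ = _ := Finset.sum_congr rfl fun k _ => by rw [hJ, H.christoffel hy]
  simp only [AEGeom.hess, h2, h3, mul_add, mul_sub, Finset.sum_add_distrib,
    Finset.sum_sub_distrib]
  have e1 : ∑ j, (∑ i, pd i (pd j f) (φ y) * J i a) * J j b
      = ∑ i, ∑ j, J i a * J j b * pd i (pd j f) (φ y) := by
    simp only [Finset.sum_mul]
    rw [Finset.sum_comm]
    exact Finset.sum_congr rfl fun i _ => Finset.sum_congr rfl fun j _ => by ring
  have e2 : ∑ k, pd k f (φ y) * ∑ i, ∑ j, AEGeom.christoffel g k i j (φ y) * (J i a * J j b)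
      = ∑ i, ∑ j, J i a * J j b * ∑ k, AEGeom.christoffel g k i j (φ y) * pd k f (φ y) := by
    simp only [Finset.mul_sum]
    rw [Finset.sum_comm]
    refine Finset.sum_congr rfl fun i _ => ?_
    rw [Finset.sum_comm]
    exact Finset.sum_congr rfl fun j _ => Finset.sum_congr rfl fun k _ => by ring
  rw [e1, e2]
  ring

/-- The `Q`-curvature is a scalar. -/
theorem qcurv (H : IsPullback O U φ g g') {y : Eu n} (hy : y ∈ O) :
    qcurv g' y = AEGeom.qcurv g (φ y) := by
  have hs : EqOn (scal g') (fun z => scal g (φ z)) O := fun z hz => H.trace2 hz (H.ric hz)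
  have hl : lap g' (scal g') y = lap g (scal g) (φ y) :=
    H.trace2 hy (H.hess (contDiffOn_scal H.isOpen_target H.smooth_metric H.det_ne_zero) hs hy)
  simp only [AEGeom.qcurv, hl, hs hy, H.normSq2 hy (H.ric hy)]

end IsPullback

end Invariance

/-! ### The metric of a Riemannian manifold in different charts -/

section Charts

variable {n : ℕ} {M : Type*} [TopologicalSpace M] [ChartedSpace (Eu n) M]
  {e Φ : OpenPartialHomeomorph M (Eu n)}

lemma contDiffOn_transition (he : e ∈ IsManifold.maximalAtlas (𝓡 n) ∞ M)
    (hΦ : Φ ∈ IsManifold.maximalAtlas (𝓡 n) ∞ M) :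
    ContDiffOn ℝ ∞ (fun y => Φ (e.symm y)) (e.symm.trans Φ).source :=
  contMDiffOn_iff_contDiffOn.mp <| (contMDiffOn_of_mem_maximalAtlas hΦ).comp
    ((contMDiffOn_symm_of_mem_maximalAtlas he).mono fun _ hy => hy.1) fun _ hy => hy.2

lemma differentiableAt_transition (he : e ∈ IsManifold.maximalAtlas (𝓡 n) ∞ M)
    (hΦ : Φ ∈ IsManifold.maximalAtlas (𝓡 n) ∞ M) {y : Eu n} (hy : y ∈ (e.symm.trans Φ).source) :
    DifferentiableAt ℝ (fun y => Φ (e.symm y)) y :=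
  ((contDiffOn_transition he hΦ).contDiffAt ((e.symm.trans Φ).open_source.mem_nhds hy))
    |>.differentiableAt (by simp)

/-- The Jacobian of a change of coordinates is invertible. -/
lemma jacobian_transition_det_ne_zero (he : e ∈ IsManifold.maximalAtlas (𝓡 n) ∞ M)
    (hΦ : Φ ∈ IsManifold.maximalAtlas (𝓡 n) ∞ M) {y : Eu n} (hy : y ∈ (e.symm.trans Φ).source) :
    (jacobian (fun y => Φ (e.symm y)) y).det ≠ 0 := by
  have hy' : Φ (e.symm y) ∈ (Φ.symm.trans e).source := by
    refine ⟨Φ.map_source hy.2, ?_⟩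
    change Φ.symm (Φ (e.symm y)) ∈ e.source
    rw [Φ.left_inv (show e.symm y ∈ Φ.source from hy.2)]
    exact e.map_target hy.1
  have hφ := differentiableAt_transition he hΦ hy
  have hψ := differentiableAt_transition hΦ he hy'
  have hprod : jacobian (fun z => e (Φ.symm z)) (Φ (e.symm y)) * jacobian (fun y => Φ (e.symm y)) y
      = 1 := by
    ext i a
    have hψi : DifferentiableAt ℝ (fun z => e (Φ.symm z) i) (Φ (e.symm y)) :=
      (EuclideanSpace.proj (𝕜 := ℝ) i).differentiableAt.comp _ hψ
    have h1 := pd_comp hψi hφ a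
    have h2 : EqOn (fun z => e (Φ.symm (Φ (e.symm z))) i) (fun z => z i)
        (e.symm.trans Φ).source := fun z hz => by
      change e (Φ.symm (Φ (e.symm z))) i = z i
      rw [Φ.left_inv (show e.symm z ∈ Φ.source from hz.2), e.right_inv hz.1]
    rw [pd_congr (e.symm.trans Φ).open_source h2 a hy] at h1
    have h3 : pd a (fun z : Eu n => z i) y = (1 : Matrix (Fin n) (Fin n) ℝ) i a := by
      rw [pd_component (φ := fun z => z) differentiableAt_id]
      simp [Matrix.one_apply]
    rw [← h3, h1, Matrix.mul_apply]
    rfl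
  intro h0
  have := congrArg Matrix.det hprod
  rw [Matrix.det_mul, h0, mul_zero, Matrix.det_one] at this
  exact zero_ne_one this

variable [RiemannianBundle (fun x : M => TangentSpace (𝓡 n) x)]

/-- The Riemannian metric at `x` as a bilinear form on `ℝⁿ`, to which the tangent space at every
point is definitionally equal. -/
def metricAt (x : M) : LinearMap.BilinForm ℝ (Eu n) :=
  LinearMap.mk₂ ℝ (fun v w => @inner ℝ (TangentSpace (𝓡 n) x) _ v w)
    (fun u v w => inner_add_left (E := TangentSpace (𝓡 n) x) u v w)
    (fun c v w => real_inner_smul_left (F := TangentSpace (𝓡 n) x) v w c)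
    (fun u v w => inner_add_right (E := TangentSpace (𝓡 n) x) u v w)
    (fun c v w => real_inner_smul_right (F := TangentSpace (𝓡 n) x) v w c)

lemma metricInChart_symm (e : OpenPartialHomeomorph M (Eu n)) (y : Eu n) (a b : Fin n) :
    metricInChart e y a b = metricInChart e y b a :=
  real_inner_comm (F := TangentSpace (𝓡 n) (e.symm y)) _ _

/-- The transformation law of the components of the metric. -/
lemma metricInChart_transition (he : e ∈ IsManifold.maximalAtlas (𝓡 n) ∞ M)
    (hΦ : Φ ∈ IsManifold.maximalAtlas (𝓡 n) ∞ M) {y : Eu n} (hy : y ∈ (e.symm.trans Φ).source)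
    (a b : Fin n) :
    metricInChart e y a b = ∑ i, ∑ j, jacobian (fun y => Φ (e.symm y)) y i a
      * jacobian (fun y => Φ (e.symm y)) y j b * metricInChart Φ (Φ (e.symm y)) i j := by
  set φ : Eu n → Eu n := fun y => Φ (e.symm y) with hφ
  have hφd : DifferentiableAt ℝ φ y := differentiableAt_transition he hΦ hy
  have hev : (e.symm : Eu n → M) =ᶠ[𝓝 y] Φ.symm ∘ φ := by
    filter_upwards [(e.symm.trans Φ).open_source.mem_nhds hy] with z hz
    exact (Φ.left_inv hz.2).symm
  have hbase : e.symm y = Φ.symm (φ y) := hev.eq_of_nhds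
  have hsymm : MDifferentiableAt (𝓡 n) (𝓡 n) Φ.symm (φ y) :=
    ((contMDiffOn_symm_of_mem_maximalAtlas hΦ).contMDiffAt
      (Φ.open_target.mem_nhds (Φ.map_source hy.2))).mdifferentiableAt (by simp)
  -- the chain rule for `e⁻¹ = Φ⁻¹ ∘ φ`
  have hchain : ∀ v : Eu n, (mfderiv (𝓡 n) (𝓡 n) e.symm y v : Eu n)
      = mfderiv (𝓡 n) (𝓡 n) Φ.symm (φ y) (fderiv ℝ φ y v : Eu n) := by
    intro v
    have h1 := hev.mfderiv_eq (I := 𝓡 n) (I' := 𝓡 n)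
    rw [mfderiv_comp y hsymm hφd.mdifferentiableAt, mfderiv_eq_fderiv] at h1
    exact DFunLike.congr_fun h1 v
  have hcol : ∀ a, fderiv ℝ φ y (EuclideanSpace.single a 1)
      = ∑ i, jacobian φ y i a • EuclideanSpace.single i (1 : ℝ) := by
    intro a
    ext j
    simp [jacobian, pd_component hφd, Pi.single_apply]
  let w : Fin n → Eu n := fun i =>
    mfderiv (𝓡 n) (𝓡 n) Φ.symm (φ y) (EuclideanSpace.single i (1 : ℝ) : Eu n)
  have hvec : ∀ a, (mfderiv (𝓡 n) (𝓡 n) e.symm y (EuclideanSpace.single a (1 : ℝ) : Eu n) : Eu n)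
      = ∑ i, jacobian φ y i a • w i := by
    intro a
    rw [hchain, hcol]
    exact (map_sum (mfderiv (𝓡 n) (𝓡 n) Φ.symm (φ y)) _ _).trans
      (Finset.sum_congr rfl fun i _ => map_smul (mfderiv (𝓡 n) (𝓡 n) Φ.symm (φ y)) _ _)
  have hw : ∀ i j, metricInChart Φ (φ y) i j = metricAt (Φ.symm (φ y)) (w i) (w j) :=
    fun _ _ => rfl
  have hexp : metricInChart e y a b
      = metricAt (e.symm y) (∑ i, jacobian φ y i a • w i) (∑ j, jacobian φ y j b • w j) :=
    congrArg₂ (fun v w => metricAt (e.symm y) v w) (hvec a) (hvec b)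
  rw [hbase] at hexp
  rw [hexp]
  simp only [map_sum, map_smul, LinearMap.sum_apply, LinearMap.smul_apply, smul_eq_mul,
    Finset.mul_sum]
  rw [Finset.sum_comm]
  exact Finset.sum_congr rfl fun i _ => Finset.sum_congr rfl fun j _ => by
    rw [← mul_assoc, mul_comm (jacobian φ y j b), hw]

end Charts

/-! ### The `Q`-curvature in the chart at infinity -/

section Integrability

variable {n : ℕ} {M : Type*} [TopologicalSpace M] [ChartedSpace (Eu n) M]
  [RiemannianBundle (fun x : M => TangentSpace (𝓡 n) x)]
  {Φ : OpenPartialHomeomorph M (Eu n)}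

/-- The function `qCurvature`, which is computed in the preferred charts of `M`, is given in the
chart `Φ` by the `Q`-curvature of the components of the metric in that chart. -/
lemma qCurvature_symm [IsManifold (𝓡 n) ∞ M]
    (hΦ : Φ ∈ IsManifold.maximalAtlas (𝓡 n) ∞ M) {U : Set (Eu n)}
    (hU : IsOpen U) (hUΦ : U ⊆ Φ.target)
    (hg : ∀ i j, ContDiffOn ℝ ∞ (fun x => metricInChart Φ x i j) U)
    (hdet : ∀ x ∈ U, (metricInChart Φ x).det ≠ 0) {x : Eu n} (hx : x ∈ U) :
    qCurvature n M (Φ.symm x) = qcurv (metricInChart Φ) x := by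
  set e := chartAt (Eu n) (Φ.symm x) with he_def
  have he : e ∈ IsManifold.maximalAtlas (𝓡 n) ∞ M := IsManifold.chart_mem_maximalAtlas _
  set O : Set (Eu n) := (e.symm.trans Φ).source ∩ (e.symm.trans Φ) ⁻¹' U with hO
  have H : IsPullback O U (fun y => Φ (e.symm y)) (metricInChart Φ) (metricInChart e) :=
    { isOpen_source := (e.symm.trans Φ).isOpen_inter_preimage hU
      isOpen_target := hU
      smooth := (contDiffOn_transition he hΦ).mono inter_subset_left
      mapsTo := fun y hy => hy.2
      smooth_metric := hg
      symm := metricInChart_symm Φ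
      det_ne_zero := hdet
      jacobian_ne_zero := fun y hy => jacobian_transition_det_ne_zero he hΦ hy.1
      pullback := fun y hy a b => metricInChart_transition he hΦ hy.1 a b }
  have hsrc : Φ.symm x ∈ e.source := mem_chart_source _ _
  have hinv : e.symm (e (Φ.symm x)) = Φ.symm x := e.left_inv hsrc
  have hval : Φ (e.symm (e (Φ.symm x))) = x := by rw [hinv, Φ.right_inv (hUΦ hx)]
  have hy : e (Φ.symm x) ∈ O := by
    refine ⟨⟨e.map_source hsrc, ?_⟩, ?_⟩
    · change e.symm (e (Φ.symm x)) ∈ Φ.source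
      rw [hinv]
      exact Φ.map_target (hUΦ hx)
    · change Φ (e.symm (e (Φ.symm x))) ∈ U
      rwa [hval]
  have := H.qcurv hy
  rwa [hval] at this

/-- Where the volume density is bounded below, integrability for the Riemannian volume implies
integrability for the Lebesgue measure of the chart. -/
lemma integrableOn_chart [MeasurableSpace M] [BorelSpace M]
    (hΦ : Φ ∈ IsManifold.maximalAtlas (𝓡 n) ∞ M) {f : M → ℝ}
    (hf : Integrable f (riemannianVolume n M)) {U : Set (Eu n)} (hU : IsOpen U)
    (hUΦ : U ⊆ Φ.target) (hdet : ∀ x ∈ U, 1 / 4 < (metricInChart Φ x).det) :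
    IntegrableOn (fun x => f (Φ.symm x)) U := by
  set ρ : Eu n → ℝ≥0∞ := fun y => ENNReal.ofReal (Real.sqrt (metricInChart Φ y).det) with hρ
  set ν := (volume.restrict Φ.target).withDensity ρ with hν
  have hle : chartVolume Φ ≤ riemannianVolume n M :=
    le_iSup₂ (f := fun (e : OpenPartialHomeomorph M (Eu n))
      (_ : e ∈ IsManifold.maximalAtlas (𝓡 n) ∞ M) => chartVolume e) Φ hΦ
  have h1 : Integrable f (Measure.map Φ.symm ν) := hf.mono_measure hle
  have hmeas : AEMeasurable Φ.symm ν :=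
    (Φ.continuousOn_symm.aemeasurable Φ.open_target.measurableSet).mono_ac
      (withDensity_absolutelyContinuous _ _)
  have h2 : Integrable (fun x => f (Φ.symm x)) ν :=
    (integrable_map_measure h1.aestronglyMeasurable hmeas).mp h1
  have hlow : (2⁻¹ : ℝ≥0∞) • volume.restrict U ≤ ν := by
    calc (2⁻¹ : ℝ≥0∞) • volume.restrict U
        = (volume.restrict U).withDensity fun _ => 2⁻¹ := (withDensity_const _).symm
      _ ≤ (volume.restrict U).withDensity ρ := by
          refine withDensity_mono ((ae_restrict_iff' hU.measurableSet).mpr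
            (Eventually.of_forall fun x hx => ?_))
          have h3 : (2⁻¹ : ℝ) ≤ Real.sqrt (metricInChart Φ x).det :=
            Real.le_sqrt_of_sq_le (by have := hdet x hx; norm_num at this ⊢; linarith)
          calc (2⁻¹ : ℝ≥0∞) = ENNReal.ofReal 2⁻¹ := by
                rw [ENNReal.ofReal_inv_of_pos two_pos]; norm_num
            _ ≤ ρ x := ENNReal.ofReal_le_ofReal h3
      _ = ν.restrict U := by
          rw [hν, restrict_withDensity hU.measurableSet,
            Measure.restrict_restrict hU.measurableSet, inter_eq_left.mpr hUΦ]
      _ ≤ ν := Measure.restrict_le_self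
  exact (integrable_smul_measure (by simp) (by simp)).mp (h2.mono_measure hlow)

end Integrability

end AEGeom

end

theorem theorem1p2 (n : ℕ) (hn : 3 ≤ n)
    (M : Type*) [EMetricSpace M] [ChartedSpace (AEGeom.Eu n) M] [IsManifold (𝓡 n) ∞ M]
    [RiemannianBundle (fun x : M => TangentSpace (𝓡 n) x)]
    [IsContMDiffRiemannianBundle (𝓡 n) ∞ (AEGeom.Eu n) (fun x : M => TangentSpace (𝓡 n) x)]
    [IsRiemannianManifold (𝓡 n) M]
    [CompleteSpace M] [ConnectedSpace M] [SecondCountableTopology M]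
    [MeasurableSpace M] [BorelSpace M]
    (Φ : OpenPartialHomeomorph M (AEGeom.Eu n)) (k : ℕ) (p : ℝ≥0∞) (τ : ℝ)
    (hkp : (5 ≤ k ∧ (n : ℝ≥0∞) < p) ∨ (4 ≤ k ∧ p = ⊤))
    (hτ : max 0 (((n : ℝ) - 4) / 2) < τ)
    (hAE : AEGeom.IsAEChart Φ k p τ)
    (hQ : Integrable (AEGeom.qCurvature n M) (AEGeom.riemannianVolume n M)) :
    ∃ energy limitG : ℝ,
      Tendsto (AEGeom.energyFlux (AEGeom.metricInChart Φ)) atTop (𝓝 energy) ∧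
      Tendsto (AEGeom.jEinsteinFlux (AEGeom.metricInChart Φ)) atTop (𝓝 limitG) ∧
      ((n : ℝ) - 4) / (8 * ((n : ℝ) - 1)) * energy = -limitG ∧
      (AEGeom.JFlat n M → energy = 0) := by
  obtain ⟨R₀, hR₀, htarget⟩ := hAE.target_eq
  set g := AEGeom.metricInChart Φ with hg
  have hτ0 : 0 < τ := hAE.order_pos
  have hτ4 : (n : ℝ) < 2 * τ + 4 := by
    have := (le_max_right 0 (((n : ℝ) - 4) / 2)).trans_lt hτ
    linarith
  have hsub : AEGeom.exterior n (max R₀ 1) ⊆ Φ.target := by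
    intro x hx
    rw [htarget]
    simpa using (le_max_left R₀ 1).trans_lt hx
  have hsd : ∀ i j, AEGeom.SymbolDecay (2 * max R₀ 1) 4 τ (fun x => g x i j - AEGeom.kron i j) :=
    fun i j => AEGeom.WeightedSobolev.symbolDecay (by omega) hkp hτ0 (le_max_right _ _)
      (AEGeom.WeightedSobolev.mono (hAE.decay i j) hsub)
  obtain ⟨R', h, hRR', hdet, H, hh⟩ := AEGeom.exists_metricApprox
    (by positivity) hτ0 hsd (AEGeom.metricInChart_symm Φ)
  have hsub' : AEGeom.exterior n R' ⊆ Φ.target := fun x hx => hsub <| by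
    have h1 : (1 : ℝ) ≤ max R₀ 1 := le_max_right _ _
    have h2 : R' < ‖x‖ := hx
    change max R₀ 1 < ‖x‖
    linarith
  have hopen := AEGeom.isOpen_exterior (n := n) R'
  have hsmooth : ∀ i j, ContDiffOn ℝ ∞ (fun x => g x i j) (AEGeom.exterior n R') := fun i j =>
    (((hAE.decay i j).1.mono hsub').add (contDiffOn_const (c := AEGeom.kron i j))).congr
      fun x _ => by simp [hg]
  have hint : IntegrableOn (AEGeom.qcurv g) (AEGeom.exterior n R') := by
    refine (AEGeom.integrableOn_chart hAE.mem_maximalAtlas hQ hopen hsub' hdet).congr_fun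
      (fun x hx => ?_) hopen.measurableSet
    exact AEGeom.qCurvature_symm hAE.mem_maximalAtlas hopen hsub' hsmooth
      (fun x hx => ((by norm_num : (0 : ℝ) < 1 / 4).trans (hdet x hx)).ne') hx
  obtain ⟨energy, limitG, h1, h2, h3, h4⟩ := H.energy_identity hn hτ4 hh hint
  exact ⟨energy, limitG, h1, h2, h3, fun hJ => h4 fun x hx i j =>
    hJ Φ hAE.mem_maximalAtlas x (hsub' hx) i j⟩
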